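/- **Setting.** Let $\mathbf C,\mathbf D$ be symmetric monoidal categories and $F:\mathbf C\to\mathbf D$ a faithful (strong) symmetric monoidal functor. A *super-operator* over $F$ is a family of functions $\Xi_{H;X}^{K;X}:\mathbf C(H\otimes X,K\otimes X)\to\mathbf D(FH,FK)$, indexed by all objects $H,K,X$ of $\mathbf C$. It is a *time-travel super-operator* if (modulo the structural isomorphisms of $F$, $\mathbf C$, $\mathbf D$): 1. (naturality) $\Xi((g\otimes 1_X)\circ\Phi\circ(f\otimes 1_X))=F(g)\circ\Xi(\Phi)\circ F(f)$ for $f:H'\to H$, $\Phi:H\otimes X\to K\otimes X$, $g:K\to K'$; 2. (strength) $\Xi(g\otimes\Phi)=F(g)\otimes\Xi(\Phi)$ for $g:A\to B$; 3. (sliding) $\Xi_{H;X}^{K;X}((1_K\otimes f)\circ\Phi)=\Xi_{H;Y}^{K;Y}(\Phi\circ(1_H\otimes f))$ for $\Phi:H\otimes X\to K\otimes Y$, $f:Y\to X$; 4. (vanishing) $\Xi_{H;I}^{K;I}(\Phi)=F(\Phi)$, where $I$ is the tensor unit and $\Phi:H\otimes I\to K\otimes I$ is identified with a morphism $H\to K$.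 A *framed causal graph* is a finite digraph such that $x\to y$ and $y\to z$ imply $x\not\to z$, with a totally ordered set of input nodes (each with no incoming and exactly one outgoing edge), a totally ordered set of output nodes (each with no outgoing and exactly one incoming edge), and total orders on the incoming and on the outgoing edges of each node, compatible with the orders of the inputs and of the outputs. The other nodes are *internal*. The graph is *CR* if it is acyclic. It is *CV-local* if each simple directed cycle has at most one node of (total) degree higher than $2$; its simple cycles are then called *CTCs*, and a node of degree higher than $2$ on a CTC is called an *interaction node*. A *diagram* over the graph in $\mathbf C$ assigns to each edge an object and to each internal node a morphism from the ordered tensor product of its incoming edges to that of its outgoing edges. A diagram over a CR graph is interpreted as a morphism of $\mathbf C$, from the tensor product of the input edges to that of the output edges, by drawing each internal node exactly once and connecting along the edges, with symmetries where wires cross. A morphism of $\mathbf D$ is *defined* by a diagram over a CV-local graph if it is obtained as follows. Cut each CTC open at one of its edges, so that each cut edge becomes an additional input/output pair. Build the resulting CR diagram as a composite, from the inputs to the outputs, of pieces that together contain each internal node exactly once, where each piece is drawn next to idle wires and is either (a) interpreted in $\mathbf C$ and embedded by $F$, or (b) a piece containing all the CTCs through one interaction node (or one CTC that has no interaction node),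 and possibly further nodes and wires of the CR region, interpreted in $\mathbf C$ as a CR diagram $\Phi:H\otimes X\to K\otimes X$, where $X$ is the tensor product, in any order, of all the cut edges of these CTCs, and then replaced by $\Xi_{H;X}^{K;X}(\Phi)$. $\Xi$ *yields well-defined morphisms* if for each diagram over each CV-local framed causal graph the CTCs can be cut open and there is a morphism of $\mathbf D$ which is defined by the diagram for every way of cutting the CTCs, and which is the only morphism so defined, whatever choices are made in cutting, decomposing and drawing. $\Xi$ *respects the embedding* if $\Xi_{H;I}^{K;I}(f)=F(f)$ for each morphism $f:H\to K$ of $\mathbf C$ defined by a diagram over a CR graph, that is, if regluing an empty collection of cut ends gives the embedded morphism. **Theorem.** If $\Xi$ is a time-travel super-operator, then it yields well-defined morphisms for diagrams over CV-local framed causal graphs. Conversely, any super-operator $\Xi$ over $F$ which yields well-defined morphisms for diagrams over CV-local framed causal graphs and respects the embedding is a time-travel super-operator, i.e. satisfies naturality, strength, sliding and vanishing. -/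

import Mathlib

open CategoryTheory MonoidalCategory

universe v₁ v₂ u₁ u₂

/-- A (finite) framed causal graph: a non-transitive digraph with ordered input nodes, ordered
output nodes and, at each node, an ordering of the incoming and of the outgoing edges. A total order
on a finite set is given as the duplicate-free list of its elements. -/
structure FramedCausalGraph where
  /-- The nodes. -/
  V : Type
  finite : Finite V
  graph : Digraph V
  nontransitive : ∀ x y z, graph.Adj x y → graph.Adj y z → ¬ graph.Adj x z
  /-- The input nodes, in order. -/
  inputs : List V
  inputs_nodup : inputs.Nodup
  /-- The output nodes, in order. -/
  outputs : List V
  outputs_nodup : outputs.Nodup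
  /-- The edges incoming to a node, in order. -/
  incoming : V → List {e : V × V // graph.Adj e.1 e.2}
  incoming_nodup : ∀ x, (incoming x).Nodup
  mem_incoming : ∀ x e, e ∈ incoming x ↔ e.1.2 = x
  /-- The edges outgoing from a node, in order. -/
  outgoing : V → List {e : V × V // graph.Adj e.1 e.2}
  outgoing_nodup : ∀ x, (outgoing x).Nodup
  mem_outgoing : ∀ x e, e ∈ outgoing x ↔ e.1.1 = x
  incoming_input : ∀ i ∈ inputs, incoming i = []
  outgoing_input : ∀ i ∈ inputs, ∃ e, outgoing i = [e]
  outgoing_output : ∀ o ∈ outputs, outgoing o = []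
  incoming_output : ∀ o ∈ outputs, ∃ e, incoming o = [e]
  /-- The order on the edges incoming to a node is compatible with the order on the inputs:
  if `e` comes before `e'` and both come from inputs, these inputs are in the same order. -/
  incoming_compatible : ∀ x e e', [e, e'].Sublist (incoming x) →
    e.1.1 ∈ inputs → e'.1.1 ∈ inputs → [e.1.1, e'.1.1].Sublist inputs
  /-- The order on the edges outgoing from a node is compatible with the order on the outputs. -/
  outgoing_compatible : ∀ x e e', [e, e'].Sublist (outgoing x) →
    e.1.2 ∈ outputs → e'.1.2 ∈ outputs → [e.1.2, e'.1.2].Sublist outputs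

namespace FramedCausalGraph

variable (G : FramedCausalGraph)

/-- The edges of the graph: pairs (source, target) of adjacent nodes. -/
abbrev Edge : Type := {e : G.V × G.V // G.graph.Adj e.1 e.2}

/-- The internal nodes: those which are neither inputs nor outputs. -/
abbrev Internal : Type := {x : G.V // x ∉ G.inputs ∧ x ∉ G.outputs}

/-- The edges leaving the inputs (exactly one for each input), in the order of the inputs. -/
def inputEdges : List G.Edge := G.inputs.flatMap G.outgoing

/-- The edges entering the outputs (exactly one for each output), in the order of the outputs. -/
def outputEdges : List G.Edge := G.outputs.flatMap G.incoming

/-- Total degree of a node. -/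
def degree (x : G.V) : ℕ := (G.incoming x).length + (G.outgoing x).length

/-- Chronology-respecting: there is no directed cycle. -/
def IsCR : Prop := ∀ x, ¬ Relation.TransGen G.graph.Adj x x

/-- Simple directed cycles: nonempty cyclic sequences of pairwise distinct nodes, each adjacent to
the next one (cyclically). In a CV-local graph these are the CTCs. -/
def IsSimpleCycle (c : Cycle G.V) : Prop :=
  c ≠ Cycle.nil ∧ c.Nodup ∧ c.Chain G.graph.Adj

variable {G} in
/-- The edge `e` lies on the cycle `c`, i.e. its source and target are consecutive nodes of `c`. -/
def Edge.LiesOn (e : G.Edge) (c : Cycle G.V) : Prop :=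
  ∃ l : List G.V, c = ((e.1.1 :: e.1.2 :: l : List G.V) : Cycle G.V)

/-- CV-local: each simple cycle has at most one node of degree higher than 2. -/
def IsCVLocal : Prop :=
  ∀ c, G.IsSimpleCycle c → ∀ x ∈ c, ∀ y ∈ c, 2 < G.degree x → 2 < G.degree y → x = y

/-- A way of cutting all the CTCs open: a set of edges lying on CTCs, exactly one on each CTC. -/
def IsCut (X : Set G.Edge) : Prop :=
  (∀ c, G.IsSimpleCycle c → ∃! e, e ∈ X ∧ e.LiesOn c) ∧
    ∀ e ∈ X, ∃ c, G.IsSimpleCycle c ∧ e.LiesOn c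

/-- Given a cut `X`, the list `E` enumerates cut edges that have to be glued together by one
application of the super-operator: either the cut edges of all the CTCs through one interaction node
`x` (a node of degree higher than 2 on a CTC), or the cut edge of a single CTC on which there is no
interaction node. -/
def IsGluingGroup (X : Set G.Edge) (E : List G.Edge) : Prop :=
  E.Nodup ∧
    ((∃ x, 2 < G.degree x ∧ (∃ c, G.IsSimpleCycle c ∧ x ∈ c) ∧
        ∀ e, e ∈ E ↔ e ∈ X ∧ ∃ c, G.IsSimpleCycle c ∧ x ∈ c ∧ e.LiesOn c) ∨
      (∃ c, G.IsSimpleCycle c ∧ (∀ x ∈ c, G.degree x ≤ 2) ∧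
        ∀ e, e ∈ E ↔ e ∈ X ∧ e.LiesOn c))

end FramedCausalGraph

section Wires

variable {C : Type u₁} [Category.{v₁} C] [MonoidalCategory C]

/-- The tensor product of the objects labelling a list of wires: `𝟙_ C` for the empty list and
`A₁ ⊗ (A₂ ⊗ (⋯ ⊗ Aₙ))` in general (without trailing unit). -/
def wireTensor {ι : Type} (obj : ι → C) : List ι → C
  | [] => 𝟙_ C
  | [i] => obj i
  | i :: j :: l => obj i ⊗ wireTensor obj (j :: l)

/-- The canonical (coherence) isomorphism splitting a list of wires in two. -/
def wireSplit {ι : Type} (obj : ι → C) :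
    ∀ l m : List ι, wireTensor obj (l ++ m) ≅ wireTensor obj l ⊗ wireTensor obj m
  | [], m => (λ_ (wireTensor obj m)).symm
  | [i], [] => (ρ_ (obj i)).symm
  | [_], _ :: _ => Iso.refl _
  | i :: j :: l, m => whiskerLeftIso (obj i) (wireSplit obj (j :: l) m) ≪≫ (α_ _ _ _).symm

/-- A morphism `f` drawn between idle wires `l` on the left and `r` on the right. -/
def wireWhisker {ι : Type} (obj : ι → C) (l r : List ι) {H K : List ι}
    (f : wireTensor obj H ⟶ wireTensor obj K) :
    wireTensor obj (l ++ H ++ r) ⟶ wireTensor obj (l ++ K ++ r) :=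
  (wireSplit obj (l ++ H) r).hom ≫
    ((wireSplit obj l H).hom ≫ (wireTensor obj l ◁ f) ≫ (wireSplit obj l K).inv) ▷
      wireTensor obj r ≫
    (wireSplit obj (l ++ K) r).inv

variable {D : Type u₂} [Category.{v₂} D] [MonoidalCategory D]

open Functor.LaxMonoidal Functor.OplaxMonoidal in
/-- A morphism `m` of `D` between images under `F`, drawn between (images of) idle wires `l` on the
left and `r` on the right. -/
def wireWhiskerMap (F : C ⥤ D) [F.Monoidal] {ι : Type} (obj : ι → C) (l r : List ι) {H K : List ι}
    (m : F.obj (wireTensor obj H) ⟶ F.obj (wireTensor obj K)) :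
    F.obj (wireTensor obj (l ++ H ++ r)) ⟶ F.obj (wireTensor obj (l ++ K ++ r)) :=
  F.map (wireSplit obj (l ++ H) r).hom ≫ δ F _ _ ≫
    (F.map (wireSplit obj l H).hom ≫ δ F _ _ ≫ (F.obj (wireTensor obj l) ◁ m) ≫ μ F _ _ ≫
      F.map (wireSplit obj l K).inv) ▷ F.obj (wireTensor obj r) ≫
    μ F _ _ ≫ F.map (wireSplit obj (l ++ K) r).inv

end Wires

/-- A family of super-operators over the functor `F : C ⥤ D`, sending each morphism
`Φ : H ⊗ X ⟶ K ⊗ X` of `C` to a morphism `F H ⟶ F K` of `D`; no law is imposed. -/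
abbrev SuperOperator {C : Type u₁} [Category.{v₁} C] [MonoidalCategory C]
    {D : Type u₂} [Category.{v₂} D] (F : C ⥤ D) : Type (max u₁ v₁ v₂) :=
  ∀ H K X : C, (H ⊗ X ⟶ K ⊗ X) → (F.obj H ⟶ F.obj K)

open Functor.LaxMonoidal Functor.OplaxMonoidal in
/-- The four laws of a time-travel super-operator. -/
structure SuperOperator.IsTimeTravel {C : Type u₁} [Category.{v₁} C] [MonoidalCategory C]
    {D : Type u₂} [Category.{v₂} D] [MonoidalCategory D] {F : C ⥤ D} [F.Monoidal]
    (Ξ : SuperOperator F) : Prop where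
  naturality : ∀ {H H' K K' X : C} (f : H' ⟶ H) (Φ : H ⊗ X ⟶ K ⊗ X) (g : K ⟶ K'),
    Ξ H' K' X (f ▷ X ≫ Φ ≫ g ▷ X) = F.map f ≫ Ξ H K X Φ ≫ F.map g
  strength : ∀ {A B H K X : C} (g : A ⟶ B) (Φ : H ⊗ X ⟶ K ⊗ X),
    Ξ (A ⊗ H) (B ⊗ K) X ((α_ A H X).hom ≫ (g ⊗ₘ Φ) ≫ (α_ B K X).inv) =
      δ F A H ≫ (F.map g ⊗ₘ Ξ H K X Φ) ≫ μ F B K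
  sliding : ∀ {H K X Y : C} (Φ : H ⊗ X ⟶ K ⊗ Y) (f : Y ⟶ X),
    Ξ H K X (Φ ≫ K ◁ f) = Ξ H K Y (H ◁ f ≫ Φ)
  vanishing : ∀ {H K : C} (Φ : H ⊗ 𝟙_ C ⟶ K ⊗ 𝟙_ C),
    Ξ H K (𝟙_ C) Φ = F.map ((ρ_ H).inv ≫ Φ ≫ (ρ_ K).hom)

/-- A diagram over a framed causal graph in `C`: an object on each edge and, on each internal node,
a morphism from the tensor product of the (ordered) incoming edges to that of the outgoing ones. -/
structure CausalDiagram (G : FramedCausalGraph) (C : Type u₁) [Category.{v₁} C]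
    [MonoidalCategory C] where
  obj : G.Edge → C
  mor : ∀ x : G.Internal, wireTensor obj (G.incoming x.1) ⟶ wireTensor obj (G.outgoing x.1)

namespace CausalDiagram

variable {C : Type u₁} [Category.{v₁} C] [MonoidalCategory C] [SymmetricCategory C]
variable {D : Type u₂} [Category.{v₂} D] [MonoidalCategory D] {F : C ⥤ D} [F.Monoidal]
variable {G : FramedCausalGraph} (d : CausalDiagram G C)

/-- `d.Draws L S M f`: the morphism `f` is obtained from the wires `L` to the wires `M` by joining
the processes at the internal nodes in `S` (listed in the order in which they are drawn) along the
edges of the graph, crossing wires where needed. -/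
inductive Draws (L : List G.Edge) :
    List G.Internal → ∀ M : List G.Edge, (wireTensor d.obj L ⟶ wireTensor d.obj M) → Prop
  | start : Draws L [] L (𝟙 _)
  | cross {S : List G.Internal} {l r : List G.Edge} {a b : G.Edge}
      {f : wireTensor d.obj L ⟶ wireTensor d.obj (l ++ [a, b] ++ r)} (h : Draws L S _ f) :
      Draws L S (l ++ [b, a] ++ r)
        (f ≫ wireWhisker d.obj l r (H := [a, b]) (K := [b, a]) (β_ (d.obj a) (d.obj b)).hom)
  | node {S : List G.Internal} {l r : List G.Edge} (x : G.Internal)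
      {f : wireTensor d.obj L ⟶ wireTensor d.obj (l ++ G.incoming x.1 ++ r)} (h : Draws L S _ f) :
      Draws L (S ++ [x]) (l ++ G.outgoing x.1 ++ r) (f ≫ wireWhisker d.obj l r (d.mor x))

/-- `f` is a morphism defined by the diagram through the interpretation of CR diagrams: all internal
nodes are drawn exactly once, starting from the input wires and ending in the output wires. -/
def IsCRMorphism (f : wireTensor d.obj G.inputEdges ⟶ wireTensor d.obj G.outputEdges) : Prop :=
  ∃ S : List G.Internal, S.Nodup ∧ (∀ x, x ∈ S) ∧ d.Draws G.inputEdges S G.outputEdges f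

/-- `d.Reglues Ξ X S M m`: the morphism `m` of `D` is obtained, from the input wires to the wires
`M`, after drawing the internal nodes in `S`, by interpreting the diagram cut open at the edges in
`X` and regluing with `Ξ`. It is a composite of pieces of two kinds.
* `embed`: a CR piece, interpreted in `C` and embedded in `D`.
* `glue`: one application of `Ξ`, to a cut-open piece. The cut-open piece is interpreted in `C` as a
  CR diagram from `H ++ E` to `K ++ E`: each cut edge `e` in `E` occurs as an additional incoming
  wire (its cut end going into the target of `e`) and as an additional outgoing wire (its cut end
  coming out of the source of `e`). All the cut edges belonging to one interaction node are glued
  together, and the CTCs that they belong to are part of the piece, which may in addition contain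
  any other nodes and wires of the CR region. -/
inductive Reglues (Ξ : SuperOperator F) (X : Set G.Edge) :
    List G.Internal → ∀ M : List G.Edge,
      (F.obj (wireTensor d.obj G.inputEdges) ⟶ F.obj (wireTensor d.obj M)) → Prop
  | start : Reglues Ξ X [] G.inputEdges (𝟙 _)
  | embed {S T : List G.Internal} {M N : List G.Edge}
      {m : F.obj (wireTensor d.obj G.inputEdges) ⟶ F.obj (wireTensor d.obj M)}
      {f : wireTensor d.obj M ⟶ wireTensor d.obj N}
      (h : Reglues Ξ X S M m) (hf : d.Draws M T N f) :
      Reglues Ξ X (S ++ T) N (m ≫ F.map f)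
  | glue {S T : List G.Internal} {l r H K E : List G.Edge}
      {m : F.obj (wireTensor d.obj G.inputEdges) ⟶ F.obj (wireTensor d.obj (l ++ H ++ r))}
      {f : wireTensor d.obj (H ++ E) ⟶ wireTensor d.obj (K ++ E)}
      (h : Reglues Ξ X S (l ++ H ++ r) m) (hE : G.IsGluingGroup X E)
      (hf : d.Draws (H ++ E) T (K ++ E) f) (hT : ∀ e ∈ E, e.1.2 ∈ T.map Subtype.val) :
      Reglues Ξ X (S ++ T) (l ++ K ++ r)
        (m ≫ wireWhiskerMap F d.obj l r
          (Ξ _ _ _ ((wireSplit d.obj H E).inv ≫ f ≫ (wireSplit d.obj K E).hom)))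

/-- `m` is a morphism defined by the diagram, cut open at the edges in `X` and reglued with `Ξ`:
all internal nodes are drawn exactly once, from the input wires to the output wires. -/
def IsMorphism (Ξ : SuperOperator F) (X : Set G.Edge)
    (m : F.obj (wireTensor d.obj G.inputEdges) ⟶ F.obj (wireTensor d.obj G.outputEdges)) : Prop :=
  ∃ S : List G.Internal, S.Nodup ∧ (∀ x, x ∈ S) ∧ d.Reglues Ξ X S G.outputEdges m

end CausalDiagram

namespace SuperOperator

variable {C : Type u₁} [Category.{v₁} C] [MonoidalCategory C] [SymmetricCategory C]
variable {D : Type u₂} [Category.{v₂} D] [MonoidalCategory D] {F : C ⥤ D}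

/-- `Ξ` yields well-defined morphisms for diagrams over CV-local framed causal graphs: the CTCs can
be cut open, and there is a morphism which is obtained for every way of cutting them open, and which
is the only one obtained, whatever choices are made in cutting, drawing and regluing. -/
def IsWellDefined [F.Monoidal] (Ξ : SuperOperator F) : Prop :=
  ∀ G : FramedCausalGraph, G.IsCVLocal → ∀ d : CausalDiagram G C,
    (∃ X, G.IsCut X) ∧
      ∃ m : F.obj (wireTensor d.obj G.inputEdges) ⟶ F.obj (wireTensor d.obj G.outputEdges),
        ∀ X, G.IsCut X → ∀ m', d.IsMorphism Ξ X m' ↔ m' = m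

/-- `Ξ` respects the embedding of the original process theory: if nothing had to be cut, that is for
a diagram over a CR graph, then regluing the empty family of cut ends (whose tensor product is
`𝟙_ C`) by `Ξ` yields the image under `F` of the morphism defined by the diagram. -/
def RespectsEmbedding (Ξ : SuperOperator F) : Prop :=
  ∀ G : FramedCausalGraph, G.IsCR → ∀ (d : CausalDiagram G C)
    (f : wireTensor d.obj G.inputEdges ⟶ wireTensor d.obj G.outputEdges), d.IsCRMorphism f →
      Ξ _ _ (𝟙_ C) ((ρ_ _).hom ≫ f ≫ (ρ_ _).inv) = F.map f

end SuperOperator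

/-!
The interpretation of a diagram with closed timelike curves is compared with a picture which does
not depend on any choice. Its basic pieces are the strongly connected components of the graph: in a
CV-local graph such a component is either a single node off the cycles, or the union of the simple
cycles through one interaction node, or one simple cycle without interaction node. Hence the cycles
glued by one application of the super-operator are exactly those of one nontrivial component
(`IsGluingGroup.exists_rep`). Each component has a representative node `rep`, which lies on all its
cycles, so that cutting the edges entering the representatives opens every cycle (`isCut_repCut`).

*From the laws to well-defined morphisms.* Cut every component open at its representative, reglue it
with the super-operator, and regard the result as a box in `D`, with the edges entering and leaving
the component as its wires (`compBoxes`). The boxes obtained in this way form an acyclic diagram,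
and four facts show that every cutting, decomposing and drawing yields the same morphism.

* *Order independence* (`BoxSystem.Run.unique`). A morphism drawn from boxes whose wires remain
  pairwise distinct does not depend on the order of the boxes nor on the crossings. It rests on the
  coherence of symmetries (`WirePerm.unique`) and on the interchange law. In a diagram whose cycles
  have been cut open, the wires remain pairwise distinct because the number of wires present from a
  given cycle never changes (`CausalDiagram.countP_liesOn_eq`, `CausalDiagram.safe_of_good`).
* *Independence of the cut* (`toMapWires_wiresGlue_eq`). Two ways of cutting a component open differ
  by nodes of degree two which sit before the representative in one of them and after it in the
  other (`exists_slide`). Sliding moves these nodes across the reglued wires.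
* *Independence of the decomposition* (`exists_glue_decomposition`). A reglued piece consists of
  nodes before the component, the component, and nodes after it, next to idle wires. Naturality
  splits off the former and the latter, and strength the idle wires.
* *Embedded pieces* (`run_compBoxes_of_run`). A component with a single node has no cut edge, so by
  vanishing its box is the image under `F` of the process at this node.

Consequently each defined morphism is drawn from the same boxes, one for each representative
(`Reglues.exists_run`). Some morphism is defined for each cut, as the components can be drawn one
after the other, starting from those which cannot be reached from the others (`exists_isMorphism`).

*From well-defined morphisms to the laws.* Each law states that two morphisms agree which are
defined by one and the same diagram. For naturality, two processes next to the cycle are either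
embedded or part of the reglued piece; for strength, likewise for a process on a separate strand;
for sliding, a cycle with two nodes is cut open at either of its two edges (`Loop`, `Strands`).
Vanishing is the compatibility with the embedding, for a graph with a single internal node
(`Segment`).
-/

/-! ### Tensor products of lists of wires -/

section Wiring

variable {C : Type u₁} [Category.{v₁} C] [MonoidalCategory C]

variable {ι : Type} (obj : ι → C)

/-- The tensor product of the objects labelling a list of wires, nested to the right and with a
trailing unit. Unlike for `wireTensor`, the last wire is not special, which allows for inductions
with a single step. -/
def wires : List ι → C
  | [] => 𝟙_ C
  | i :: l => obj i ⊗ wires l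

/-- The canonical isomorphism splitting a list of wires in two. -/
def wiresSplit : ∀ l m : List ι, wires obj (l ++ m) ≅ wires obj l ⊗ wires obj m
  | [], m => (λ_ (wires obj m)).symm
  | i :: l, m => whiskerLeftIso (obj i) (wiresSplit l m) ≪≫ (α_ _ _ _).symm

/-- The identification of the wires of two equal lists. -/
def wiresCast {M N : List ι} (h : M = N) : wires obj M ⟶ wires obj N :=
  eqToHom (by rw [h])

variable {obj}

@[simp] lemma wiresCast_rfl (M : List ι) : wiresCast obj (rfl : M = M) = 𝟙 _ := rfl

@[simp]
lemma wiresCast_trans {M N O : List ι} (h : M = N) (h' : N = O) :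
    wiresCast obj h ≫ wiresCast obj h' = wiresCast obj (h.trans h') := by
  subst h h'; simp

@[simp]
lemma wiresCast_trans_assoc {M N O : List ι} (h : M = N) (h' : N = O) {Z : C}
    (f : wires obj O ⟶ Z) :
    wiresCast obj h ≫ wiresCast obj h' ≫ f = wiresCast obj (h.trans h') ≫ f := by
  rw [← Category.assoc, wiresCast_trans]

lemma whiskerLeft_wiresCast (i : ι) {M N : List ι} (h : M = N) :
    obj i ◁ wiresCast obj h = wiresCast obj (congrArg (i :: ·) h) := by
  subst h; simp [wires]

/-- A morphism drawn to the right of idle wires. -/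
def wiresLeft {M N : List ι} (f : wires obj M ⟶ wires obj N) :
    ∀ l : List ι, wires obj (l ++ M) ⟶ wires obj (l ++ N)
  | [] => f
  | i :: l => obj i ◁ wiresLeft f l

/-- A morphism drawn to the left of idle wires. -/
def wiresRight {M N : List ι} (f : wires obj M ⟶ wires obj N) (r : List ι) :
    wires obj (M ++ r) ⟶ wires obj (N ++ r) :=
  (wiresSplit obj M r).hom ≫ f ▷ wires obj r ≫ (wiresSplit obj N r).inv

lemma wiresLeft_eq {M N : List ι} (f : wires obj M ⟶ wires obj N) (l : List ι) :
    wiresLeft f l = (wiresSplit obj l M).hom ≫ wires obj l ◁ f ≫ (wiresSplit obj l N).inv := by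
  induction l with
  | nil => simp [wiresLeft, wiresSplit, wires]
  | cons i l ih =>
    -- An identity of structural morphisms is proved for arbitrary objects in place of tensor
    -- products of wires, which it yields upon unfolding `wires`. This is the part played by each
    -- of the facts `key` about objects of a category.
    have key : ∀ {A L X Y U V : C} (s : U ≅ L ⊗ X) (t : V ≅ L ⊗ Y) (g : X ⟶ Y),
        A ◁ (s.hom ≫ L ◁ g ≫ t.inv) = (whiskerLeftIso A s ≪≫ (α_ A L X).symm).hom ≫
          (A ⊗ L) ◁ g ≫ (whiskerLeftIso A t ≪≫ (α_ A L Y).symm).inv := by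
      intros; simp
    rw [wiresLeft, ih]
    exact key _ _ _

@[simp] lemma wiresLeft_id (M l : List ι) : wiresLeft (𝟙 (wires obj M)) l = 𝟙 _ := by
  simp [wiresLeft_eq]

lemma wiresLeft_comp {M N O : List ι} (f : wires obj M ⟶ wires obj N)
    (g : wires obj N ⟶ wires obj O) (l : List ι) :
    wiresLeft (f ≫ g) l = wiresLeft f l ≫ wiresLeft g l := by
  simp [wiresLeft_eq]

lemma wiresLeft_comp_assoc {M N O : List ι} (f : wires obj M ⟶ wires obj N)
    (g : wires obj N ⟶ wires obj O) (l : List ι) {Z : C} (h : wires obj (l ++ O) ⟶ Z) :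
    wiresLeft (f ≫ g) l ≫ h = wiresLeft f l ≫ wiresLeft g l ≫ h := by
  rw [wiresLeft_comp, Category.assoc]

@[simp] lemma wiresRight_id (M r : List ι) : wiresRight (𝟙 (wires obj M)) r = 𝟙 _ := by
  simp [wiresRight]

lemma wiresRight_comp {M N O : List ι} (f : wires obj M ⟶ wires obj N)
    (g : wires obj N ⟶ wires obj O) (r : List ι) :
    wiresRight (f ≫ g) r = wiresRight f r ≫ wiresRight g r := by
  simp [wiresRight]

lemma wiresRight_comp_assoc {M N O : List ι} (f : wires obj M ⟶ wires obj N)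
    (g : wires obj N ⟶ wires obj O) (r : List ι) {Z : C} (h : wires obj (O ++ r) ⟶ Z) :
    wiresRight (f ≫ g) r ≫ h = wiresRight f r ≫ wiresRight g r ≫ h := by
  rw [wiresRight_comp, Category.assoc]

lemma wiresRight_whiskerLeft (i : ι) {M N : List ι} (f : wires obj M ⟶ wires obj N)
    (r : List ι) :
    wiresRight (M := i :: M) (N := i :: N) (obj i ◁ f) r = obj i ◁ wiresRight f r := by
  simp [wiresRight, wiresSplit, wires]

lemma wires_exchange {H K M N : List ι} (f : wires obj H ⟶ wires obj K)
    (g : wires obj M ⟶ wires obj N) :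
    wiresRight f M ≫ wiresLeft g K = wiresLeft g H ≫ wiresRight f N := by
  simp [wiresLeft_eq, wiresRight, ← whisker_exchange_assoc]

lemma wires_exchange_assoc {H K M N : List ι} (f : wires obj H ⟶ wires obj K)
    (g : wires obj M ⟶ wires obj N) {Z : C} (h : wires obj (K ++ N) ⟶ Z) :
    wiresRight f M ≫ wiresLeft g K ≫ h = wiresLeft g H ≫ wiresRight f N ≫ h := by
  rw [← Category.assoc, wires_exchange, Category.assoc]

lemma wiresSplit_assoc (l m n : List ι) :
    (wiresSplit obj (l ++ m) n).hom ≫ (wiresSplit obj l m).hom ▷ wires obj n ≫ (α_ _ _ _).hom =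
      wiresCast obj (List.append_assoc ..) ≫ (wiresSplit obj l (m ++ n)).hom ≫
        wires obj l ◁ (wiresSplit obj m n).hom := by
  induction l with
  | nil =>
    have : ∀ h : ([] ++ m) ++ n = [] ++ (m ++ n), wiresCast obj h = 𝟙 _ := fun _ => rfl
    rw [this]
    simp [wiresSplit, wires]
  | cons i l ih =>
    have key : ∀ {A L M N U V T X : C} (s : U ⟶ V ⊗ N) (t : V ⟶ L ⊗ M) (c : U ⟶ T)
        (u : T ⟶ L ⊗ X) (v : X ⟶ M ⊗ N) (_ : s ≫ t ▷ N ≫ (α_ _ _ _).hom = c ≫ u ≫ L ◁ v),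
        (A ◁ s ≫ (α_ A V N).inv) ≫ (A ◁ t ≫ (α_ A L M).inv) ▷ N ≫ (α_ _ _ _).hom =
          A ◁ c ≫ (A ◁ u ≫ (α_ A L X).inv) ≫ (A ⊗ L) ◁ v := by
      intro A L M N U V T X s t c u v h
      have h2 := congrArg (fun f => A ◁ f ≫ (α_ A L (M ⊗ N)).inv) h
      simp only [whiskerLeft_comp, Category.assoc] at h2
      simp only [Category.assoc, ← associator_inv_naturality_right]
      rw [← h2]
      simp
    have h := key (A := obj i) _ _ _ _ _ ih
    rw [whiskerLeft_wiresCast] at h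
    exact h

lemma wiresRight_wiresRight {M N : List ι} (f : wires obj M ⟶ wires obj N) (r s : List ι) :
    wiresRight (wiresRight f r) s = wiresCast obj (List.append_assoc ..) ≫
      wiresRight f (r ++ s) ≫ wiresCast obj (List.append_assoc ..).symm := by
  have h1 := wiresSplit_assoc (obj := obj) M r s
  have h2 := wiresSplit_assoc (obj := obj) N r s
  have h1' : wiresCast obj (List.append_assoc M r s) ≫ (wiresSplit obj M (r ++ s)).hom =
      (wiresSplit obj (M ++ r) s).hom ≫ (wiresSplit obj M r).hom ▷ wires obj s ≫
        (α_ _ _ _).hom ≫ wires obj M ◁ (wiresSplit obj r s).inv := by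
    have := congrArg (· ≫ wires obj M ◁ (wiresSplit obj r s).inv) h1
    simpa using this.symm
  have h2' : (wiresSplit obj N (r ++ s)).inv ≫ wiresCast obj (List.append_assoc N r s).symm =
      wires obj N ◁ (wiresSplit obj r s).hom ≫ (α_ _ _ _).inv ≫
        (wiresSplit obj N r).inv ▷ wires obj s ≫ (wiresSplit obj (N ++ r) s).inv := by
    have h3 : wiresCast obj (List.append_assoc N r s) ≫ (wiresSplit obj N (r ++ s)).hom =
      (wiresSplit obj (N ++ r) s).hom ≫ (wiresSplit obj N r).hom ▷ wires obj s ≫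
        (α_ _ _ _).hom ≫ wires obj N ◁ (wiresSplit obj r s).inv := by
      have := congrArg (· ≫ wires obj N ◁ (wiresSplit obj r s).inv) h2
      simpa using this.symm
    rw [Iso.inv_comp_eq]
    have h4 := congrArg (wiresCast obj (List.append_assoc N r s).symm ≫ ·) h3
    simp only [wiresCast_trans_assoc, wiresCast_rfl, Category.id_comp] at h4
    rw [h4]
    simp [← whiskerLeft_comp_assoc, ← comp_whiskerRight_assoc]
  simp only [wiresRight, Category.assoc]
  rw [h2', ← Category.assoc (wiresCast obj _), h1']
  simp only [Category.assoc, comp_whiskerRight]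
  simp [whisker_exchange_assoc]

lemma wiresSplit_nil (l : List ι) :
    (wiresSplit obj l []).hom = wiresCast obj (List.append_nil l) ≫ (ρ_ _).inv := by
  induction l with
  | nil =>
    have key : (λ_ (𝟙_ C)).inv = 𝟙 _ ≫ (ρ_ (𝟙_ C)).inv := by simp [unitors_inv_equal]
    exact key
  | cons i l ih =>
    have key : ∀ {A L U : C} (s : U ≅ L ⊗ 𝟙_ C) (t : U ⟶ L), s.hom = t ≫ (ρ_ L).inv →
        (whiskerLeftIso A s ≪≫ (α_ A L (𝟙_ C)).symm).hom = A ◁ t ≫ (ρ_ (A ⊗ L)).inv := by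
      intro A L U s t h
      simp [h]
    have h := key (A := obj i) _ _ ih
    rw [whiskerLeft_wiresCast] at h
    exact h

lemma wiresRight_nil {M N : List ι} (f : wires obj M ⟶ wires obj N) :
    wiresRight f [] = wiresCast obj (List.append_nil M) ≫ f ≫
      wiresCast obj (List.append_nil N).symm := by
  have key : ∀ {M N U V : C} (s : U ≅ M ⊗ 𝟙_ C) (t : V ≅ N ⊗ 𝟙_ C) (c : U ⟶ M) (b : V ⟶ N)
      (b' : N ⟶ V) (f : M ⟶ N), b ≫ b' = 𝟙 _ → s.hom = c ≫ (ρ_ M).inv → t.hom = b ≫ (ρ_ N).inv →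
      s.hom ≫ f ▷ 𝟙_ C ≫ t.inv = c ≫ f ≫ b' := by
    intro M N U V s t c b b' f hb hs ht
    have : t.inv = (ρ_ N).hom ≫ b' := by
      rw [← cancel_epi t.hom, Iso.hom_inv_id, ht]; simp [hb]
    rw [hs, this]; simp
  exact key _ _ _ _ _ _ (by simp) (wiresSplit_nil M) (wiresSplit_nil N)

end Wiring

/-! ### Exchanges of wires -/

section Swap

variable {C : Type u₁} [Category.{v₁} C] [MonoidalCategory C] [SymmetricCategory C]

/-- The exchange of the first two factors of a right-nested tensor product. -/
def tensorSwap (A B Z : C) : A ⊗ B ⊗ Z ⟶ B ⊗ A ⊗ Z :=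
  (α_ A B Z).inv ≫ (β_ A B).hom ▷ Z ≫ (α_ B A Z).hom

lemma tensorSwap_tensorSwap (A B Z : C) : tensorSwap A B Z ≫ tensorSwap B A Z = 𝟙 _ := by
  simp [tensorSwap, ← comp_whiskerRight_assoc]

lemma tensorSwap_naturality (A B : C) {Z Z' : C} (f : Z ⟶ Z') :
    tensorSwap A B Z ≫ B ◁ A ◁ f = A ◁ B ◁ f ≫ tensorSwap A B Z' := by
  simp only [tensorSwap, Category.assoc]
  rw [← associator_naturality_right, ← whisker_exchange_assoc,
    associator_inv_naturality_right_assoc]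

lemma tensorSwap_yang_baxter (A B X Z : C) :
    tensorSwap A B (X ⊗ Z) ≫ B ◁ tensorSwap A X Z ≫ tensorSwap B X (A ⊗ Z) =
      A ◁ tensorSwap B X Z ≫ tensorSwap A X (B ⊗ Z) ≫ X ◁ tensorSwap A B Z := by
  have h := congrArg (fun t => (A ◁ (α_ B X Z).inv ≫ (α_ A (B ⊗ X) Z).inv) ≫ t ▷ Z ≫
    ((α_ X (B ⊗ A) Z).hom ≫ X ◁ (α_ B A Z).hom)) (BraidedCategory.yang_baxter A B X)
  simp only [tensorSwap]
  calc _ = _ := ?_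
    _ = _ := h
    _ = _ := ?_
  · monoidal
  · monoidal

variable {ι : Type} {obj : ι → C}

lemma wiresRight_tensorSwap (a b : ι) (M r : List ι) :
    wiresRight (M := a :: b :: M) (N := b :: a :: M)
      (tensorSwap (obj a) (obj b) (wires obj M)) r =
      tensorSwap (obj a) (obj b) (wires obj (M ++ r)) := by
  have key : ∀ {A B Z R U : C} (s : U ≅ Z ⊗ R),
      (whiskerLeftIso A (whiskerLeftIso B s ≪≫ (α_ B Z R).symm) ≪≫ (α_ A (B ⊗ Z) R).symm).hom ≫
        tensorSwap A B Z ▷ R ≫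
        (whiskerLeftIso B (whiskerLeftIso A s ≪≫ (α_ A Z R).symm) ≪≫
          (α_ B (A ⊗ Z) R).symm).inv = tensorSwap A B U := by
    intro A B Z R U s
    have h : (α_ A (B ⊗ Z) R).inv ≫ tensorSwap A B Z ▷ R ≫ (α_ B (A ⊗ Z) R).hom =
        A ◁ (α_ B Z R).hom ≫ tensorSwap A B (Z ⊗ R) ≫ B ◁ (α_ A Z R).inv := by
      simp only [tensorSwap]; monoidal
    simp only [Iso.trans_hom, Iso.trans_inv, whiskerLeftIso_hom, whiskerLeftIso_inv,
      Iso.symm_hom, Iso.symm_inv, Category.assoc, whiskerLeft_comp]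
    rw [reassoc_of% h]
    simp only [← whiskerLeft_comp_assoc, ← whiskerLeft_comp, Iso.inv_hom_id,
      whiskerLeft_id, Category.id_comp, Iso.inv_hom_id_assoc]
    rw [tensorSwap_naturality]
    simp [← whiskerLeft_comp_assoc]
  exact key _

/-- The braiding of two lists of wires. -/
def wiresBraid (l m : List ι) : wires obj (l ++ m) ⟶ wires obj (m ++ l) :=
  (wiresSplit obj l m).hom ≫ (β_ _ _).hom ≫ (wiresSplit obj m l).inv

@[simp]
lemma wiresBraid_wiresBraid (l m : List ι) :
    wiresBraid l m ≫ wiresBraid m l = 𝟙 (wires obj (l ++ m)) := by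
  simp [wiresBraid]

@[simp]
lemma wiresBraid_wiresBraid_assoc (l m : List ι) {Z : C} (f : wires obj (l ++ m) ⟶ Z) :
    wiresBraid l m ≫ wiresBraid m l ≫ f = f := by
  rw [← Category.assoc, wiresBraid_wiresBraid, Category.id_comp]

lemma wiresBraid_naturality_left {M N : List ι} (f : wires obj M ⟶ wires obj N) (l : List ι) :
    wiresRight f l ≫ wiresBraid N l = wiresBraid M l ≫ wiresLeft f l := by
  simp [wiresBraid, wiresLeft_eq, wiresRight]

lemma wiresBraid_naturality_left_assoc {M N : List ι} (f : wires obj M ⟶ wires obj N)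
    (l : List ι) {Z : C} (h : wires obj (l ++ N) ⟶ Z) :
    wiresRight f l ≫ wiresBraid N l ≫ h = wiresBraid M l ≫ wiresLeft f l ≫ h := by
  rw [← Category.assoc, wiresBraid_naturality_left, Category.assoc]

end Swap

/-! ### Coherence of permutations of wires -/

section WirePerm

variable {C : Type u₁} [Category.{v₁} C] [MonoidalCategory C] [SymmetricCategory C]
variable {ι : Type} {obj : ι → C}

variable (obj) in
/-- The morphisms which only permute wires, generated by the exchanges of adjacent wires. The
constructors follow those of `List.Perm`. -/
inductive WirePerm : ∀ M N : List ι, (wires obj M ⟶ wires obj N) → Prop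
  | refl (M : List ι) : WirePerm M M (𝟙 _)
  | cons (i : ι) {M N : List ι} {f : wires obj M ⟶ wires obj N} (h : WirePerm M N f) :
      WirePerm (i :: M) (i :: N) (obj i ◁ f)
  | swap (a b : ι) (M : List ι) :
      WirePerm (a :: b :: M) (b :: a :: M) (tensorSwap (obj a) (obj b) (wires obj M))
  | trans {M N O : List ι} {f : wires obj M ⟶ wires obj N} {g : wires obj N ⟶ wires obj O}
      (hf : WirePerm M N f) (hg : WirePerm N O g) : WirePerm M O (f ≫ g)

/-- The wire `a` is moved past the wires in `l`, to the front. -/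
def wiresToFront (a : ι) : ∀ l r : List ι, wires obj (l ++ a :: r) ⟶ wires obj (a :: (l ++ r))
  | [], _ => 𝟙 _
  | i :: l, r => obj i ◁ wiresToFront a l r ≫ tensorSwap (obj i) (obj a) (wires obj (l ++ r))

/-- The first wire `a` is moved past the wires in `l`. -/
def wiresFromFront (a : ι) : ∀ l r : List ι, wires obj (a :: (l ++ r)) ⟶ wires obj (l ++ a :: r)
  | [], _ => 𝟙 _
  | i :: l, r => tensorSwap (obj a) (obj i) (wires obj (l ++ r)) ≫ obj i ◁ wiresFromFront a l r

lemma wiresFromFront_eq (a : ι) (l r : List ι) :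
    wiresFromFront a l r = obj a ◁ (wiresSplit obj l r).hom ≫
      tensorSwap (obj a) (wires obj l) (wires obj r) ≫ (wiresSplit obj l (a :: r)).inv := by
  induction l with
  | nil =>
    have key : ∀ A R : C, 𝟙 _ = A ◁ (λ_ R).inv ≫ tensorSwap A (𝟙_ C) R ≫ (λ_ (A ⊗ R)).hom := by
      intro A R
      simp [tensorSwap]
    exact key _ _
  | cons i l ih =>
    have key : ∀ {A B L R U V : C} (s : U ≅ L ⊗ R) (t : V ≅ L ⊗ A ⊗ R),
        tensorSwap A B U ≫ B ◁ (A ◁ s.hom ≫ tensorSwap A L R ≫ t.inv) =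
        A ◁ (whiskerLeftIso B s ≪≫ (α_ B L R).symm).hom ≫ tensorSwap A (B ⊗ L) R ≫
          (whiskerLeftIso B t ≪≫ (α_ B L (A ⊗ R)).symm).inv := by
      intro A B L R U V s t
      have h : tensorSwap A B (L ⊗ R) ≫ B ◁ tensorSwap A L R =
          A ◁ (α_ B L R).inv ≫ tensorSwap A (B ⊗ L) R ≫ (α_ B L (A ⊗ R)).hom := by
        simp only [tensorSwap, BraidedCategory.braiding_tensor_right_hom]
        monoidal
      simp only [whiskerLeft_comp, Iso.trans_hom, Iso.trans_inv, whiskerLeftIso_hom,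
        whiskerLeftIso_inv, Iso.symm_hom, Iso.symm_inv, Category.assoc]
      rw [← reassoc_of% h, reassoc_of% tensorSwap_naturality]
    rw [wiresFromFront, ih]
    exact key _ _

lemma wiresBraid_cons (a : ι) (l m : List ι) :
    wiresBraid (a :: l) m =
      (obj a ◁ wiresBraid l m : obj a ⊗ wires obj (l ++ m) ⟶ _) ≫ wiresFromFront a m l := by
  have key : ∀ {A L M U V W : C} (s : U ≅ L ⊗ M) (t : V ≅ M ⊗ L) (u : W ≅ M ⊗ A ⊗ L),
      (whiskerLeftIso A s ≪≫ (α_ A L M).symm).hom ≫ (β_ (A ⊗ L) M).hom ≫ u.inv =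
      A ◁ (s.hom ≫ (β_ L M).hom ≫ t.inv) ≫ A ◁ t.hom ≫ tensorSwap A M L ≫ u.inv := by
    intro A L M U V W s t u
    simp only [tensorSwap, BraidedCategory.braiding_tensor_left_hom]
    simp
  rw [wiresFromFront_eq]
  exact key _ _ _

namespace WirePerm

lemma perm {M N : List ι} {f : wires obj M ⟶ wires obj N} (h : WirePerm obj M N f) :
    M.Perm N := by
  induction h with
  | refl M => exact .refl _
  | cons i _ ih => exact ih.cons i
  | swap a b M => exact .swap _ _ _
  | trans _ _ h1 h2 => exact h1.trans h2

lemma exists_of_perm {M N : List ι} (h : M.Perm N) : ∃ f, WirePerm obj M N f := by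
  induction h with
  | nil => exact ⟨_, .refl _⟩
  | cons i _ ih => exact ⟨_, ih.choose_spec.cons i⟩
  | swap a b M => exact ⟨_, .swap _ _ _⟩
  | trans _ _ h1 h2 => exact ⟨_, h1.choose_spec.trans h2.choose_spec⟩

lemma exists_inv {M N : List ι} {f : wires obj M ⟶ wires obj N} (h : WirePerm obj M N f) :
    ∃ g, WirePerm obj N M g ∧ f ≫ g = 𝟙 _ ∧ g ≫ f = 𝟙 _ := by
  induction h with
  | refl M => exact ⟨_, .refl _, by simp, by simp⟩
  | cons i _ ih =>
    obtain ⟨g, hg, h1, h2⟩ := ih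
    refine ⟨_, hg.cons i, ?_, ?_⟩
    · exact (whiskerLeft_comp (obj i) _ _).symm.trans
        ((congrArg (obj i ◁ ·) h1).trans (by simp [wires]))
    · exact (whiskerLeft_comp (obj i) _ _).symm.trans
        ((congrArg (obj i ◁ ·) h2).trans (by simp [wires]))
  | swap a b M => exact ⟨_, .swap _ _ _, tensorSwap_tensorSwap _ _ _, tensorSwap_tensorSwap _ _ _⟩
  | trans _ _ h1 h2 =>
    obtain ⟨g, hg, h1, h1'⟩ := h1
    obtain ⟨g', hg', h2, h2'⟩ := h2
    exact ⟨_, hg'.trans hg, by simp [reassoc_of% h2, h1], by simp [reassoc_of% h1', h2']⟩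

lemma wiresCast {M N : List ι} (h : M = N) : WirePerm obj M N (wiresCast obj h) := by
  subst h; exact .refl _

lemma wiresLeft {M N : List ι} {f : wires obj M ⟶ wires obj N} (h : WirePerm obj M N f)
    (l : List ι) : WirePerm obj (l ++ M) (l ++ N) (wiresLeft f l) := by
  induction l with
  | nil => exact h
  | cons i l ih => exact ih.cons i

lemma wiresRight {M N : List ι} {f : wires obj M ⟶ wires obj N} (h : WirePerm obj M N f)
    (r : List ι) : WirePerm obj (M ++ r) (N ++ r) (wiresRight f r) := by
  induction h with
  | refl M => rw [wiresRight_id]; exact .refl _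
  | cons i _ ih => rw [wiresRight_whiskerLeft]; exact ih.cons i
  | swap a b M => rw [wiresRight_tensorSwap]; exact .swap _ _ _
  | trans _ _ h1 h2 => rw [wiresRight_comp]; exact h1.trans h2

lemma wiresFromFront (a : ι) (l r : List ι) :
    WirePerm obj _ _ (wiresFromFront a l r) := by
  induction l with
  | nil => exact .refl _
  | cons i l ih => exact (WirePerm.swap _ _ _).trans (ih.cons i)

lemma wiresBraid (l m : List ι) : WirePerm obj _ _ (wiresBraid l m) := by
  induction l with
  | nil =>
    have h : _root_.wiresBraid [] m = _root_.wiresCast obj (by simp) := by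
      have h1 := wiresSplit_nil (obj := obj) m
      have h2 : (wiresSplit obj m []).inv = (ρ_ _).hom ≫
          _root_.wiresCast obj (List.append_nil m).symm := by
        have key : ∀ {U M : C} (s : U ≅ M ⊗ 𝟙_ C) (c : U ⟶ M) (c' : M ⟶ U), c ≫ c' = 𝟙 _ →
            s.hom = c ≫ (ρ_ M).inv → s.inv = (ρ_ M).hom ≫ c' := by
          intro U M s c c' h h1
          rw [← cancel_epi s.hom, Iso.hom_inv_id, h1]
          simp [h]
        exact key _ _ _ (by simp) h1
      have key : ∀ {M U : C} (c : M ⟶ U), (λ_ M).inv ≫ (β_ (𝟙_ C) M).hom ≫ (ρ_ M).hom ≫ c = c := by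
        intro M U c; simp
      rw [_root_.wiresBraid, h2]
      exact key _
    rw [h]
    exact .wiresCast _
  | cons a l ih =>
    rw [wiresBraid_cons]
    exact (ih.cons a).trans (.wiresFromFront _ _ _)

/-- A permutation of wires ending with the wire `a` at some place factors through moving `a` to
the front. -/
lemma exists_toFront {M N : List ι} {f : wires obj M ⟶ wires obj N} (hf : WirePerm obj M N f)
    (a : ι) (l r : List ι) (h : N = l ++ a :: r) :
    ∃ (l' r' : List ι) (h' : M = l' ++ a :: r') (g : wires obj (l' ++ r') ⟶ wires obj (l ++ r)),
      WirePerm obj _ _ g ∧ f ≫ _root_.wiresCast obj h ≫ wiresToFront a l r =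
        _root_.wiresCast obj h' ≫ wiresToFront a l' r' ≫ obj a ◁ g := by
  induction hf generalizing l r with
  | refl M =>
    subst h
    refine ⟨l, r, rfl, 𝟙 _, .refl _, ?_⟩
    have key : ∀ {U V A : C} (f : U ⟶ A ⊗ V), 𝟙 _ ≫ 𝟙 _ ≫ f = 𝟙 _ ≫ f ≫ A ◁ 𝟙 _ := by
      intros; simp
    exact key _
  | @cons i M N f hf ih =>
    cases l with
    | nil =>
      obtain ⟨rfl, rfl⟩ := List.cons.inj h
      refine ⟨[], M, rfl, f, hf, ?_⟩
      have key : ∀ {U V A : C} (f : U ⟶ V), A ◁ f ≫ 𝟙 _ ≫ 𝟙 _ = 𝟙 _ ≫ 𝟙 _ ≫ A ◁ f := by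
        intros; simp
      exact key _
    | cons j l =>
      obtain ⟨rfl, rfl⟩ := List.cons.inj h
      obtain ⟨l', r', rfl, g, hg, e⟩ := ih l r rfl
      refine ⟨i :: l', r', rfl, _, hg.cons i, ?_⟩
      have key : ∀ {U V A B X Y : C} (f : U ⟶ V) (s : V ⟶ A ⊗ X) (t : U ⟶ A ⊗ Y) (g : Y ⟶ X),
          f ≫ 𝟙 _ ≫ s = 𝟙 _ ≫ t ≫ A ◁ g →
          B ◁ f ≫ 𝟙 _ ≫ B ◁ s ≫ tensorSwap B A X =
            𝟙 _ ≫ (B ◁ t ≫ tensorSwap B A Y) ≫ A ◁ B ◁ g := by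
        intro U V A B X Y f s t g h
        simp only [Category.id_comp, Category.assoc] at h ⊢
        rw [tensorSwap_naturality, ← whiskerLeft_comp_assoc, h, whiskerLeft_comp, Category.assoc]
      exact key _ _ _ _ e
  | swap x y M =>
    rcases l with _ | ⟨z, _ | ⟨w, l⟩⟩
    · obtain ⟨rfl, rfl⟩ := List.cons.inj h
      refine ⟨[x], M, rfl, 𝟙 _, .refl _, ?_⟩
      have key : ∀ A B X : C, tensorSwap A B X ≫ 𝟙 _ ≫ 𝟙 _ =
          𝟙 _ ≫ (A ◁ 𝟙 _ ≫ tensorSwap A B X) ≫ B ◁ 𝟙 _ := by intros; simp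
      exact key _ _ _
    · obtain ⟨rfl, h1⟩ : y = z ∧ x :: M = _ := List.cons.inj h
      obtain ⟨rfl, rfl⟩ : x = _ ∧ M = _ := List.cons.inj h1
      refine ⟨[], _, rfl, 𝟙 _, .refl _, ?_⟩
      have key : ∀ A B X : C, tensorSwap A B X ≫ 𝟙 _ ≫ B ◁ 𝟙 _ ≫ tensorSwap B A X =
          𝟙 _ ≫ 𝟙 _ ≫ A ◁ 𝟙 _ := by intros; simp [tensorSwap_tensorSwap]
      exact key _ _ _
    · obtain ⟨rfl, h1⟩ : y = z ∧ x :: M = _ := List.cons.inj h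
      obtain ⟨rfl, rfl⟩ : x = _ ∧ M = _ := List.cons.inj h1
      refine ⟨x :: y :: l, r, rfl, _, .swap _ _ _, ?_⟩
      have key : ∀ {A B X U V : C} (t : U ⟶ X ⊗ V),
          tensorSwap A B U ≫ 𝟙 _ ≫ B ◁ (A ◁ t ≫ tensorSwap A X V) ≫ tensorSwap B X (A ⊗ V) =
            𝟙 _ ≫ (A ◁ (B ◁ t ≫ tensorSwap B X V) ≫ tensorSwap A X (B ⊗ V)) ≫
              X ◁ tensorSwap A B V := by
        intro A B X U V t
        simp only [Category.id_comp, Category.assoc, whiskerLeft_comp]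
        rw [reassoc_of% tensorSwap_naturality, tensorSwap_yang_baxter]
      exact key _
  | trans h1 h2 ih1 ih2 =>
    obtain ⟨l2, r2, e2, g2, hg2, h2⟩ := ih2 l r h
    obtain ⟨l1, r1, e1, g1, hg1, h1⟩ := ih1 l2 r2 e2
    refine ⟨l1, r1, e1, _, hg1.trans hg2, ?_⟩
    have key : ∀ {A X Y Z P R S U V : C} (f : X ⟶ Y) (g : Y ⟶ Z) (p : Z ⟶ A ⊗ P)
        (s : Y ⟶ R) (t : R ⟶ A ⊗ S) (g2 : S ⟶ P) (u : X ⟶ U) (v : U ⟶ A ⊗ V) (g1 : V ⟶ S),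
        g ≫ p = s ≫ t ≫ A ◁ g2 → f ≫ s ≫ t = u ≫ v ≫ A ◁ g1 →
          (f ≫ g) ≫ p = u ≫ v ≫ A ◁ (g1 ≫ g2) := by
      intro A X Y Z P R S U V f g p s t g2 u v g1 h2 h1
      rw [Category.assoc, h2, whiskerLeft_comp, ← reassoc_of% h1]
    exact key _ _ _ _ _ _ _ _ _ h2 h1

/-- Coherence: a permutation of pairwise distinct wires is determined by the orders of the wires
before and after it. For a wire occurring twice, the exchange of its two copies may differ from the
identity. -/
theorem unique {M N : List ι} (hM : M.Nodup) {f g : wires obj M ⟶ wires obj N}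
    (hf : WirePerm obj M N f) (hg : WirePerm obj M N g) : f = g := by
  induction N generalizing M with
  | nil =>
    obtain rfl := hf.perm.eq_nil
    have h : ∀ {M N : List ι} {f : wires obj M ⟶ wires obj N} (_ : WirePerm obj M N f)
        (e : M = []), ∃ e' : M = N, f = _root_.wiresCast obj e' := by
      intro M N f hf
      induction hf with
      | refl M => exact fun _ => ⟨rfl, rfl⟩
      | cons => exact fun e => by simp at e
      | swap => exact fun e => by simp at e
      | trans h1 h2 ih1 ih2 =>
        intro e
        obtain ⟨e1, rfl⟩ := ih1 e
        obtain ⟨e2, rfl⟩ := ih2 (e1 ▸ e)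
        exact ⟨e1.trans e2, by simp⟩
    obtain ⟨_, rfl⟩ := h hf rfl
    obtain ⟨_, rfl⟩ := h hg rfl
    rfl
  | cons a N ih =>
    obtain ⟨l, r, e, f', hf', h1⟩ := hf.exists_toFront a [] N rfl
    obtain ⟨l', r', e', g', hg', h2⟩ := hg.exists_toFront a [] N rfl
    subst e
    obtain ⟨rfl, rfl⟩ : l = l' ∧ r = r' := by
      have ha : a ∉ l := fun h => by
        rw [List.nodup_append] at hM; exact hM.2.2 a h a (by simp) rfl
      have ha' : a ∉ l' := fun h => by
        rw [e', List.nodup_append] at hM; exact hM.2.2 a h a (by simp) rfl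
      have := List.append_eq_append_iff.1 e'
      rcases this with ⟨t, h3, h4⟩ | ⟨t, h3, h4⟩
      · cases t with
        | nil => simp_all
        | cons b t => simp_all
      · cases t with
        | nil => simp_all
        | cons b t => simp_all
    have hn : (l ++ r).Nodup := by
      rw [List.nodup_middle] at hM; exact hM.of_cons
    obtain rfl : f' = g' := ih hn hf' hg'
    have h := h1.trans h2.symm
    have key : ∀ {X Y : C} (f g : X ⟶ Y), f ≫ 𝟙 _ ≫ 𝟙 _ = g ≫ 𝟙 _ ≫ 𝟙 _ → f = g := by
      intro X Y f g h; simpa using h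
    exact key _ _ h

end WirePerm

end WirePerm

/-! ### Order independence of drawings -/

section Boxes

variable {C : Type u₁} [Category.{v₁} C] [MonoidalCategory C] [SymmetricCategory C]
variable {ι : Type}

lemma List.Nodup.exists_perm_append {α : Type*} {l m : List α} (hl : l.Nodup) (h : l ⊆ m) :
    ∃ r, m.Perm (l ++ r) := by
  classical
  have := (List.subperm_of_subset hl h)
  obtain ⟨r, hr⟩ := Multiset.le_iff_exists_add.1 (Multiset.coe_le.2 this)
  refine ⟨r.toList, Multiset.coe_eq_coe.1 ?_⟩
  rw [hr, ← Multiset.coe_add, Multiset.coe_toList]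

/-- A family of processes (boxes) with ordered input and output wires labelled by `ι`. -/
structure BoxSystem (obj : ι → C) (β : Type) where
  /-- The input wires of a box, in order. -/
  inp : β → List ι
  /-- The output wires of a box, in order. -/
  out : β → List ι
  /-- The process inside a box. -/
  mor : ∀ b, wires obj (inp b) ⟶ wires obj (out b)

namespace BoxSystem

variable {obj : ι → C} {β : Type} (B : BoxSystem obj β)

/-- `B.Run L S M f`: the morphism `f` from the wires `L` to the wires `M` is obtained by drawing the
boxes in the list `S`, one after the other, and permuting wires in between. -/
inductive Run (L : List ι) : List β → ∀ M : List ι, (wires obj L ⟶ wires obj M) → Prop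
  | start : Run L [] L (𝟙 _)
  | perm {S : List β} {M N : List ι} {f : wires obj L ⟶ wires obj M}
      {p : wires obj M ⟶ wires obj N} (h : Run L S M f) (hp : WirePerm obj M N p) :
      Run L S N (f ≫ p)
  | box {S : List β} {R : List ι} (b : β) {f : wires obj L ⟶ wires obj (B.inp b ++ R)}
      (h : Run L S (B.inp b ++ R) f) :
      Run L (S ++ [b]) (B.out b ++ R) (f ≫ wiresRight (B.mor b) R)

variable {B}

namespace Run

lemma of_wirePerm {L M : List ι} {p : wires obj L ⟶ wires obj M} (h : WirePerm obj L M p) :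
    B.Run L [] M p := by
  simpa using Run.start.perm h

lemma single (b : β) (R : List ι) :
    B.Run (B.inp b ++ R) [b] (B.out b ++ R) (wiresRight (B.mor b) R) := by
  simpa using Run.start.box (B := B) b

lemma append {L M N : List ι} {S T : List β} {f : wires obj L ⟶ wires obj M}
    {g : wires obj M ⟶ wires obj N} (hf : B.Run L S M f) (hg : B.Run M T N g) :
    B.Run L (S ++ T) N (f ≫ g) := by
  induction hg with
  | start => simpa using hf
  | perm _ hp ih => simpa using ih.perm hp
  | box b _ ih => simpa using ih.box b

lemma split {L M : List ι} {S T : List β} {f : wires obj L ⟶ wires obj M}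
    (hf : B.Run L (S ++ T) M f) :
    ∃ (N : List ι) (g : wires obj L ⟶ wires obj N) (h : wires obj N ⟶ wires obj M),
      B.Run L S N g ∧ B.Run N T M h ∧ f = g ≫ h := by
  generalize hU : S ++ T = U at hf
  induction hf generalizing T with
  | start =>
    obtain ⟨rfl, rfl⟩ := List.append_eq_nil_iff.1 hU
    exact ⟨_, _, _, .start, .start, by simp⟩
  | perm _ hp ih =>
    obtain ⟨N, g, h, hg, hh, rfl⟩ := ih hU
    exact ⟨N, g, _, hg, hh.perm hp, by simp⟩
  | @box S' R b f hf ih =>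
    rcases List.eq_nil_or_concat T with rfl | ⟨T, c, rfl⟩
    · rw [List.append_nil] at hU
      subst hU
      exact ⟨_, _, _, hf.box b, .start, by simp⟩
    · rw [List.concat_eq_append, ← List.append_assoc] at hU
      obtain ⟨h1, h2⟩ := List.append_inj' hU rfl
      obtain rfl : c = b := by simpa using h2
      obtain ⟨N, g, h, hg, hh, rfl⟩ := ih h1
      exact ⟨N, g, _, hg, by simpa using hh.box c, by simp⟩

lemma wirePerm {L M : List ι} {f : wires obj L ⟶ wires obj M} (hf : B.Run L [] M f) :
    WirePerm obj L M f := by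
  generalize hS : ([] : List β) = S at hf
  induction hf with
  | start => exact .refl _
  | perm _ hp ih => exact (ih hS).trans hp
  | box b _ _ => simp at hS

lemma exists_eq_of_singleton {L M : List ι} {b : β} {f : wires obj L ⟶ wires obj M}
    (hf : B.Run L [b] M f) :
    ∃ (R : List ι) (p : wires obj L ⟶ wires obj (B.inp b ++ R))
      (q : wires obj (B.out b ++ R) ⟶ wires obj M),
      WirePerm obj _ _ p ∧ WirePerm obj _ _ q ∧ f = p ≫ wiresRight (B.mor b) R ≫ q := by
  generalize hS : [b] = S at hf
  induction hf with
  | start => simp at hS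
  | perm _ hp ih =>
    obtain ⟨R, p, q, hp', hq, rfl⟩ := ih hS
    exact ⟨R, p, _, hp', hq.trans hp, by simp⟩
  | @box S R b f h ih =>
    obtain ⟨rfl, h2⟩ := List.append_inj' (s₁ := []) hS rfl
    obtain rfl : _ = b := by simpa using h2
    exact ⟨R, f, 𝟙 _, h.wirePerm, .refl _, by simp⟩

lemma flatMap_perm {L M : List ι} {S : List β} {f : wires obj L ⟶ wires obj M}
    (hf : B.Run L S M f) : (M ++ S.flatMap B.inp).Perm (L ++ S.flatMap B.out) := by
  induction hf with
  | start => simp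
  | perm _ hp ih => exact (hp.perm.symm.append_right _).trans ih
  | @box S R b f h ih =>
    simp only [List.flatMap_append, List.flatMap_singleton]
    classical
    rw [List.perm_iff_count] at ih ⊢
    intro a
    have := ih a
    simp only [List.count_append] at this ⊢
    omega

lemma wiresRight {L M : List ι} {S : List β} {f : wires obj L ⟶ wires obj M}
    (hf : B.Run L S M f) (r : List ι) : B.Run (L ++ r) S (M ++ r) (wiresRight f r) := by
  induction hf with
  | start => rw [wiresRight_id]; exact .start
  | perm _ hp ih => rw [wiresRight_comp]; exact ih.perm (hp.wiresRight r)
  | @box S R b f h ih =>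
    rw [wiresRight_comp, wiresRight_wiresRight, ← Category.assoc, ← Category.assoc]
    exact (Run.box b (ih.perm (.wiresCast _))).perm (.wiresCast _)

lemma wiresLeft {L M : List ι} {S : List β} {f : wires obj L ⟶ wires obj M}
    (hf : B.Run L S M f) (l : List ι) : B.Run (l ++ L) S (l ++ M) (wiresLeft f l) := by
  have h : _root_.wiresLeft f l = wiresBraid l L ≫ _root_.wiresRight f l ≫ wiresBraid M l := by
    rw [wiresBraid_naturality_left, wiresBraid_wiresBraid_assoc]
  rw [h]
  simpa using (of_wirePerm (.wiresBraid l L)).append ((hf.wiresRight l).perm (.wiresBraid M l))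

end Run

/-- Two boxes drawn one after the other on disjoint sets of wires can be drawn in either order. -/
lemma interchange (x y : β) (r : List ι) :
    wiresRight (B.mor x) (B.inp y ++ r) ≫
      (wiresCast obj (List.append_assoc ..).symm ≫ wiresRight (wiresBraid _ _) r ≫
        wiresCast obj (List.append_assoc ..)) ≫ wiresRight (B.mor y) (B.out x ++ r) =
    (wiresCast obj (List.append_assoc ..).symm ≫ wiresRight (wiresBraid _ _) r ≫
        wiresCast obj (List.append_assoc ..)) ≫
      wiresRight (B.mor y) (B.inp x ++ r) ≫
      (wiresCast obj (List.append_assoc ..).symm ≫ wiresRight (wiresBraid _ _) r ≫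
        wiresCast obj (List.append_assoc ..)) ≫
      wiresRight (B.mor x) (B.out y ++ r) ≫
      (wiresCast obj (List.append_assoc ..).symm ≫ wiresRight (wiresBraid _ _) r ≫
        wiresCast obj (List.append_assoc ..)) := by
  have key : ∀ {M N : List ι} (f : wires obj M ⟶ wires obj N) (s : List ι),
      wiresRight f (s ++ r) = wiresCast obj (List.append_assoc ..).symm ≫
        wiresRight (wiresRight f s) r ≫ wiresCast obj (List.append_assoc ..) := by
    intro M N f s
    simp [wiresRight_wiresRight]
  have h : wiresRight (B.mor x) (B.inp y) ≫ wiresBraid _ _ ≫ wiresRight (B.mor y) (B.out x) =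
      wiresBraid _ _ ≫ wiresRight (B.mor y) (B.inp x) ≫ wiresBraid _ _ ≫
        wiresRight (B.mor x) (B.out y) ≫ wiresBraid _ _ := by
    rw [wiresBraid_naturality_left_assoc, ← wires_exchange, wiresBraid_naturality_left,
      wiresBraid_wiresBraid_assoc]
  simp only [key, Category.assoc, wiresCast_trans_assoc, wiresCast_rfl, Category.id_comp,
    ← wiresRight_comp_assoc, h]

namespace Run

/-- Two boxes drawn one after the other can be exchanged if no wire goes from the first to the
second. As the wires in between are pairwise distinct, they may be assumed to be crossed as in
`interchange`. -/
lemma swap {L M : List ι} {x y : β} {f : wires obj L ⟶ wires obj M} (hf : B.Run L [x, y] M f)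
    (hy : (B.inp y).Nodup) (hxy : List.Disjoint (B.out x) (B.inp y))
    (hn : ∀ N g, B.Run L [x] N g → N.Nodup) : B.Run L [y, x] M f := by
  obtain ⟨N, g, h, hg, hh, rfl⟩ := split (S := [x]) (T := [y]) hf
  obtain ⟨R, p0, p1, hp0, hp1, rfl⟩ := hg.exists_eq_of_singleton
  obtain ⟨R', p1', p2, hp1', hp2, rfl⟩ := hh.exists_eq_of_singleton
  have hp := hp1.trans hp1'
  have hoR : (B.out x ++ R).Nodup :=
    hn _ _ ((of_wirePerm hp0).append (single x R))
  obtain ⟨R2, hR2⟩ : ∃ R2, R.Perm (B.inp y ++ R2) := by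
    refine hy.exists_perm_append fun i hi => ?_
    have : i ∈ B.out x ++ R := hp.perm.mem_iff.2 (List.mem_append_left _ hi)
    exact (List.mem_append.1 this).resolve_left fun h => hxy h hi
  have hR' : R'.Perm (B.out x ++ R2) := by
    classical
    have h1 := hp.perm
    rw [List.perm_iff_count] at h1 hR2 ⊢
    intro a
    have h2 := h1 a
    have h3 := hR2 a
    simp only [List.count_append] at h2 h3 ⊢
    omega
  obtain ⟨q, hq⟩ := WirePerm.exists_of_perm (obj := obj) hR2
  obtain ⟨qi, hqi, hq1, -⟩ := hq.exists_inv
  obtain ⟨q', hq'⟩ := WirePerm.exists_of_perm (obj := obj) hR'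
  obtain ⟨qi', hqi', hq1', -⟩ := hq'.exists_inv
  have hX : _root_.wiresRight (B.mor x) R = _root_.wiresLeft q _ ≫
      _root_.wiresRight (B.mor x) (B.inp y ++ R2) ≫ _root_.wiresLeft qi _ := by
    rw [wires_exchange, ← wiresLeft_comp_assoc, hq1, wiresLeft_id, Category.id_comp]
  have hY : _root_.wiresRight (B.mor y) R' = _root_.wiresLeft q' _ ≫
      _root_.wiresRight (B.mor y) (B.out x ++ R2) ≫ _root_.wiresLeft qi' _ := by
    rw [wires_exchange, ← wiresLeft_comp_assoc, hq1', wiresLeft_id, Category.id_comp]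
  have hb := ((hqi.wiresLeft (B.out x)).trans hp).trans (hq'.wiresLeft (B.inp y))
  have hperm : ∀ l m : List ι, WirePerm obj (l ++ (m ++ R2)) (m ++ (l ++ R2))
      (_root_.wiresCast obj (List.append_assoc ..).symm ≫
        _root_.wiresRight (_root_.wiresBraid l m) R2 ≫
        _root_.wiresCast obj (List.append_assoc ..)) := fun l m =>
    (WirePerm.wiresCast _).trans (((WirePerm.wiresBraid l m).wiresRight R2).trans (.wiresCast _))
  have hn' : (B.out x ++ (B.inp y ++ R2)).Nodup := (hR2.append_left _).nodup_iff.1 hoR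
  have hb' := WirePerm.unique hn' hb (hperm _ _)
  have e : (p0 ≫ _root_.wiresRight (B.mor x) R ≫ p1) ≫ p1' ≫ _root_.wiresRight (B.mor y) R' ≫ p2 =
      (p0 ≫ _root_.wiresLeft q _) ≫ (_root_.wiresRight (B.mor x) (B.inp y ++ R2) ≫
        ((_root_.wiresLeft qi _ ≫ p1 ≫ p1') ≫ _root_.wiresLeft q' _) ≫
        _root_.wiresRight (B.mor y) (B.out x ++ R2)) ≫ _root_.wiresLeft qi' _ ≫ p2 := by
    rw [hX, hY]; simp only [Category.assoc]
  rw [e, hb', interchange]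
  refine (of_wirePerm (hp0.trans (hq.wiresLeft _))).append (S := []) (T := [y, x]) ?_
  refine append (S := [y, x]) (T := []) ?_ (of_wirePerm ((hqi'.wiresLeft _).trans hp2))
  refine append (S := []) (T := [y, x]) (of_wirePerm (hperm _ _)) ?_
  refine append (S := [y]) (T := [x]) (single _ _) ?_
  refine append (S := []) (T := [x]) (of_wirePerm (hperm _ _)) ?_
  exact (single _ _).perm (hperm _ _)

end Run

variable (B) in
/-- However some of the boxes in `S` are drawn on the wires `L`, the wires obtained are pairwise
distinct. Without this, the permutations of wires between boxes would not be determined by the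
orders of the wires. -/
def Safe (L : List ι) (S : List β) : Prop :=
  ∀ S' M f, B.Run L S' M f → S'.Subperm S → M.Nodup

lemma Safe.mono {L : List ι} {S T : List β} (h : B.Safe L S) (hT : T.Subperm S) : B.Safe L T :=
  fun S' M f hf hS' => h S' M f hf (hS'.trans hT)

lemma Run.nodup {L M : List ι} {S : List β} {f : wires obj L ⟶ wires obj M} (hf : B.Run L S M f)
    (h : B.Safe L S) : M.Nodup :=
  h _ _ _ hf (List.Subperm.refl _)

lemma Safe.nodup {L : List ι} {S : List β} (h : B.Safe L S) : L.Nodup :=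
  h _ _ _ .start (List.nil_subperm)

lemma safe_of_nodup {L : List ι} {S : List β} (h : (L ++ S.flatMap B.out).Nodup) :
    B.Safe L S := by
  intro S' M f hf hS'
  obtain ⟨T, hT, hT'⟩ := hS'
  have h1 : (L ++ S'.flatMap B.out).Nodup := by
    refine ((hT.flatMap_right B.out).append_left L).nodup_iff.1 ?_
    exact h.sublist ((hT'.flatMap _).append_left L)
  exact (hf.flatMap_perm.nodup_iff.2 h1).of_append_left

/-- A box can be drawn last if no wire goes from it to the boxes drawn after it. -/
lemma Run.move_to_end {L M : List ι} {S T : List β} {x : β} {f : wires obj L ⟶ wires obj M}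
    (hf : B.Run L (S ++ x :: T) M f) (hs : B.Safe L (S ++ x :: T))
    (hT : ∀ y ∈ T, (B.inp y).Nodup ∧ List.Disjoint (B.out x) (B.inp y)) :
    B.Run L (S ++ T ++ [x]) M f := by
  induction T generalizing S with
  | nil => simpa using hf
  | cons y T ih =>
    obtain ⟨N, g, h, hg, hh, rfl⟩ := hf.split
    obtain ⟨O, h1, h2, hh1, hh2, rfl⟩ := Run.split (S := [x, y]) (T := T) hh
    have hsub : (S ++ [x]).Subperm (S ++ x :: y :: T) :=
      (List.Sublist.append_left (by simp) S).subperm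
    have hh1' := hh1.swap (hT y (by simp)).1 (hT y (by simp)).2
      fun P k hk => hs _ _ _ (hg.append hk) hsub
    have hf' := hg.append (hh1'.append hh2)
    have hp : (S ++ [y] ++ x :: T).Perm (S ++ x :: y :: T) := by
      simpa using (List.Perm.swap x y T).append_left S
    have := ih (S := S ++ [y]) (by simpa using hf') (hs.mono hp.subperm)
      fun z hz => hT z (by simp [hz])
    simpa using this

/-- If all wires have at most one source and at most one target among the boxes, the morphism
obtained by drawing the boxes does not depend on the order in which they are drawn, nor on how the
wires are crossed. -/
theorem Run.unique {L M M' : List ι} {S S' : List β} {f : wires obj L ⟶ wires obj M}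
    {f' : wires obj L ⟶ wires obj M'} (hf : B.Run L S M f) (hf' : B.Run L S' M' f')
    (hS : S.Perm S') (hs : B.Safe L S) (hin : (S.flatMap B.inp).Nodup)
    (hout : (S.flatMap B.out).Nodup) {p : wires obj M ⟶ wires obj M'}
    (hp : WirePerm obj M M' p) : f ≫ p = f' := by
  classical
  induction S using List.reverseRecOn generalizing M M' S' with
  | nil =>
    obtain rfl := hS.symm.eq_nil
    exact WirePerm.unique hs.nodup (hf.wirePerm.trans hp) hf'.wirePerm
  | append_singleton S x ih =>
    have hx : x ∈ S' := hS.subset (by simp)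
    obtain ⟨S1, S2, rfl⟩ := List.append_of_mem hx
    have hS12 : S.Perm (S1 ++ S2) := by
      have h1 : (x :: S).Perm (x :: (S1 ++ S2)) :=
        ((List.perm_append_singleton x S).symm.trans hS).trans List.perm_middle
      exact (List.perm_cons x).1 h1
    obtain ⟨N, g, h, hg, hh, rfl⟩ := hf.split
    have hs' : B.Safe L (S1 ++ x :: S2) := hs.mono hS.symm.subperm
    have hin' := (hS.flatMap_right B.inp).nodup_iff.1 hin
    have hout' := (hS.flatMap_right B.out).nodup_iff.1 hout
    have hgp := hg.flatMap_perm
    -- It is shown that `x` can be drawn last on both sides.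
    -- A wire from `x` to a box drawn before `x` on one side and after `x` on the other side
    -- would be present in `L`, hence twice on the other side.
    have hdisj : ∀ y ∈ S2, (B.inp y).Nodup ∧ List.Disjoint (B.out x) (B.inp y) := by
      intro y hy
      refine ⟨(List.nodup_flatMap.1 hin').1 y (by simp [hy]), fun i hi hi' => ?_⟩
      have hyS : y ∈ S := hS12.mem_iff.2 (by simp [hy])
      have h1 : i ∉ S.flatMap B.out := by
        rw [List.flatMap_append, List.nodup_append] at hout
        exact fun h => hout.2.2 i h i (by simpa using hi) rfl
      have h2 : i ∈ L := by
        have : i ∈ N ++ S.flatMap B.inp :=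
          List.mem_append_right _ (List.mem_flatMap.2 ⟨y, hyS, hi'⟩)
        exact (List.mem_append.1 (hgp.mem_iff.1 this)).resolve_right h1
      obtain ⟨N', g', -, hg', -, -⟩ :=
        Run.split (S := S1 ++ [x]) (T := S2) (by simpa using hf')
      have hN' : N'.Nodup := hs' _ _ _ hg' (by simpa using
        (List.Sublist.append_left (by simp : [x].Sublist (x :: S2)) S1).subperm)
      have h3 := List.perm_iff_count.1 hg'.flatMap_perm i
      have h4 : (N'.count i) ≤ 1 := List.nodup_iff_count_le_one.1 hN' i
      have h5 : i ∉ (S1 ++ [x]).flatMap B.inp := by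
        have : S1 ++ x :: S2 = (S1 ++ [x]) ++ S2 := by simp
        rw [this, List.flatMap_append, List.nodup_append] at hin'
        exact fun h => hin'.2.2 i h i (List.mem_flatMap.2 ⟨y, hy, hi'⟩) rfl
      have h6 : 0 < L.count i := List.count_pos_iff.2 h2
      have h7 : 0 < ((S1 ++ [x]).flatMap B.out).count i :=
        List.count_pos_iff.2 (List.mem_flatMap.2 ⟨x, by simp, hi⟩)
      simp only [List.count_append, List.count_eq_zero_of_not_mem h5] at h3
      omega
    have hf'' := hf'.move_to_end hs' hdisj
    obtain ⟨N', g', h', hg', hh', rfl⟩ := hf''.split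
    obtain ⟨R, p0, p1, hp0, hp1, rfl⟩ := hh.exists_eq_of_singleton
    obtain ⟨R', p0', p1', hp0', hp1', rfl⟩ := hh'.exists_eq_of_singleton
    have hNN : (B.inp x ++ R).Perm (B.inp x ++ R') := by
      have h1 := hg'.flatMap_perm
      have h2 := hS12.flatMap_right B.inp
      have h3 := hS12.flatMap_right B.out
      have h4 := hp0.perm
      have h5 := hp0'.perm
      rw [List.perm_iff_count] at *
      intro a
      have h1 := h1 a; have h2 := h2 a; have h3 := h3 a; have h4 := h4 a; have h5 := h5 a
      have h6 := hgp a
      simp only [List.count_append] at *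
      omega
    obtain ⟨q, hq⟩ := WirePerm.exists_of_perm (obj := obj) ((List.perm_append_left_iff _).1 hNN)
    have hsS : B.Safe L S := hs.mono (List.sublist_append_left _ _).subperm
    rw [List.flatMap_append] at hin hout
    have key := ih (hg.perm hp0) (hg'.perm hp0') hS12 hsS hin.of_append_left hout.of_append_left
      (hq.wiresLeft _)
    have hnR : (B.out x ++ R).Nodup :=
      (((hg.perm hp0).box x).nodup hs)
    have hlast : _root_.wiresLeft q _ ≫ p1' = p1 ≫ p :=
      WirePerm.unique hnR ((hq.wiresLeft _).trans hp1') (hp1.trans hp)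
    calc _ = (g ≫ p0) ≫ _root_.wiresRight (B.mor x) R ≫ p1 ≫ p := by simp
      _ = ((g ≫ p0) ≫ _root_.wiresLeft q _) ≫ _root_.wiresRight (B.mor x) R' ≫ p1' := by
        simp only [← hlast, Category.assoc, wires_exchange_assoc]
      _ = _ := by rw [key]; simp only [Category.assoc]

end BoxSystem

end Boxes

/-! ### Tensor products with and without trailing unit -/

section Transfer

variable {C : Type u₁} [Category.{v₁} C] [MonoidalCategory C]
variable {ι : Type} (obj : ι → C)

/-- The tensor products of a list of wires without and with a trailing unit agree. -/
def wireTensorIso : ∀ l : List ι, wireTensor obj l ≅ wires obj l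
  | [] => Iso.refl _
  | [i] => (ρ_ (obj i)).symm
  | i :: j :: l => whiskerLeftIso (obj i) (wireTensorIso (j :: l))

/-- The isomorphism `wireTensorIso` is compatible with splitting a list of wires in two. -/
lemma wireSplit_wireTensorIso (l m : List ι) :
    (wireSplit obj l m).hom ≫ ((wireTensorIso obj l).hom ⊗ₘ (wireTensorIso obj m).hom) =
      (wireTensorIso obj (l ++ m)).hom ≫ (wiresSplit obj l m).hom := by
  induction l with
  | nil =>
    have key : ∀ {U V : C} (t : U ≅ V), (λ_ U).inv ≫ (𝟙 _ ⊗ₘ t.hom) = t.hom ≫ (λ_ V).inv := by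
      intros; simp
    exact key _
  | cons i l ih =>
    rcases l with _ | ⟨j, l⟩
    · rcases m with _ | ⟨k, m⟩
      · have key : ∀ A : C, (ρ_ A).inv ≫ ((ρ_ A).inv ⊗ₘ 𝟙 _) = (ρ_ A).inv ≫
            A ◁ (λ_ (𝟙_ C)).inv ≫ (α_ A (𝟙_ C) (𝟙_ C)).inv := by intros; simp
        exact key _
      · have key : ∀ {A U V : C} (t : U ≅ V), 𝟙 _ ≫ ((ρ_ A).inv ⊗ₘ t.hom) = A ◁ t.hom ≫
            A ◁ (λ_ V).inv ≫ (α_ A (𝟙_ C) V).inv := by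
          intros; simp [MonoidalCategory.tensorHom_def']
        exact key _
    · have key : ∀ {A L M L' M' U V : C} (s : U ⟶ L ⊗ M) (t : V ⟶ L' ⊗ M') (u : U ⟶ V)
          (v : L ⟶ L') (w : M ⟶ M'), s ≫ (v ⊗ₘ w) = u ≫ t →
          (A ◁ s ≫ (α_ _ _ _).inv) ≫ (A ◁ v ⊗ₘ w) = A ◁ u ≫ A ◁ t ≫ (α_ _ _ _).inv := by
        intro A L M L' M' U V s t u v w h
        rw [← whiskerLeft_comp_assoc, ← h]
        simp [MonoidalCategory.tensorHom_def]
      exact key _ _ _ _ _ ih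

variable {obj}

/-- A morphism between tensor products of wires, regarded as a morphism between tensor products
with a trailing unit. -/
def toWires {M N : List ι} (f : wireTensor obj M ⟶ wireTensor obj N) :
    wires obj M ⟶ wires obj N :=
  (wireTensorIso obj M).inv ≫ f ≫ (wireTensorIso obj N).hom

@[simp] lemma toWires_id (M : List ι) : toWires (𝟙 (wireTensor obj M)) = 𝟙 _ := by
  simp [toWires]

@[simp] lemma toWires_comp {M N O : List ι} (f : wireTensor obj M ⟶ wireTensor obj N)
    (g : wireTensor obj N ⟶ wireTensor obj O) : toWires (f ≫ g) = toWires f ≫ toWires g := by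
  simp [toWires]

section Whisker

variable {L M L' M' N N' U V U' V' : C}

/-- A morphism drawn to the right of idle wires, for any choice of the splittings, is transported
along isomorphisms compatible with the splittings. -/
lemma split_conj_left (s : U ≅ L ⊗ M) (t : V ≅ L ⊗ N) (s' : U' ≅ L' ⊗ M') (t' : V' ≅ L' ⊗ N')
    (a : L ≅ L') (b : M ≅ M') (c : N ≅ N') (u : U ≅ U') (v : V ≅ V')
    (hs : s.hom ≫ (a.hom ⊗ₘ b.hom) = u.hom ≫ s'.hom)
    (ht : t.hom ≫ (a.hom ⊗ₘ c.hom) = v.hom ≫ t'.hom) (f : M ⟶ N) :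
    u.inv ≫ (s.hom ≫ L ◁ f ≫ t.inv) ≫ v.hom =
      s'.hom ≫ L' ◁ (b.inv ≫ f ≫ c.hom) ≫ t'.inv := by
  have ht' : t.inv ≫ v.hom = (a.hom ⊗ₘ c.hom) ≫ t'.inv := by
    rw [Iso.inv_comp_eq, reassoc_of% ht, Iso.hom_inv_id, Category.comp_id]
  have hs' : u.inv ≫ s.hom = s'.hom ≫ (a.inv ⊗ₘ b.inv) := by
    have : s.hom = u.hom ≫ s'.hom ≫ (a.inv ⊗ₘ b.inv) := by
      rw [← reassoc_of% hs, tensorHom_comp_tensorHom]; simp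
    rw [this, Iso.inv_hom_id_assoc]
  simp only [Category.assoc, ht', reassoc_of% hs']
  simp only [MonoidalCategory.tensorHom_def', whiskerLeft_comp, Category.assoc,
    whisker_exchange_assoc]
  simp [← comp_whiskerRight_assoc]

/-- A morphism drawn to the left of idle wires, for any choice of the splittings, is transported
along isomorphisms compatible with the splittings. -/
lemma split_conj_right (s : U ≅ M ⊗ L) (t : V ≅ N ⊗ L) (s' : U' ≅ M' ⊗ L') (t' : V' ≅ N' ⊗ L')
    (a : L ≅ L') (b : M ≅ M') (c : N ≅ N') (u : U ≅ U') (v : V ≅ V')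
    (hs : s.hom ≫ (b.hom ⊗ₘ a.hom) = u.hom ≫ s'.hom)
    (ht : t.hom ≫ (c.hom ⊗ₘ a.hom) = v.hom ≫ t'.hom) (f : M ⟶ N) :
    u.inv ≫ (s.hom ≫ f ▷ L ≫ t.inv) ≫ v.hom =
      s'.hom ≫ (b.inv ≫ f ≫ c.hom) ▷ L' ≫ t'.inv := by
  have ht' : t.inv ≫ v.hom = (c.hom ⊗ₘ a.hom) ≫ t'.inv := by
    rw [Iso.inv_comp_eq, reassoc_of% ht, Iso.hom_inv_id, Category.comp_id]
  have hs' : u.inv ≫ s.hom = s'.hom ≫ (b.inv ⊗ₘ a.inv) := by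
    have : s.hom = u.hom ≫ s'.hom ≫ (b.inv ⊗ₘ a.inv) := by
      rw [← reassoc_of% hs, tensorHom_comp_tensorHom]; simp
    rw [this, Iso.inv_hom_id_assoc]
  simp only [Category.assoc, ht', reassoc_of% hs']
  simp only [MonoidalCategory.tensorHom_def, comp_whiskerRight, Category.assoc,
    ← whisker_exchange_assoc]
  simp [← whiskerLeft_comp_assoc]

end Whisker

lemma toWires_wireWhisker (l r : List ι) {H K : List ι}
    (f : wireTensor obj H ⟶ wireTensor obj K) :
    toWires (wireWhisker obj l r f) = wiresRight (wiresLeft (toWires f) l) r := by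
  rw [wiresLeft_eq]
  have h1 := split_conj_left _ _ _ _ _ _ _ _ _ (wireSplit_wireTensorIso obj l H)
    (wireSplit_wireTensorIso obj l K) f
  have h2 := split_conj_right _ _ _ _ _ _ _ _ _ (wireSplit_wireTensorIso obj (l ++ H) r)
    (wireSplit_wireTensorIso obj (l ++ K) r)
    ((wireSplit obj l H).hom ≫ (wireTensor obj l ◁ f) ≫ (wireSplit obj l K).inv)
  rw [h1] at h2
  exact h2

end Transfer

/-! ### Images of wires under a monoidal functor -/

section MapTransfer

open Functor.LaxMonoidal Functor.OplaxMonoidal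

variable {C : Type u₁} [Category.{v₁} C] [MonoidalCategory C]
variable {D : Type u₂} [Category.{v₂} D] [MonoidalCategory D] (F : C ⥤ D) [F.Monoidal]
variable {ι : Type} (obj : ι → C)

/-- The structural isomorphism of `F` for a list of wires. -/
def mapWiresIso : ∀ l : List ι, F.obj (wires obj l) ≅ wires (fun i => F.obj (obj i)) l
  | [] => (Functor.Monoidal.εIso F).symm
  | i :: l => (Functor.Monoidal.μIso F (obj i) (wires obj l)).symm ≪≫
      whiskerLeftIso (F.obj (obj i)) (mapWiresIso l)

/-- The image under `F` of the splitting of a list of wires in two. -/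
def mapWiresSplit (l m : List ι) :
    F.obj (wires obj (l ++ m)) ≅ F.obj (wires obj l) ⊗ F.obj (wires obj m) :=
  F.mapIso (wiresSplit obj l m) ≪≫ (Functor.Monoidal.μIso F _ _).symm

/-- Coherence of the structural isomorphisms of `F`: they are compatible with splitting a list of
wires in two. -/
lemma mapWiresSplit_mapWiresIso (l m : List ι) :
    (mapWiresSplit F obj l m).hom ≫ ((mapWiresIso F obj l).hom ⊗ₘ (mapWiresIso F obj m).hom) =
      (mapWiresIso F obj (l ++ m)).hom ≫ (wiresSplit _ l m).hom := by
  induction l with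
  | nil =>
    have key : ∀ {U : C} {V : D} (t : F.obj U ≅ V), (F.map (λ_ U).inv ≫ δ F _ _) ≫
        (η F ⊗ₘ t.hom) = t.hom ≫ (λ_ V).inv := by
      intro U V t
      have h := Functor.OplaxMonoidal.left_unitality F U
      rw [MonoidalCategory.tensorHom_def, Category.assoc, ← reassoc_of% h]
      simp
    exact key _
  | cons i l ih =>
    have key : ∀ {A L M U : C} {L' M' U' : D} (s : U ⟶ L ⊗ M) (u : F.obj U ⟶ U')
        (s' : U' ⟶ L' ⊗ M') (v : F.obj L ⟶ L') (w : F.obj M ⟶ M'),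
        (F.map s ≫ δ F _ _) ≫ (v ⊗ₘ w) = u ≫ s' →
        (F.map (A ◁ s ≫ (α_ A L M).inv) ≫ δ F _ _) ≫ ((δ F _ _ ≫ F.obj A ◁ v) ⊗ₘ w) =
          (δ F _ _ ≫ F.obj A ◁ u) ≫ F.obj A ◁ s' ≫ (α_ _ _ _).inv := by
      intro A L M U L' M' U' s u s' v w h
      simp only [Category.assoc]
      rw [← whiskerLeft_comp_assoc, ← h]
      have h1 : (δ F A L ≫ F.obj A ◁ v) ⊗ₘ w = δ F A L ▷ F.obj M ≫ (F.obj A ◁ v ⊗ₘ w) := by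
        simp [MonoidalCategory.tensorHom_def]
      rw [h1, F.map_comp, Category.assoc]
      have h2 := Functor.OplaxMonoidal.associativity_inv F A L M
      rw [← reassoc_of% h2, ← δ_natural_right_assoc]
      simp [MonoidalCategory.tensorHom_def]
    exact key _ _ _ _ _ ih

variable {F obj}

/-- A morphism between images under `F` of lists of wires, regarded as a morphism between lists of
image wires. -/
def toMapWires {M N : List ι} (m : F.obj (wires obj M) ⟶ F.obj (wires obj N)) :
    wires (fun i => F.obj (obj i)) M ⟶ wires (fun i => F.obj (obj i)) N :=
  (mapWiresIso F obj M).inv ≫ m ≫ (mapWiresIso F obj N).hom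

@[simp] lemma toMapWires_id (M : List ι) : toMapWires (𝟙 (F.obj (wires obj M))) = 𝟙 _ := by
  simp [toMapWires]

lemma toMapWires_comp {M N O : List ι} (f : F.obj (wires obj M) ⟶ F.obj (wires obj N))
    (g : F.obj (wires obj N) ⟶ F.obj (wires obj O)) :
    toMapWires (f ≫ g) = toMapWires f ≫ toMapWires g := by
  simp [toMapWires]

lemma toMapWires_injective {M N : List ι} :
    Function.Injective (toMapWires (F := F) (obj := obj) (M := M) (N := N)) := by
  intro f g h
  simpa [toMapWires] using h

lemma toMapWires_left (l : List ι) {M N : List ι}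
    (m : F.obj (wires obj M) ⟶ F.obj (wires obj N)) :
    toMapWires ((mapWiresSplit F obj l M).hom ≫ F.obj (wires obj l) ◁ m ≫
      (mapWiresSplit F obj l N).inv) = wiresLeft (toMapWires m) l := by
  rw [wiresLeft_eq]
  exact split_conj_left _ _ _ _ _ _ _ _ _ (mapWiresSplit_mapWiresIso F obj l M)
    (mapWiresSplit_mapWiresIso F obj l N) m

lemma toMapWires_right (r : List ι) {M N : List ι}
    (m : F.obj (wires obj M) ⟶ F.obj (wires obj N)) :
    toMapWires ((mapWiresSplit F obj M r).hom ≫ m ▷ F.obj (wires obj r) ≫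
      (mapWiresSplit F obj N r).inv) = wiresRight (toMapWires m) r :=
  split_conj_right _ _ _ _ _ _ _ _ _ (mapWiresSplit_mapWiresIso F obj M r)
    (mapWiresSplit_mapWiresIso F obj N r) m

lemma toMapWires_map_wiresRight (r : List ι) {M N : List ι} (f : wires obj M ⟶ wires obj N) :
    toMapWires (F.map (wiresRight f r)) = wiresRight (toMapWires (F.map f)) r := by
  rw [← toMapWires_right]
  congr 1
  simp [mapWiresSplit, wiresRight]

lemma toMapWires_map_wiresLeft (l : List ι) {M N : List ι} (f : wires obj M ⟶ wires obj N) :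
    toMapWires (F.map (wiresLeft f l)) = wiresLeft (toMapWires (F.map f)) l := by
  rw [← toMapWires_left]
  congr 1
  rw [wiresLeft_eq]
  simp [mapWiresSplit]

/-- A morphism of `D` between images of tensor products of wires, regarded as a morphism between
lists of image wires. -/
def toMapWires' {M N : List ι} (m : F.obj (wireTensor obj M) ⟶ F.obj (wireTensor obj N)) :
    wires (fun i => F.obj (obj i)) M ⟶ wires (fun i => F.obj (obj i)) N :=
  toMapWires (F.map (wireTensorIso obj M).inv ≫ m ≫ F.map (wireTensorIso obj N).hom)

@[simp] lemma toMapWires'_id (M : List ι) :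
    toMapWires' (𝟙 (F.obj (wireTensor obj M))) = 𝟙 _ := by
  simp [toMapWires', ← Functor.map_comp]

lemma toMapWires'_comp {M N O : List ι} (f : F.obj (wireTensor obj M) ⟶ F.obj (wireTensor obj N))
    (g : F.obj (wireTensor obj N) ⟶ F.obj (wireTensor obj O)) :
    toMapWires' (f ≫ g) = toMapWires' f ≫ toMapWires' g := by
  simp [toMapWires', ← toMapWires_comp]

lemma toMapWires'_injective {M N : List ι} :
    Function.Injective (toMapWires' (F := F) (obj := obj) (M := M) (N := N)) := by
  intro f g h
  have := toMapWires_injective h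
  rwa [cancel_epi, cancel_mono] at this

lemma toMapWires'_map {M N : List ι} (f : wireTensor obj M ⟶ wireTensor obj N) :
    toMapWires' (F.map f) = toMapWires (F.map (toWires f)) := by
  simp [toMapWires', toWires]

lemma toMapWires'_wireWhiskerMap (l r : List ι) {H K : List ι}
    (m : F.obj (wireTensor obj H) ⟶ F.obj (wireTensor obj K)) :
    toMapWires' (wireWhiskerMap F obj l r m) = wiresRight (wiresLeft (toMapWires' m) l) r := by
  have hsplit : ∀ l m : List ι,
      (F.mapIso (wireSplit obj l m) ≪≫ (Functor.Monoidal.μIso F _ _).symm).hom ≫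
        ((F.mapIso (wireTensorIso obj l)).hom ⊗ₘ (F.mapIso (wireTensorIso obj m)).hom) =
      (F.mapIso (wireTensorIso obj (l ++ m))).hom ≫ (mapWiresSplit F obj l m).hom := by
    intro l m
    have := congrArg (fun t => F.map t ≫ δ F _ _) (wireSplit_wireTensorIso obj l m)
    simpa [mapWiresSplit, δ_natural] using this
  have h1 := split_conj_left _ _ _ _ _ _ _ _ _ (hsplit l H) (hsplit l K) m
  have h2 := split_conj_right _ _ _ _ _ _ _ _ _ (hsplit (l ++ H) r) (hsplit (l ++ K) r)
    (F.map (wireSplit obj l H).hom ≫ δ F _ _ ≫ (F.obj (wireTensor obj l) ◁ m) ≫ μ F _ _ ≫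
      F.map (wireSplit obj l K).inv)
  have e : F.map (wireSplit obj l H).hom ≫ δ F _ _ ≫ (F.obj (wireTensor obj l) ◁ m) ≫ μ F _ _ ≫
      F.map (wireSplit obj l K).inv =
      (F.mapIso (wireSplit obj l H) ≪≫ (Functor.Monoidal.μIso F _ _).symm).hom ≫
        F.obj (wireTensor obj l) ◁ m ≫
        (F.mapIso (wireSplit obj l K) ≪≫ (Functor.Monoidal.μIso F _ _).symm).inv := by
    simp
  rw [toMapWires', toMapWires', ← toMapWires_left, ← toMapWires_right]
  congr 1
  simp only [Functor.mapIso_hom, Functor.mapIso_inv] at h1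
  rw [← h1, ← e]
  refine Eq.trans ?_ h2
  simp [wireWhiskerMap]

end MapTransfer

section WirePermMap

open Functor.LaxMonoidal Functor.OplaxMonoidal

variable {C : Type u₁} [Category.{v₁} C] [MonoidalCategory C] [SymmetricCategory C]
variable {D : Type u₂} [Category.{v₂} D] [MonoidalCategory D] [SymmetricCategory D]
variable {F : C ⥤ D} [F.Braided] {ι : Type} {obj : ι → C}

/-- A braided functor preserves permutations of wires. -/
lemma WirePerm.map {M N : List ι} {f : wires obj M ⟶ wires obj N} (h : WirePerm obj M N f) :
    WirePerm (fun i => F.obj (obj i)) M N (toMapWires (F.map f)) := by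
  induction h with
  | refl M => simpa using WirePerm.refl _
  | @cons i M N f h ih =>
    have e : toMapWires (F.map (_root_.wiresLeft f [i])) =
        _root_.wiresLeft (toMapWires (F.map f)) [i] := toMapWires_map_wiresLeft [i] f
    have := ih.cons i
    exact e ▸ this
  | swap a b M =>
    have key : ∀ {A B X : C} {Y : D} (t : F.obj X ≅ Y),
        ((Functor.Monoidal.μIso F A (B ⊗ X)).symm ≪≫ whiskerLeftIso (F.obj A)
          ((Functor.Monoidal.μIso F B X).symm ≪≫ whiskerLeftIso (F.obj B) t)).inv ≫
        F.map (tensorSwap A B X) ≫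
        ((Functor.Monoidal.μIso F B (A ⊗ X)).symm ≪≫ whiskerLeftIso (F.obj B)
          ((Functor.Monoidal.μIso F A X).symm ≪≫ whiskerLeftIso (F.obj A) t)).hom =
        tensorSwap (F.obj A) (F.obj B) Y := by
      intro A B X Y t
      have h : tensorSwap (F.obj A) (F.obj B) (F.obj X) = F.obj A ◁ μ F B X ≫ μ F A (B ⊗ X) ≫
          F.map (tensorSwap A B X) ≫ δ F _ _ ≫ F.obj B ◁ δ F A X := by
        have e1 := Functor.OplaxMonoidal.associativity F B A X
        have e2 := Functor.LaxMonoidal.associativity_inv F A B X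
        have e3 : μ F (A ⊗ B) X ≫ F.map ((β_ A B).hom ▷ X) ≫ δ F (B ⊗ A) X =
            F.map (β_ A B).hom ▷ F.obj X := by
          rw [← δ_natural_left, Functor.Monoidal.μ_δ_assoc]
        have e4 : F.map (β_ A B).hom = δ F A B ≫ (β_ _ _).hom ≫ μ F B A := by
          simp [Functor.map_braiding]
        simp only [tensorSwap, F.map_comp, Category.assoc]
        have e5 : μ F A B ▷ F.obj X ≫ F.map (β_ A B).hom ▷ F.obj X ≫ δ F B A ▷ F.obj X =
            (β_ _ _).hom ▷ F.obj X := by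
          rw [← comp_whiskerRight, ← comp_whiskerRight, e4]
          simp only [Category.assoc, Functor.Monoidal.μ_δ, Functor.Monoidal.μ_δ_assoc,
            Category.comp_id]
        rw [reassoc_of% e2, ← e1, reassoc_of% e3, reassoc_of% e5]
      have h2 := tensorSwap_naturality (F.obj A) (F.obj B) t.hom
      have h3 : tensorSwap (F.obj A) (F.obj B) Y = F.obj A ◁ F.obj B ◁ t.inv ≫
          tensorSwap (F.obj A) (F.obj B) (F.obj X) ≫ F.obj B ◁ F.obj A ◁ t.hom := by
        rw [h2]; simp [← whiskerLeft_comp_assoc]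
      rw [h3, h]
      simp
    have h := WirePerm.swap (obj := fun i => F.obj (obj i)) a b M
    rw [← key (mapWiresIso F obj M)] at h
    exact h
  | trans _ _ h1 h2 =>
    rw [Functor.map_comp, toMapWires_comp]
    exact h1.trans h2

end WirePermMap

/-! ### Cycles in a relation -/

namespace Cycle

variable {α : Type*} {c : Cycle α} {a a' b b' : α}

/-- `b` comes just after `a` on the cycle `c`. -/
def Follows (c : Cycle α) (a b : α) : Prop := ∃ l : List α, c = ((a :: b :: l : List α) : Cycle α)

lemma exists_eq_cons (h : a ∈ c) : ∃ l : List α, c = ((a :: l : List α) : Cycle α) := by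
  induction c using Quotient.inductionOn with
  | h l =>
    obtain ⟨s, t, rfl⟩ := List.append_of_mem (Cycle.mem_coe_iff.1 h)
    exact ⟨t ++ s, Quotient.sound ⟨s.length, by rw [List.rotate_append_length_eq]; simp⟩⟩

lemma Follows.mem_left (h : c.Follows a b) : a ∈ c := by
  obtain ⟨l, rfl⟩ := h; simp

lemma Follows.mem_right (h : c.Follows a b) : b ∈ c := by
  obtain ⟨l, rfl⟩ := h; simp

lemma Follows.rel {r : α → α → Prop} (hc : c.Chain r) (h : c.Follows a b) : r a b := by
  obtain ⟨l, rfl⟩ := h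
  rw [chain_coe_cons] at hc
  exact hc.rel

lemma eq_of_coe_cons_eq {l m : List α} (hn : (a :: l).Nodup)
    (h : ((a :: l : List α) : Cycle α) = ((a :: m : List α) : Cycle α)) : l = m := by
  obtain ⟨n, hn'⟩ := Cycle.coe_eq_coe.1 h
  have hlen := congrArg List.length hn'
  by_cases h0 : n % (a :: l).length = 0
  · rw [← List.rotate_mod, h0, List.rotate_zero] at hn'
    exact (List.cons.inj hn').2
  · exfalso
    have hlt : n % (a :: l).length < (a :: l).length := Nat.mod_lt _ (by simp)
    rw [← List.rotate_mod] at hn'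
    have h1 : ((a :: l).rotate (n % (a :: l).length))[0]? = some a := by rw [hn']; simp
    rw [List.getElem?_rotate (by simp), Nat.zero_add, Nat.mod_mod] at h1
    have h2 : (a :: l)[n % (a :: l).length]? = (a :: l)[0]? := by rw [h1]; simp
    exact h0 ((List.getElem?_inj hlt hn).1 h2)

lemma Follows.right_unique (hc : c.Nodup) (h : c.Follows a b) (h' : c.Follows a b') : b = b' := by
  obtain ⟨l, rfl⟩ := h
  obtain ⟨l', h'⟩ := h'
  exact (List.cons.inj (eq_of_coe_cons_eq (Cycle.nodup_coe_iff.1 hc) h')).1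

lemma Follows.left_unique (hc : c.Nodup) (h : c.Follows a b) (h' : c.Follows a' b) : a = a' := by
  obtain ⟨l, rfl⟩ := h
  obtain ⟨l', h'⟩ := h'
  rw [Cycle.coe_cons_eq_coe_append] at h' hc
  rw [Cycle.coe_cons_eq_coe_append (b :: l') a'] at h'
  have := eq_of_coe_cons_eq (Cycle.nodup_coe_iff.1 hc) h'
  simpa using (List.append_inj' this rfl).2

lemma exists_follows {r : α → α → Prop} (hr : ∀ a, ¬ r a a) (hc : c.Chain r) (h : a ∈ c) :
    ∃ b, c.Follows a b := by
  obtain ⟨_ | ⟨b, l⟩, rfl⟩ := exists_eq_cons h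
  · exact absurd ((chain_singleton r a).1 hc) (hr a)
  · exact ⟨b, l, rfl⟩

lemma exists_follows' {r : α → α → Prop} (hr : ∀ a, ¬ r a a) (hc : c.Chain r) (h : a ∈ c) :
    ∃ b, c.Follows b a := by
  obtain ⟨l, rfl⟩ := exists_eq_cons h
  rcases List.eq_nil_or_concat l with rfl | ⟨l, b, rfl⟩
  · exact absurd ((chain_singleton r a).1 hc) (hr a)
  · refine ⟨b, l, ?_⟩
    rw [Cycle.coe_cons_eq_coe_append (a :: l) b]
    simp

/-- A property of the points of a cycle which passes from each point to the next one holds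
everywhere as soon as it holds somewhere. -/
lemma forall_of_follows {p : α → Prop} (hp : ∀ a b, c.Follows a b → p a → p b) (ha : a ∈ c)
    (h : p a) (hb : b ∈ c) : p b := by
  obtain ⟨l, hl⟩ := exists_eq_cons ha
  have key : ∀ (m s : List α) (x : α), c = ((s ++ x :: m : List α) : Cycle α) → p x →
      ∀ y ∈ m, p y := by
    intro m
    induction m with
    | nil => simp
    | cons z m ih =>
      intro s x hc hx
      have hz : p z := by
        refine hp x z ⟨m ++ s, ?_⟩ hx
        rw [hc]
        exact Quotient.sound ⟨s.length, by rw [List.rotate_append_length_eq]; simp⟩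
      have := ih (s ++ [x]) z (by simpa using hc) hz
      simpa [hz] using this
  rw [hl, Cycle.mem_coe_iff, List.mem_cons] at hb
  rcases hb with rfl | hb
  · exact h
  · exact key l [] a (by simpa using hl) h b hb

end Cycle

/-- A path can be shortened to a path without repetitions. -/
lemma Relation.ReflTransGen.exists_nodup {α : Type*} {r : α → α → Prop} {a b : α}
    (h : Relation.ReflTransGen r a b) :
    ∃ l : List α, (a :: l).Nodup ∧ (a :: l).IsChain r ∧ (a :: l).getLast (by simp) = b := by
  induction h using Relation.ReflTransGen.head_induction_on with
  | refl => exact ⟨[], by simp, by simp, rfl⟩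
  | @head a c hac _ ih =>
    obtain ⟨l, hn, hc, hl⟩ := ih
    by_cases ha : a ∈ c :: l
    · obtain ⟨s, t, hst⟩ := List.append_of_mem ha
      refine ⟨t, ?_, ?_, ?_⟩
      · exact hn.sublist (hst ▸ List.sublist_append_right _ _)
      · rw [hst] at hc; exact hc.right_of_append
      · rw [← hl]; simp only [hst]; rw [List.getLast_append_right]
    · refine ⟨c :: l, List.nodup_cons.2 ⟨ha, hn⟩, ?_, by simpa using hl⟩
      exact List.isChain_cons_cons.2 ⟨hac, hc⟩

/-- An edge and a path from its target back to its source yield a cycle without repetitions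
through this edge. -/
lemma Relation.exists_cycle {α : Type*} {r : α → α → Prop} (hr : ∀ a, ¬ r a a) {a b : α}
    (hab : r a b) (h : Relation.ReflTransGen r b a) :
    ∃ c : Cycle α, c ≠ Cycle.nil ∧ c.Nodup ∧ c.Chain r ∧ c.Follows a b := by
  obtain ⟨l, hn, hc, hl⟩ := h.exists_nodup
  rcases List.eq_nil_or_concat l with rfl | ⟨l, d, rfl⟩
  · obtain rfl : b = a := by simpa using hl
    exact absurd hab (hr _)
  · obtain rfl : d = a := by simpa using hl
    simp only [List.concat_eq_append] at *
    refine ⟨((d :: b :: l : List α) : Cycle α), ?_, ?_, ?_, l, rfl⟩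
    · simp
    · rw [Cycle.coe_cons_eq_coe_append]; exact Cycle.nodup_coe_iff.2 (by simpa using hn)
    · rw [Cycle.chain_coe_cons]
      exact List.isChain_cons_cons.2 ⟨hab, by simpa using hc⟩

/-! ### Strongly connected components of CV-local graphs -/

namespace FramedCausalGraph

variable {G : FramedCausalGraph}

lemma not_adj_self (v : G.V) : ¬ G.graph.Adj v v := fun h => G.nontransitive v v v h h h

variable (G) in
/-- The node `v` can be reached from the node `u` by a directed path. -/
def Reach (u v : G.V) : Prop := Relation.ReflTransGen G.graph.Adj u v

lemma Reach.trans {u v w : G.V} (h : G.Reach u v) (h' : G.Reach v w) : G.Reach u w :=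
  Relation.ReflTransGen.trans h h'

lemma Edge.reach (e : G.Edge) : G.Reach e.1.1 e.1.2 := Relation.ReflTransGen.single e.2

variable (G) in
/-- The partition of the nodes into strongly connected components. -/
def compSetoid : Setoid G.V where
  r u v := G.Reach u v ∧ G.Reach v u
  iseqv := ⟨fun _ => ⟨.refl, .refl⟩, fun h => ⟨h.2, h.1⟩,
    fun h h' => ⟨h.1.trans h'.1, h'.2.trans h.2⟩⟩

variable (G) in
/-- Two nodes are in the same strongly connected component. -/
def Comp (u v : G.V) : Prop := G.Reach u v ∧ G.Reach v u

lemma Comp.refl (u : G.V) : G.Comp u u := G.compSetoid.refl u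
lemma Comp.symm {u v : G.V} (h : G.Comp u v) : G.Comp v u := G.compSetoid.symm h
lemma Comp.trans {u v w : G.V} (h : G.Comp u v) (h' : G.Comp v w) : G.Comp u w :=
  G.compSetoid.trans h h'

lemma comp_of_isSimpleCycle {c : Cycle G.V} (hc : G.IsSimpleCycle c) {u v : G.V} (hu : u ∈ c)
    (hv : v ∈ c) : G.Comp u v := by
  have h : ∀ {u v}, u ∈ c → v ∈ c → G.Reach u v := fun {u v} hu hv =>
    Cycle.forall_of_follows (p := fun w => G.Reach u w)
      (fun a b hab h => Relation.ReflTransGen.tail h (hab.rel hc.2.2)) hu .refl hv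
  exact ⟨h hu hv, h hv hu⟩

lemma Edge.LiesOn.comp {e : G.Edge} {c : Cycle G.V} (h : e.LiesOn c) (hc : G.IsSimpleCycle c) :
    G.Comp e.1.1 e.1.2 :=
  comp_of_isSimpleCycle hc (Cycle.Follows.mem_left h) (Cycle.Follows.mem_right h)

lemma exists_isSimpleCycle (e : G.Edge) (h : G.Comp e.1.1 e.1.2) :
    ∃ c, G.IsSimpleCycle c ∧ e.LiesOn c := by
  obtain ⟨c, h1, h2, h3, h4⟩ := Relation.exists_cycle not_adj_self e.2 h.2
  exact ⟨c, ⟨h1, h2, h3⟩, h4⟩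

lemma exists_source {c : Cycle G.V} (hc : G.IsSimpleCycle c) {v : G.V} (hv : v ∈ c) :
    ∃ e : G.Edge, e.1.1 = v ∧ e.LiesOn c := by
  obtain ⟨b, hb⟩ := Cycle.exists_follows not_adj_self hc.2.2 hv
  exact ⟨⟨(v, b), hb.rel hc.2.2⟩, rfl, hb⟩

lemma exists_target {c : Cycle G.V} (hc : G.IsSimpleCycle c) {v : G.V} (hv : v ∈ c) :
    ∃ e : G.Edge, e.1.2 = v ∧ e.LiesOn c := by
  obtain ⟨b, hb⟩ := Cycle.exists_follows' not_adj_self hc.2.2 hv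
  exact ⟨⟨(b, v), hb.rel hc.2.2⟩, rfl, hb⟩

lemma Edge.LiesOn.eq_of_source {c : Cycle G.V} (hc : G.IsSimpleCycle c) {e e' : G.Edge}
    (h : e.LiesOn c) (h' : e'.LiesOn c) (hs : e.1.1 = e'.1.1) : e = e' := by
  obtain ⟨⟨a, b⟩, hab⟩ := e
  obtain ⟨⟨a', b'⟩, hab'⟩ := e'
  obtain rfl : a = a' := hs
  obtain rfl : b = b' := Cycle.Follows.right_unique hc.2.1 h h'
  rfl

lemma Edge.LiesOn.eq_of_target {c : Cycle G.V} (hc : G.IsSimpleCycle c) {e e' : G.Edge}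
    (h : e.LiesOn c) (h' : e'.LiesOn c) (hs : e.1.2 = e'.1.2) : e = e' := by
  obtain ⟨⟨a, b⟩, hab⟩ := e
  obtain ⟨⟨a', b'⟩, hab'⟩ := e'
  obtain rfl : b = b' := hs
  obtain rfl : a = a' := Cycle.Follows.left_unique hc.2.1 h h'
  rfl

lemma two_lt_degree_of_source {e e' f : G.Edge} (h : e.1.1 = e'.1.1) (hf : f.1.2 = e.1.1)
    (hne : e ≠ e') : 2 < G.degree e.1.1 := by
  have h1 : 0 < (G.incoming e.1.1).length :=
    List.length_pos_of_mem ((G.mem_incoming _ f).2 hf)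
  have h2 : [e, e'].Subperm (G.outgoing e.1.1) := by
    refine List.subperm_of_subset (by simpa using hne) fun x hx => ?_
    simp only [List.mem_cons, List.not_mem_nil, or_false] at hx
    rcases hx with rfl | rfl
    · exact (G.mem_outgoing _ _).2 rfl
    · exact (G.mem_outgoing _ _).2 h.symm
  have := h2.length_le
  simp only [List.length_cons, List.length_nil] at this
  rw [degree]; omega

lemma two_lt_degree_of_target {e e' f : G.Edge} (h : e.1.2 = e'.1.2) (hf : f.1.1 = e.1.2)
    (hne : e ≠ e') : 2 < G.degree e.1.2 := by
  have h1 : 0 < (G.outgoing e.1.2).length :=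
    List.length_pos_of_mem ((G.mem_outgoing _ f).2 hf)
  have h2 : [e, e'].Subperm (G.incoming e.1.2) := by
    refine List.subperm_of_subset (by simpa using hne) fun x hx => ?_
    simp only [List.mem_cons, List.not_mem_nil, or_false] at hx
    rcases hx with rfl | rfl
    · exact (G.mem_incoming _ _).2 rfl
    · exact (G.mem_incoming _ _).2 h.symm
  have := h2.length_le
  simp only [List.length_cons, List.length_nil] at this
  rw [degree]; omega

/-- A cycle can only be left through a node of degree higher than two. -/
lemma two_lt_degree_of_leave {c : Cycle G.V} (hc : G.IsSimpleCycle c) {e : G.Edge}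
    (h1 : e.1.1 ∈ c) (h2 : ¬ e.LiesOn c) : 2 < G.degree e.1.1 := by
  obtain ⟨e', h3, h4⟩ := exists_source hc h1
  obtain ⟨f, h5, -⟩ := exists_target hc h1
  exact two_lt_degree_of_source h3.symm h5 (by rintro rfl; exact h2 h4)

/-- A cycle can only be entered through a node of degree higher than two. -/
lemma two_lt_degree_of_enter {c : Cycle G.V} (hc : G.IsSimpleCycle c) {e : G.Edge}
    (h1 : e.1.2 ∈ c) (h2 : ¬ e.LiesOn c) : 2 < G.degree e.1.2 := by
  obtain ⟨e', h3, h4⟩ := exists_target hc h1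
  obtain ⟨f, h5, -⟩ := exists_source hc h1
  exact two_lt_degree_of_target h3.symm h5 (by rintro rfl; exact h2 h4)

/-- In a CV-local graph, the strongly connected component of a node `u` of degree higher than two
consists of simple cycles through `u`. -/
lemma exists_isSimpleCycle_of_two_lt_degree (hG : G.IsCVLocal) {u v : G.V} (hu : 2 < G.degree u)
    (h : G.Comp u v) : v = u ∨ ∃ c, G.IsSimpleCycle c ∧ u ∈ c ∧ v ∈ c := by
  obtain ⟨h1, h2⟩ := h
  induction h1 with
  | refl => exact Or.inl rfl
  | @tail a w _ haw ih =>
    have ha := ih (Relation.ReflTransGen.head haw h2)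
    have key : ∀ hu' : a = u, ∃ c, G.IsSimpleCycle c ∧ u ∈ c ∧ w ∈ c := by
      rintro rfl
      obtain ⟨c, hc, hl⟩ := exists_isSimpleCycle (G := G) ⟨(a, w), haw⟩
        ⟨Relation.ReflTransGen.single haw, h2⟩
      exact ⟨c, hc, Cycle.Follows.mem_left hl, Cycle.Follows.mem_right hl⟩
    rcases ha with ha | ⟨c, hc, huc, hac⟩
    · exact Or.inr (key ha)
    · by_cases hau : a = u
      · exact Or.inr (key hau)
      · by_cases hl : Edge.LiesOn (G := G) ⟨(a, w), haw⟩ c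
        · exact Or.inr ⟨c, hc, huc, Cycle.Follows.mem_right hl⟩
        · exact absurd (hG c hc a hac u huc (two_lt_degree_of_leave (e := ⟨(a, w), haw⟩) hc hac hl)
            hu) hau

open Classical in
variable (G) in
/-- A chosen node in each strongly connected component, of degree higher than two if there is one
in the component. In a CV-local graph with an interaction node in the component, it is this
interaction node. -/
noncomputable def rep (v : G.V) : G.V :=
  Quotient.lift (s := G.compSetoid)
    (fun v => if h : ∃ u, G.Comp v u ∧ 2 < G.degree u then h.choose else
      (Quotient.mk G.compSetoid v).out)
    (by
      intro a b hab
      have hab' : G.Comp a b := hab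
      have h : (fun u => G.Comp a u ∧ 2 < G.degree u) = fun u => G.Comp b u ∧ 2 < G.degree u := by
        funext u
        exact propext ⟨fun h => ⟨hab'.symm.trans h.1, h.2⟩, fun h => ⟨hab'.trans h.1, h.2⟩⟩
      have h' : Quotient.mk G.compSetoid a = Quotient.mk G.compSetoid b := Quotient.sound hab
      simp only [h, h'])
    (Quotient.mk G.compSetoid v)

lemma rep_eq_of_comp {u v : G.V} (h : G.Comp u v) : G.rep u = G.rep v := by
  have : Quotient.mk G.compSetoid u = Quotient.mk G.compSetoid v := Quotient.sound h
  rw [rep, rep, this]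

lemma comp_rep (v : G.V) : G.Comp v (G.rep v) := by
  rw [rep, Quotient.lift_mk]
  split_ifs with h
  · exact h.choose_spec.1
  · exact (Quotient.mk_out (s := G.compSetoid) v : G.Comp _ _).symm

lemma rep_rep (v : G.V) : G.rep (G.rep v) = G.rep v := (rep_eq_of_comp (comp_rep v)).symm

lemma rep_eq_self_of_two_lt_degree (hG : G.IsCVLocal) {v : G.V} (hv : 2 < G.degree v) :
    G.rep v = v := by
  have h : ∃ u, G.Comp v u ∧ 2 < G.degree u := ⟨v, Comp.refl v, hv⟩
  have hu : 2 < G.degree (G.rep v) := by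
    rw [rep, Quotient.lift_mk, dif_pos h]
    exact h.choose_spec.2
  rcases exists_isSimpleCycle_of_two_lt_degree hG hv (comp_rep v) with h1 | ⟨c, hc, h1, h2⟩
  · exact h1
  · exact hG c hc _ h2 _ h1 hu hv

/-- Each cycle passes through the representative of its component. -/
lemma rep_mem_of_mem (hG : G.IsCVLocal) {c : Cycle G.V} (hc : G.IsSimpleCycle c) {v : G.V}
    (hv : v ∈ c) : G.rep v ∈ c := by
  by_contra hr
  -- A path from `v` to its representative would leave the cycle through a node of degree higher
  -- than two, that is, through the representative.
  have key : ∀ w, G.Reach v w → w ∈ c := by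
    intro w hw
    induction hw with
    | refl => exact hv
    | @tail a w _ haw ih =>
      by_cases hl : Edge.LiesOn (G := G) ⟨(a, w), haw⟩ c
      · exact Cycle.Follows.mem_right hl
      · have := rep_eq_self_of_two_lt_degree hG
          (two_lt_degree_of_leave (e := ⟨(a, w), haw⟩) hc ih hl)
        rw [rep_eq_of_comp (comp_of_isSimpleCycle hc hv ih), this] at hr
        exact absurd ih hr
  exact hr (key _ (comp_rep v).1)

lemma exists_edge_of_ne_rep {v : G.V} (hv : G.rep v ≠ v) :
    ∃ e : G.Edge, e.1.1 = v ∧ G.Comp e.1.1 e.1.2 := by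
  obtain ⟨h1, h2⟩ := comp_rep v
  rcases Relation.ReflTransGen.cases_head h1 with h | ⟨w, hw, h⟩
  · exact absurd h.symm hv
  · exact ⟨⟨(v, w), hw⟩, rfl, Relation.ReflTransGen.single hw, Reach.trans h h2⟩

/-- A node which does not represent its component is of degree two, hence its edges stay in the
component. -/
lemma comp_of_source_ne_rep (hG : G.IsCVLocal) {e : G.Edge} (h : G.rep e.1.1 ≠ e.1.1) :
    G.Comp e.1.1 e.1.2 := by
  obtain ⟨f, hf, hf'⟩ := exists_edge_of_ne_rep h
  obtain ⟨c, hc, hl⟩ := exists_isSimpleCycle f hf'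
  by_cases he : e.LiesOn c
  · exact he.comp hc
  · exact absurd (rep_eq_self_of_two_lt_degree hG (two_lt_degree_of_leave hc
      (hf ▸ Cycle.Follows.mem_left hl) he)) h

lemma comp_of_target_ne_rep (hG : G.IsCVLocal) {e : G.Edge} (h : G.rep e.1.2 ≠ e.1.2) :
    G.Comp e.1.1 e.1.2 := by
  obtain ⟨f, hf, hf'⟩ := exists_edge_of_ne_rep h
  obtain ⟨c, hc, hl⟩ := exists_isSimpleCycle f hf'
  by_cases he : e.LiesOn c
  · exact he.comp hc
  · exact absurd (rep_eq_self_of_two_lt_degree hG (two_lt_degree_of_enter hc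
      (hf ▸ Cycle.Follows.mem_left hl) he)) h

variable (G) in
/-- The cut of all the cycles at the edges entering the representatives of the components. -/
def repCut : Set G.Edge := {e | G.Comp e.1.1 e.1.2 ∧ G.rep e.1.2 = e.1.2}

lemma isCut_repCut (hG : G.IsCVLocal) : G.IsCut G.repCut := by
  refine ⟨fun c hc => ?_, fun e he => exists_isSimpleCycle e he.1⟩
  obtain ⟨v, hv⟩ : ∃ v, v ∈ c := by
    induction c using Cycle.induction_on with
    | nil => exact absurd rfl hc.1
    | cons a l _ => exact ⟨a, by simp⟩
  obtain ⟨e, he, hl⟩ := exists_target hc (rep_mem_of_mem hG hc hv)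
  refine ⟨e, ⟨⟨hl.comp hc, by rw [he, rep_rep]⟩, hl⟩, ?_⟩
  rintro e' ⟨⟨-, h2⟩, hl'⟩
  refine hl'.eq_of_target hc hl ?_
  rw [he, ← h2]
  exact rep_eq_of_comp (comp_of_isSimpleCycle hc (Cycle.Follows.mem_right hl') hv)

lemma IsCut.comp {X : Set G.Edge} (hX : G.IsCut X) {e : G.Edge} (he : e ∈ X) :
    G.Comp e.1.1 e.1.2 := by
  obtain ⟨c, hc, hl⟩ := hX.2 e he
  exact hl.comp hc

lemma IsCut.eq_of_liesOn {X : Set G.Edge} (hX : G.IsCut X) {c : Cycle G.V}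
    (hc : G.IsSimpleCycle c) {e e' : G.Edge} (he : e ∈ X) (hl : e.LiesOn c) (he' : e' ∈ X)
    (hl' : e'.LiesOn c) : e = e' :=
  (hX.1 c hc).unique ⟨he, hl⟩ ⟨he', hl'⟩

/-- After the cycles have been cut open, there is no directed cycle left. -/
lemma IsCut.wellFounded {X : Set G.Edge} (hX : G.IsCut X) :
    WellFounded (fun u v : G.V => ∃ h : G.graph.Adj u v, (⟨(u, v), h⟩ : G.Edge) ∉ X) := by
  set r := fun u v : G.V => ∃ h : G.graph.Adj u v, (⟨(u, v), h⟩ : G.Edge) ∉ X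
  have hirr : ∀ v, ¬ r v v := fun v h => not_adj_self v h.1
  have := G.finite
  have h1 : Std.Irrefl (Relation.TransGen r) := by
    refine ⟨fun v hv => ?_⟩
    obtain ⟨w, hvw, hwv⟩ := Relation.TransGen.head'_iff.1 hv
    obtain ⟨c, hc1, hc2, hc3, -⟩ := Relation.exists_cycle hirr hvw hwv
    have hc : G.IsSimpleCycle c := ⟨hc1, hc2, hc3.imp fun a b h => h.1⟩
    obtain ⟨e, ⟨he, hl⟩, -⟩ := hX.1 c hc
    obtain ⟨_, h2⟩ := Cycle.Follows.rel hc3 hl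
    exact h2 he
  exact Subrelation.wf (fun {a b} h => Relation.TransGen.single h)
    (Finite.wellFounded_of_trans_of_irrefl (Relation.TransGen r))

/-- An application of the super-operator glues the cut edges of a nontrivial strongly connected
component. -/
lemma IsGluingGroup.exists_rep (hG : G.IsCVLocal) {X : Set G.Edge} (hX : G.IsCut X)
    {E : List G.Edge} (hE : G.IsGluingGroup X E) :
    ∃ x, G.rep x = x ∧ (∃ c, G.IsSimpleCycle c ∧ x ∈ c) ∧ E.Nodup ∧
      ∀ e, e ∈ E ↔ e ∈ X ∧ G.Comp e.1.2 x := by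
  obtain ⟨hn, ⟨x, hx, hc, h⟩ | ⟨c, hc, hd, h⟩⟩ := hE
  · have hr := rep_eq_self_of_two_lt_degree hG hx
    refine ⟨x, hr, hc, hn, fun e => (h e).trans ⟨?_, ?_⟩⟩
    · rintro ⟨he, c, hc, hx, hl⟩
      exact ⟨he, comp_of_isSimpleCycle hc (Cycle.Follows.mem_right hl) hx⟩
    · rintro ⟨he, hcomp⟩
      obtain ⟨c, hc, hl⟩ := hX.2 e he
      refine ⟨he, c, hc, ?_, hl⟩
      rw [← hr, ← rep_eq_of_comp hcomp]
      exact rep_mem_of_mem hG hc (Cycle.Follows.mem_right hl)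
  · obtain ⟨e0, ⟨-, hl0⟩, -⟩ := hX.1 c hc
    have hv := Cycle.Follows.mem_right hl0
    have hx := rep_mem_of_mem hG hc hv
    refine ⟨G.rep e0.1.2, rep_rep _, ⟨c, hc, hx⟩, hn, fun e => (h e).trans ?_⟩
    refine and_congr_right fun he => ⟨fun hl => comp_of_isSimpleCycle hc
      (Cycle.Follows.mem_right hl) hx, fun hcomp => ?_⟩
    have hmem : ∀ w, G.Reach (G.rep e0.1.2) w → w ∈ c := by
      intro w hw
      induction hw with
      | refl => exact hx
      | @tail a w _ haw ih =>
        by_cases hl : Edge.LiesOn (G := G) ⟨(a, w), haw⟩ c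
        · exact Cycle.Follows.mem_right hl
        · exact absurd (two_lt_degree_of_leave (e := ⟨(a, w), haw⟩) hc ih hl)
            (not_lt.2 (hd _ ih))
    have hm := hmem _ hcomp.2
    by_contra hl
    exact absurd (two_lt_degree_of_enter hc hm hl) (not_lt.2 (hd _ hm))

/-- The cut edges of a nontrivial component are glued by one application of the super-operator. -/
lemma isGluingGroup_of_rep (hG : G.IsCVLocal) {X : Set G.Edge} (hX : G.IsCut X) {x : G.V}
    (hx : G.rep x = x) (hxc : ∃ c, G.IsSimpleCycle c ∧ x ∈ c) {E : List G.Edge} (hn : E.Nodup)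
    (hE : ∀ e, e ∈ E ↔ e ∈ X ∧ G.Comp e.1.2 x) : G.IsGluingGroup X E := by
  refine ⟨hn, ?_⟩
  by_cases hd : 2 < G.degree x
  · refine Or.inl ⟨x, hd, hxc, fun e => (hE e).trans (and_congr_right fun he => ?_)⟩
    constructor
    · intro hcomp
      obtain ⟨c, hc, hl⟩ := hX.2 e he
      refine ⟨c, hc, ?_, hl⟩
      rw [← hx, ← rep_eq_of_comp hcomp]
      exact rep_mem_of_mem hG hc (Cycle.Follows.mem_right hl)
    · rintro ⟨c, hc, hx, hl⟩
      exact comp_of_isSimpleCycle hc (Cycle.Follows.mem_right hl) hx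
  · obtain ⟨c, hc, hxc⟩ := hxc
    have hd' : ∀ w, G.Comp w x → G.degree w ≤ 2 := by
      intro w hw
      by_contra hlt
      have := rep_eq_self_of_two_lt_degree hG (not_le.1 hlt)
      rw [rep_eq_of_comp hw, hx] at this
      exact hd (this ▸ not_le.1 hlt)
    refine Or.inr ⟨c, hc, fun w hw => hd' w (comp_of_isSimpleCycle hc hw hxc),
      fun e => (hE e).trans (and_congr_right fun he => ?_)⟩
    refine ⟨fun hcomp => ?_, fun hl => comp_of_isSimpleCycle hc (Cycle.Follows.mem_right hl) hxc⟩
    obtain ⟨c', hc', hl'⟩ := hX.2 e he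
    have hmem : e.1.2 ∈ c := by
      have : ∀ w, G.Reach x w → G.Reach w x → w ∈ c := by
        intro w hw
        induction hw with
        | refl => exact fun _ => hxc
        | @tail a w hxa haw ih =>
          intro hwx
          have ha := ih (Relation.ReflTransGen.head haw hwx)
          by_cases hl : Edge.LiesOn (G := G) ⟨(a, w), haw⟩ c
          · exact Cycle.Follows.mem_right hl
          · exact absurd (two_lt_degree_of_leave (e := ⟨(a, w), haw⟩) hc ha hl)
              (not_lt.2 (hd' _ (comp_of_isSimpleCycle hc ha hxc)))
      exact this _ hcomp.2 hcomp.1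
    by_contra hl
    exact absurd (two_lt_degree_of_enter hc hmem hl) (not_lt.2 (hd' _ hcomp))

end FramedCausalGraph

/-! ### Counting in lists -/

section ListCount

variable {α : Type*} {l : List α} {p : α → Bool}

lemma List.Nodup.countP_le_one (hl : l.Nodup)
    (h : ∀ a ∈ l, ∀ b ∈ l, p a → p b → a = b) : l.countP p ≤ 1 := by
  rw [List.countP_eq_length_filter]
  have hn := hl.filter p
  rcases hf : l.filter p with _ | ⟨a, _ | ⟨b, m⟩⟩
  · simp
  · simp
  · have ha : a ∈ l.filter p := by simp [hf]
    have hb : b ∈ l.filter p := by simp [hf]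
    rw [List.mem_filter] at ha hb
    have := h a ha.1 b hb.1 ha.2 hb.2
    rw [hf] at hn
    simp [this] at hn

lemma List.eq_of_countP_le_one (h : l.countP p ≤ 1) {a b : α} (ha : a ∈ l) (hb : b ∈ l)
    (hpa : p a) (hpb : p b) : a = b := by
  rw [List.countP_eq_length_filter] at h
  have ha' := List.mem_filter.2 ⟨ha, hpa⟩
  have hb' := List.mem_filter.2 ⟨hb, hpb⟩
  rcases hf : l.filter p with _ | ⟨x, _ | ⟨y, m⟩⟩
  · simp [hf] at ha'
  · rw [hf, List.mem_singleton] at ha' hb'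
    rw [ha', hb']
  · simp [hf] at h

/-- The elements of a finite type with a given property, in some order. -/
noncomputable def finiteList {α : Type*} [Finite α] (p : α → Prop) : List α :=
  (Set.toFinite {a | p a}).toFinset.toList

lemma nodup_finiteList {α : Type*} [Finite α] (p : α → Prop) : (finiteList p).Nodup :=
  Finset.nodup_toList _

@[simp] lemma mem_finiteList {α : Type*} [Finite α] {p : α → Prop} {a : α} :
    a ∈ finiteList p ↔ p a := by
  simp [finiteList]

end ListCount

/-! ### Drawings of diagrams with cycles -/

namespace BoxSystem.Run

variable {C : Type u₁} [Category.{v₁} C] [MonoidalCategory C] [SymmetricCategory C]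
variable {ι β : Type} {obj : ι → C} {B : BoxSystem obj β}

lemma mor (b : β) : B.Run (B.inp b) [b] (B.out b) (B.mor b) := by
  have h := ((Run.of_wirePerm (B := B) (.wiresCast (List.append_nil (B.inp b)).symm)).append
    (single b [])).perm (.wiresCast (List.append_nil (B.out b)))
  rw [wiresRight_nil] at h
  simpa using h

lemma mem_of_mem_inp {L M : List ι} {S : List β} {f : wires obj L ⟶ wires obj M}
    (hf : B.Run L S M f) {b : β} (hb : b ∈ S) {i : ι} (hi : i ∈ B.inp b) :
    i ∈ L ∨ ∃ b' ∈ S, i ∈ B.out b' := by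
  have : i ∈ L ++ S.flatMap B.out :=
    hf.flatMap_perm.subset (List.mem_append_right _ (List.mem_flatMap.2 ⟨b, hb, hi⟩))
  simpa using this

lemma countP_eq {L M : List ι} {S : List β} {f : wires obj L ⟶ wires obj M}
    (hf : B.Run L S M f) {p : ι → Bool}
    (h : ∀ b ∈ S, (B.inp b).countP p = (B.out b).countP p) : M.countP p = L.countP p := by
  have h1 := hf.flatMap_perm.countP_eq p
  have h2 : (S.flatMap B.inp).countP p = (S.flatMap B.out).countP p := by
    rw [List.countP_flatMap, List.countP_flatMap]
    exact congrArg _ (List.map_congr_left fun b hb => h b hb)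
  rw [List.countP_append, List.countP_append] at h1
  omega

end BoxSystem.Run

namespace FramedCausalGraph

variable {G : FramedCausalGraph}

instance : Finite G.V := G.finite

lemma nodup_flatMap_incoming {S : List G.Internal} (hS : S.Nodup) :
    (S.flatMap fun x => G.incoming x.1).Nodup := by
  refine List.nodup_flatMap.2 ⟨fun x _ => G.incoming_nodup _, hS.imp fun {a b} hab e he he' => ?_⟩
  exact hab (Subtype.ext (((G.mem_incoming _ _).1 he).symm.trans ((G.mem_incoming _ _).1 he')))

lemma nodup_flatMap_outgoing {S : List G.Internal} (hS : S.Nodup) :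
    (S.flatMap fun x => G.outgoing x.1).Nodup := by
  refine List.nodup_flatMap.2 ⟨fun x _ => G.outgoing_nodup _, hS.imp fun {a b} hab e he he' => ?_⟩
  exact hab (Subtype.ext (((G.mem_outgoing _ _).1 he).symm.trans ((G.mem_outgoing _ _).1 he')))

lemma mem_flatMap_incoming {S : List G.Internal} {e : G.Edge} :
    e ∈ S.flatMap (fun x => G.incoming x.1) ↔ e.1.2 ∈ S.map Subtype.val := by
  simp only [List.mem_flatMap, G.mem_incoming, List.mem_map]
  exact exists_congr fun x => and_congr_right fun _ => eq_comm

lemma mem_flatMap_outgoing {S : List G.Internal} {e : G.Edge} :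
    e ∈ S.flatMap (fun x => G.outgoing x.1) ↔ e.1.1 ∈ S.map Subtype.val := by
  simp only [List.mem_flatMap, G.mem_outgoing, List.mem_map]
  exact exists_congr fun x => and_congr_right fun _ => eq_comm

open Classical in
/-- A simple cycle enters a node as often as it leaves it, namely once or never. -/
lemma countP_liesOn {c : Cycle G.V} (hc : G.IsSimpleCycle c) (x : G.V) :
    (G.incoming x).countP (fun e : G.Edge => e.LiesOn c) =
      (G.outgoing x).countP (fun e : G.Edge => e.LiesOn c) := by
  by_cases hx : x ∈ c
  · obtain ⟨e, he, hl⟩ := exists_target hc hx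
    obtain ⟨e', he', hl'⟩ := exists_source hc hx
    have h1 : 0 < (G.incoming x).countP (fun e : G.Edge => e.LiesOn c) :=
      List.countP_pos_iff.2 ⟨e, (G.mem_incoming _ _).2 he, by simpa using hl⟩
    have h2 : 0 < (G.outgoing x).countP (fun e : G.Edge => e.LiesOn c) :=
      List.countP_pos_iff.2 ⟨e', (G.mem_outgoing _ _).2 he', by simpa using hl'⟩
    have h3 : (G.incoming x).countP (fun e : G.Edge => e.LiesOn c) ≤ 1 :=
      (G.incoming_nodup x).countP_le_one fun a ha b hb hpa hpb =>
        Edge.LiesOn.eq_of_target hc (by simpa using hpa) (by simpa using hpb)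
          (((G.mem_incoming _ _).1 ha).trans ((G.mem_incoming _ _).1 hb).symm)
    have h4 : (G.outgoing x).countP (fun e : G.Edge => e.LiesOn c) ≤ 1 :=
      (G.outgoing_nodup x).countP_le_one fun a ha b hb hpa hpb =>
        Edge.LiesOn.eq_of_source hc (by simpa using hpa) (by simpa using hpb)
          (((G.mem_outgoing _ _).1 ha).trans ((G.mem_outgoing _ _).1 hb).symm)
    omega
  · rw [List.countP_eq_zero.2, List.countP_eq_zero.2]
    · intro e he hl
      rw [G.mem_outgoing] at he
      exact hx (he ▸ Cycle.Follows.mem_left (of_decide_eq_true hl))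
    · intro e he hl
      rw [G.mem_incoming] at he
      exact hx (he ▸ Cycle.Follows.mem_right (of_decide_eq_true hl))

lemma notMem_of_edges {e f : G.Edge} (h : e.1.2 = f.1.1) :
    e.1.2 ∉ G.inputs ∧ e.1.2 ∉ G.outputs := by
  constructor
  · intro hi
    have := (G.mem_incoming e.1.2 e).2 rfl
    rw [G.incoming_input _ hi] at this
    exact absurd this (by simp)
  · intro ho
    have := (G.mem_outgoing e.1.2 f).2 h.symm
    rw [G.outgoing_output _ ho] at this
    exact absurd this (by simp)

lemma notMem_of_mem_cycle {c : Cycle G.V} (hc : G.IsSimpleCycle c) {v : G.V} (hv : v ∈ c) :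
    v ∉ G.inputs ∧ v ∉ G.outputs := by
  obtain ⟨e, rfl, -⟩ := exists_target hc hv
  obtain ⟨f, hf, -⟩ := exists_source hc hv
  exact notMem_of_edges hf.symm

lemma exists_cycle_of_comp {v w : G.V} (h : G.Comp v w) (hne : v ≠ w) :
    ∃ c, G.IsSimpleCycle c ∧ v ∈ c := by
  obtain ⟨h1, h2⟩ := h
  rcases Relation.ReflTransGen.cases_head h1 with h | ⟨u, hu, h⟩
  · exact absurd h hne
  · obtain ⟨c, hc, hl⟩ := exists_isSimpleCycle (G := G) ⟨(v, u), hu⟩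
      ⟨Relation.ReflTransGen.single hu, Reach.trans h h2⟩
    exact ⟨c, hc, Cycle.Follows.mem_left hl⟩

variable (G) in
/-- The edges entering the component of `x` from outside. -/
noncomputable def compIn (x : G.V) : List G.Edge :=
  finiteList fun e => G.Comp e.1.2 x ∧ ¬ G.Comp e.1.1 e.1.2

variable (G) in
/-- The edges leaving the component of `x`. -/
noncomputable def compOut (x : G.V) : List G.Edge :=
  finiteList fun e => G.Comp e.1.1 x ∧ ¬ G.Comp e.1.1 e.1.2

/-- Conditions on a list of wires `L` and a list of nodes `S` ensuring that no wire ever occurs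
twice when nodes in `S` are drawn on `L`: at most one wire from each cycle is present, and only
wires on cycles have their source drawn again. -/
structure Good (L : List G.Edge) (S : List G.Internal) : Prop where
  nodup_wires : L.Nodup
  nodup_nodes : S.Nodup
  comp : ∀ e ∈ L, e.1.1 ∈ S.map Subtype.val → G.Comp e.1.1 e.1.2
  cycle : ∀ c, G.IsSimpleCycle c → ∀ e ∈ L, ∀ e' ∈ L, e.LiesOn c → e'.LiesOn c → e = e'

end FramedCausalGraph

namespace CausalDiagram

open FramedCausalGraph

variable {C : Type u₁} [Category.{v₁} C] [MonoidalCategory C]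
variable {G : FramedCausalGraph} (d : CausalDiagram G C)

/-- The processes at the internal nodes, as boxes. -/
def boxes : BoxSystem d.obj G.Internal where
  inp x := G.incoming x.1
  out x := G.outgoing x.1
  mor x := toWires (d.mor x)

variable [SymmetricCategory C] {d}

lemma toWires_braiding (a b : G.Edge) :
    toWires (M := [a, b]) (N := [b, a]) (β_ (d.obj a) (d.obj b)).hom =
      tensorSwap (d.obj a) (d.obj b) (𝟙_ C) := by
  have key : ∀ A B : C, (whiskerLeftIso A (ρ_ B).symm).inv ≫ (β_ A B).hom ≫
      (whiskerLeftIso B (ρ_ A).symm).hom = tensorSwap A B (𝟙_ C) := by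
    intro A B
    simp [tensorSwap]
  exact key _ _

lemma Draws.run {L M : List G.Edge} {S : List G.Internal}
    {f : wireTensor d.obj L ⟶ wireTensor d.obj M} (h : d.Draws L S M f) :
    d.boxes.Run L S M (toWires f) := by
  induction h with
  | start => rw [toWires_id]; exact .start
  | @cross S l r a b f h ih =>
    have key : ∀ x : wireTensor d.obj [a, b] ⟶ wireTensor d.obj [b, a],
        WirePerm d.obj [a, b] [b, a] (toWires x) →
        d.boxes.Run L S (l ++ [b, a] ++ r) (toWires (f ≫ wireWhisker d.obj l r x)) := by
      intro x hx
      rw [toWires_comp, toWires_wireWhisker]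
      exact ih.perm ((hx.wiresLeft l).wiresRight r)
    refine key _ ?_
    have := WirePerm.swap (obj := d.obj) a b []
    exact (toWires_braiding (d := d) a b).symm ▸ this
  | node x h ih =>
    rw [toWires_comp, toWires_wireWhisker]
    exact ih.append (((BoxSystem.Run.mor (B := d.boxes) x).wiresLeft _).wiresRight _)

lemma Draws.perm {L M N : List G.Edge} {S : List G.Internal}
    {f : wireTensor d.obj L ⟶ wireTensor d.obj M} (h : d.Draws L S M f) (hp : M.Perm N) :
    ∃ f', d.Draws L S N f' := by
  have key : ∀ l, (∃ f, d.Draws L S (l ++ M) f) → ∃ f, d.Draws L S (l ++ N) f := by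
    clear h f
    have cast : ∀ {M N : List G.Edge}, M = N → (∃ f, d.Draws L S M f) → ∃ f, d.Draws L S N f := by
      rintro M _ rfl h
      exact h
    induction hp with
    | nil => exact fun _ h => h
    | cons a _ ih => exact fun l h => cast (by simp) (ih (l ++ [a]) (cast (by simp) h))
    | swap a b M =>
      intro l h
      obtain ⟨f', h'⟩ := cast (N := l ++ [b, a] ++ M) (by simp) h
      exact cast (by simp) ⟨_, h'.cross⟩
    | trans _ _ h1 h2 => exact fun l h => h2 l (h1 l h)
  exact key [] ⟨f, h⟩

lemma Draws.exists_node {L M R : List G.Edge} {S : List G.Internal}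
    {f : wireTensor d.obj L ⟶ wireTensor d.obj M} (h : d.Draws L S M f) (x : G.Internal)
    (hp : M.Perm (G.incoming x.1 ++ R)) :
    ∃ f', d.Draws L (S ++ [x]) (G.outgoing x.1 ++ R) f' := by
  obtain ⟨f', h'⟩ := h.perm hp
  exact ⟨_, Draws.node (l := []) x h'⟩

lemma Draws.flatMap_perm {L M : List G.Edge} {S : List G.Internal}
    {f : wireTensor d.obj L ⟶ wireTensor d.obj M} (h : d.Draws L S M f) :
    (M ++ S.flatMap fun x => G.incoming x.1).Perm (L ++ S.flatMap fun x => G.outgoing x.1) :=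
  h.run.flatMap_perm

/-- A set of nodes can be drawn as soon as each of their incoming edges is available from the start
or comes out of one of these nodes without having been cut: the nodes are drawn in the order
obtained by cutting all cycles open. -/
lemma exists_draws {X : Set G.Edge} (hX : G.IsCut X) {A : List G.Internal} (hA : A.Nodup)
    {L N : List G.Edge}
    (h : ∀ z ∈ A, ∀ e ∈ G.incoming z.1, e ∈ L ∨ e.1.1 ∈ A.map Subtype.val ∧ e ∉ X)
    (hN : (N ++ A.flatMap fun x => G.incoming x.1).Perm
      (L ++ A.flatMap fun x => G.outgoing x.1)) :
    ∃ (S : List G.Internal) (f : _), S.Perm A ∧ d.Draws L S N f := by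
  classical
  have key : ∀ n ≤ A.length, ∃ (S : List G.Internal) (M : List G.Edge) (f : _),
      S.length = n ∧ S.Nodup ∧ S ⊆ A ∧ d.Draws L S M f := by
    intro n
    induction n with
    | zero => exact fun _ => ⟨[], L, _, rfl, List.nodup_nil, by simp, .start⟩
    | succ n ih =>
      intro hn
      obtain ⟨S, M, f, hS, hSn, hSA, hf⟩ := ih (by omega)
      obtain ⟨z0, hz0, hz0'⟩ : ∃ z ∈ A, z ∉ S := by
        by_contra! hcon
        have := (List.subperm_of_subset hA hcon).length_le
        omega
      have hwf := InvImage.wf (Subtype.val : G.Internal → G.V) hX.wellFounded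
      obtain ⟨z, ⟨hzA, hzS⟩, hmin⟩ := hwf.has_min {z | z ∈ A ∧ z ∉ S} ⟨z0, hz0, hz0'⟩
      have hsub : G.incoming z.1 ⊆ M := by
        intro e he
        have h1 : e ∈ L ++ S.flatMap fun x => G.outgoing x.1 := by
          rcases h z hzA e he with h1 | ⟨h1, h2⟩
          · exact List.mem_append_left _ h1
          · obtain ⟨s, hs, hse⟩ := List.mem_map.1 h1
            refine List.mem_append_right _ (mem_flatMap_outgoing.2 (List.mem_map.2 ⟨s, ?_, hse⟩))
            by_contra hsS
            obtain ⟨⟨a, b⟩, hab⟩ := e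
            have hb : b = z.1 := (G.mem_incoming _ _).1 he
            subst hb
            have ha : s.1 = a := hse
            subst ha
            exact hmin s ⟨hs, hsS⟩ ⟨hab, h2⟩
        have h2 := hf.flatMap_perm.symm.subset h1
        refine (List.mem_append.1 h2).resolve_right fun h3 => hzS ?_
        rw [mem_flatMap_incoming, (G.mem_incoming _ _).1 he] at h3
        obtain ⟨s, hs, hsz⟩ := List.mem_map.1 h3
        exact Subtype.ext hsz ▸ hs
      obtain ⟨R, hR⟩ := (G.incoming_nodup z.1).exists_perm_append hsub
      obtain ⟨f', hf'⟩ := hf.exists_node z hR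
      refine ⟨S ++ [z], _, f', by simp [hS], ?_, ?_, hf'⟩
      · rw [List.nodup_append]
        exact ⟨hSn, by simp, by rintro a ha b hb rfl; exact hzS (by simp at hb; exact hb ▸ ha)⟩
      · intro a ha
        rcases List.mem_append.1 ha with ha | ha
        · exact hSA ha
        · simp at ha; exact ha ▸ hzA
  obtain ⟨S, M, f, hS, hSn, hSA, hf⟩ := key A.length le_rfl
  have hSA' : S.Perm A := (List.subperm_of_subset hSn hSA).perm_of_length_le hS.ge
  have h1 := hf.flatMap_perm
  have h2 := hSA'.flatMap_right (fun x => G.incoming x.1)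
  have h3 := hSA'.flatMap_right (fun x => G.outgoing x.1)
  have hMN : M.Perm N := by
    have h4 := ((h2.append_left M).symm.trans h1).trans ((h3.append_left L).trans hN.symm)
    exact (List.perm_append_right_iff _).1 h4
  obtain ⟨f', hf'⟩ := hf.perm hMN
  exact ⟨S, f', hSA', hf'⟩

section Run

variable {L M : List G.Edge} {S : List G.Internal} {f : wires d.obj L ⟶ wires d.obj M}

open Classical in
/-- Drawing nodes does not change the number of wires present from a given cycle. -/
lemma countP_liesOn_eq (hf : d.boxes.Run L S M f) {c : Cycle G.V} (hc : G.IsSimpleCycle c) :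
    M.countP (fun e : G.Edge => e.LiesOn c) = L.countP (fun e : G.Edge => e.LiesOn c) :=
  hf.countP_eq fun b _ => countP_liesOn hc b.1

/-- If no wire from a cycle is present, the nodes of the cycle cannot be drawn. -/
lemma notMem_of_run (hf : d.boxes.Run L S M f) {c : Cycle G.V} (hc : G.IsSimpleCycle c)
    (hL : ∀ e ∈ L, ¬ e.LiesOn c) {z : G.Internal} (hz : z ∈ S) : z.1 ∉ c := by
  classical
  intro hzc
  obtain ⟨S1, S2, rfl⟩ := List.append_of_mem hz
  obtain ⟨N, g, h, hg, hh, -⟩ := hf.split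
  obtain ⟨O, h1, -, hh1, -, -⟩ := BoxSystem.Run.split (S := [z]) (T := S2) hh
  obtain ⟨R, p, -, hp, -, -⟩ := hh1.exists_eq_of_singleton
  obtain ⟨e, he, hl⟩ := exists_target hc hzc
  have h1 := countP_liesOn_eq hg hc
  have h2 : L.countP (fun e : G.Edge => e.LiesOn c) = 0 :=
    List.countP_eq_zero.2 (by simpa using hL)
  rw [h2] at h1
  refine List.countP_eq_zero.1 h1 e ?_ (by simpa using hl)
  exact hp.perm.mem_iff.2 (List.mem_append_left _ ((G.mem_incoming _ _).2 he))

/-- No wire ever occurs twice: for an edge on a cycle because the number of wires from this cycle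
does not change, for any other edge because it is either present from the start or drawn, not both.
-/
lemma safe_of_good (h : Good L S) : d.boxes.Safe L S := by
  classical
  intro S' M f hf hS'
  have hS'n : S'.Nodup := by
    obtain ⟨T, hT, hTS⟩ := hS'
    exact hT.nodup_iff.1 (h.nodup_nodes.sublist hTS)
  rw [List.nodup_iff_count_le_one]
  intro e
  by_cases he : G.Comp e.1.1 e.1.2
  · obtain ⟨c, hc, hl⟩ := exists_isSimpleCycle e he
    have h1 := countP_liesOn_eq hf hc
    have h2 : L.countP (fun e : G.Edge => e.LiesOn c) ≤ 1 := h.nodup_wires.countP_le_one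
      fun a ha b hb hpa hpb => h.cycle c hc a ha b hb (by simpa using hpa) (by simpa using hpb)
    have h3 : M.count e ≤ M.countP (fun e : G.Edge => e.LiesOn c) := by
      rw [List.count]
      refine List.countP_mono_left fun x _ hx => ?_
      obtain rfl : x = e := eq_of_beq hx
      simpa using hl
    omega
  · have h1 := hf.flatMap_perm.count_eq e
    rw [List.count_append, List.count_append] at h1
    have h2 := List.nodup_iff_count_le_one.1 h.nodup_wires e
    have h3 := List.nodup_iff_count_le_one.1 (nodup_flatMap_outgoing hS'n) e
    have h4 : L.count e = 0 ∨ (S'.flatMap d.boxes.out).count e = 0 := by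
      by_contra! hcon
      have h5 := List.count_pos_iff.1 (Nat.pos_of_ne_zero hcon.1)
      have h6 := mem_flatMap_outgoing.1 (List.count_pos_iff.1 (Nat.pos_of_ne_zero hcon.2))
      exact he (h.comp e h5 (List.map_subset _ hS'.subset h6))
    change (S'.flatMap d.boxes.out).count e ≤ 1 at h3
    omega

/-- Under the conditions `Good`, all drawings of a set of nodes between given lists of wires agree.
-/
lemma run_unique {S' : List G.Internal} {f' : wires d.obj L ⟶ wires d.obj M}
    (hf : d.boxes.Run L S M f) (hf' : d.boxes.Run L S' M f') (hS : S.Perm S') (h : Good L S) :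
    f = f' := by
  have := hf.unique hf' hS (safe_of_good h) (nodup_flatMap_incoming h.nodup_nodes)
    (nodup_flatMap_outgoing h.nodup_nodes) (.refl _)
  simpa using this

open Classical in
/-- Balance of the wires: the number of occurrences of an edge changes by one when its source or
its target is drawn. -/
lemma count_add_eq (hf : d.boxes.Run L S M f) (hS : S.Nodup) (e : G.Edge) :
    M.count e + (if e.1.2 ∈ S.map Subtype.val then 1 else 0) =
      L.count e + (if e.1.1 ∈ S.map Subtype.val then 1 else 0) := by
  have h1 := hf.flatMap_perm.count_eq e
  have h2 : (S.flatMap d.boxes.inp).count e = if e.1.2 ∈ S.map Subtype.val then 1 else 0 := by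
    exact (List.Nodup.count (nodup_flatMap_incoming hS)).trans
      (if_congr mem_flatMap_incoming rfl rfl)
  have h3 : (S.flatMap d.boxes.out).count e = if e.1.1 ∈ S.map Subtype.val then 1 else 0 := by
    exact (List.Nodup.count (nodup_flatMap_outgoing hS)).trans
      (if_congr mem_flatMap_outgoing rfl rfl)
  rw [List.count_append, List.count_append, h2, h3] at h1
  exact h1

end Run

end CausalDiagram

/-! ### Components inside a piece of a diagram -/

namespace CausalDiagram

open FramedCausalGraph

variable {C : Type u₁} [Category.{v₁} C] [MonoidalCategory C] [SymmetricCategory C]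
variable {G : FramedCausalGraph} {d : CausalDiagram G C} {X : Set G.Edge} {x : G.V}

lemma mem_map_val_iff (hI : ∀ w, G.Comp w x → w ∉ G.inputs ∧ w ∉ G.outputs)
    {T : List G.Internal} (hT : ∀ z, z ∈ T ↔ G.Comp z.1 x) {v : G.V} :
    v ∈ T.map Subtype.val ↔ G.Comp v x := by
  constructor
  · rintro h
    obtain ⟨z, hz, rfl⟩ := List.mem_map.1 h
    exact (hT z).1 hz
  · exact fun h => List.mem_map.2 ⟨⟨v, hI v h⟩, (hT _).2 h, rfl⟩

/-- The nodes of a component turn the edges entering the component into those leaving it. -/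
lemma comp_balance (hI : ∀ w, G.Comp w x → w ∉ G.inputs ∧ w ∉ G.outputs)
    {T : List G.Internal} (hTn : T.Nodup) (hT : ∀ z, z ∈ T ↔ G.Comp z.1 x) :
    (G.compOut x ++ T.flatMap fun z => G.incoming z.1).Perm
      (G.compIn x ++ T.flatMap fun z => G.outgoing z.1) := by
  classical
  rw [List.perm_iff_count]
  intro e
  have h1 : (G.compIn x).count e = _ := List.Nodup.count (nodup_finiteList _)
  have h2 : (G.compOut x).count e = _ := List.Nodup.count (nodup_finiteList _)
  have h3 := List.Nodup.count (a := e) (nodup_flatMap_incoming hTn)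
  have h4 := List.Nodup.count (a := e) (nodup_flatMap_outgoing hTn)
  rw [List.count_append, List.count_append, h1, h2, h3, h4]
  simp only [mem_flatMap_incoming, mem_flatMap_outgoing, mem_map_val_iff hI hT, compIn, compOut,
    mem_finiteList]
  by_cases ha : G.Comp e.1.1 x <;> by_cases hb : G.Comp e.1.2 x
  · simp [ha, hb, ha.trans hb.symm]
  · have hab : ¬ G.Comp e.1.1 e.1.2 := fun h => hb (h.symm.trans ha)
    simp [ha, hb, hab]
  · have hab : ¬ G.Comp e.1.1 e.1.2 := fun h => ha (h.trans hb)
    simp [ha, hb, hab]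
  · simp [ha, hb]

/-- The nodes of a component can be drawn once its cycles have been cut open. -/
lemma exists_draws_comp (hX : G.IsCut X) (hI : ∀ w, G.Comp w x → w ∉ G.inputs ∧ w ∉ G.outputs)
    {E : List G.Edge} (hE : ∀ e, e ∈ E ↔ e ∈ X ∧ G.Comp e.1.2 x) :
    ∃ (T : List G.Internal) (φ : _), T.Nodup ∧ (∀ z, z ∈ T ↔ G.Comp z.1 x) ∧
      d.Draws (G.compIn x ++ E) T (G.compOut x ++ E) φ := by
  have hA : ∀ z : G.Internal, z ∈ finiteList (fun z : G.Internal => G.Comp z.1 x) ↔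
      G.Comp z.1 x := fun z => mem_finiteList
  have hAn := nodup_finiteList (fun z : G.Internal => G.Comp z.1 x)
  obtain ⟨T, φ, hT, h⟩ := exists_draws (d := d) hX hAn (L := G.compIn x ++ E)
    (N := G.compOut x ++ E) (by
      intro z hz e he
      have hz := (hA z).1 hz
      rw [G.mem_incoming] at he
      rw [← he] at hz
      rw [mem_map_val_iff hI hA, List.mem_append, hE, compIn, mem_finiteList]
      by_cases h1 : G.Comp e.1.1 e.1.2
      · by_cases h2 : e ∈ X
        · exact Or.inl (Or.inr ⟨h2, hz⟩)
        · exact Or.inr ⟨h1.trans hz, h2⟩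
      · exact Or.inl (Or.inl ⟨hz, h1⟩)) (by
      have h := comp_balance hI hAn hA
      classical
      rw [List.perm_iff_count] at h ⊢
      intro e
      have := h e
      simp only [List.count_append] at this ⊢
      omega)
  exact ⟨T, φ, hT.nodup_iff.2 hAn, fun z => hT.mem_iff.trans (hA z), h⟩

lemma good_append (hX : G.IsCut X) {H E : List G.Edge} {T : List G.Internal} (hH : H.Nodup)
    (hE : E.Nodup) (hEX : ∀ e ∈ E, e ∈ X) (hT : T.Nodup) (hHc : ∀ e ∈ H, ¬ G.Comp e.1.1 e.1.2)
    (hHT : ∀ e ∈ H, e.1.1 ∉ T.map Subtype.val) : Good (H ++ E) T where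
  nodup_wires := by
    refine List.nodup_append.2 ⟨hH, hE, ?_⟩
    rintro e he e' he' rfl
    exact hHc e he (hX.comp (hEX e he'))
  nodup_nodes := hT
  comp := by
    intro e he heT
    rcases List.mem_append.1 he with h | h
    · exact absurd heT (hHT e h)
    · exact hX.comp (hEX e h)
  cycle := by
    intro c hc e he e' he' hl hl'
    rcases List.mem_append.1 he with h | h
    · exact absurd (hl.comp hc) (hHc e h)
    rcases List.mem_append.1 he' with h' | h'
    · exact absurd (hl'.comp hc) (hHc e' h')
    exact hX.eq_of_liesOn hc (hEX e h) hl (hEX e' h') hl'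

lemma good_comp (hX : G.IsCut X) {E : List G.Edge} (hEn : E.Nodup)
    (hE : ∀ e, e ∈ E ↔ e ∈ X ∧ G.Comp e.1.2 x) {T : List G.Internal} (hTn : T.Nodup)
    (hT : ∀ z ∈ T, G.Comp z.1 x) : Good (G.compIn x ++ E) T := by
  refine good_append hX (nodup_finiteList _) hEn (fun e he => ((hE e).1 he).1) hTn
    (fun e he => (mem_finiteList.1 he).2) fun e he heT => ?_
  obtain ⟨h1, h2⟩ := mem_finiteList.1 he
  obtain ⟨z, hz, hze⟩ := List.mem_map.1 heT
  exact h2 ((hze ▸ hT z hz).trans h1.symm)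

/-- The two ways of cutting a component open, at an arbitrary cut or at the edges entering its
representative `x`, differ by the nodes `Tp` which are drawn before `x` in the former and after the
other nodes in the latter. -/
lemma exists_slide (hG : G.IsCVLocal) (hX : G.IsCut X) (hx : G.rep x = x)
    (hI : ∀ w, G.Comp w x → w ∉ G.inputs ∧ w ∉ G.outputs)
    {E E' : List G.Edge} (hEn : E.Nodup) (hE : ∀ e, e ∈ E ↔ e ∈ X ∧ G.Comp e.1.2 x)
    (hEn' : E'.Nodup) (hE' : ∀ e, e ∈ E' ↔ e ∈ G.repCut ∧ G.Comp e.1.2 x)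
    {T : List G.Internal} (hTn : T.Nodup) (hT : ∀ z, z ∈ T ↔ G.Comp z.1 x)
    {φ : wires d.obj (G.compIn x ++ E) ⟶ wires d.obj (G.compOut x ++ E)}
    (hφ : d.boxes.Run (G.compIn x ++ E) T (G.compOut x ++ E) φ) :
    ∃ (Tp Tq : List G.Internal) (f : wires d.obj E ⟶ wires d.obj E')
      (ψ : wires d.obj (G.compIn x ++ E') ⟶ wires d.obj (G.compOut x ++ E)),
      (Tp ++ Tq).Perm T ∧ d.boxes.Run E Tp E' f ∧
        d.boxes.Run (G.compIn x ++ E') Tq (G.compOut x ++ E) ψ := by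
  classical
  set x' : G.Internal := ⟨x, hI x (.refl x)⟩ with hx'
  obtain ⟨Tp, Tq, rfl⟩ := List.append_of_mem ((hT x').2 (.refl x))
  -- The wires `M` are those present when `x` is about to be drawn.
  obtain ⟨M, g, h, hg, hh, -⟩ := hφ.split
  have hgood := good_comp hX hEn hE hTn (fun z hz => (hT z).1 hz)
  have hM : M.Nodup := safe_of_good hgood _ _ _ hg (List.sublist_append_left _ _).subperm
  have hTpn : Tp.Nodup := hTn.sublist (List.sublist_append_left _ _)
  have hTpx : ∀ z ∈ Tp, G.Comp z.1 x ∧ z.1 ≠ x := by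
    intro z hz
    refine ⟨(hT z).1 (List.mem_append_left _ hz), fun hzx => ?_⟩
    have : z = x' := Subtype.ext hzx
    subst this
    exact (List.nodup_append.1 hTn).2.2 _ hz _ (by simp) rfl
  have hrep : ∀ {v}, G.Comp v x → v ≠ x → G.rep v ≠ v := by
    intro v hv hne h
    rw [rep_eq_of_comp hv, hx] at h
    exact hne h.symm
  have hxM : ∀ e ∈ G.incoming x, e ∈ M := by
    obtain ⟨O, h1, -, hh1, -, -⟩ := BoxSystem.Run.split (S := [x']) (T := Tq) hh
    obtain ⟨R, p, -, hp, -, -⟩ := hh1.exists_eq_of_singleton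
    exact fun e he => hp.perm.mem_iff.2 (List.mem_append_left _ he)
  have hcount := count_add_eq hg hTpn
  have hE'mem : ∀ {e}, e ∈ E' ↔ G.Comp e.1.1 x ∧ e.1.2 = x := by
    intro e
    rw [hE']
    constructor
    · rintro ⟨⟨h1, h2⟩, h3⟩
      rw [rep_eq_of_comp h3, hx] at h2
      exact ⟨h1.trans h3, h2.symm⟩
    · rintro ⟨h1, h2⟩
      exact ⟨⟨h2 ▸ h1, h2 ▸ hx⟩, h2 ▸ .refl _⟩
  have hInE' : (G.compIn x ++ E').Nodup :=
    (good_comp (isCut_repCut hG) hEn' hE' hTn (fun z hz => (hT z).1 hz)).nodup_wires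
  -- The wires present when `x` is drawn are the edges entering `x`.
  have hMperm : M.Perm (G.compIn x ++ E') := by
    refine (List.perm_ext_iff_of_nodup hM hInE').2 fun e => ?_
    have hin : e ∈ G.compIn x → e.1.2 = x := by
      intro he
      obtain ⟨h1, h2⟩ := mem_finiteList.1 he
      by_contra hne
      exact h2 (comp_of_target_ne_rep hG (hrep h1 hne))
    constructor
    · intro he
      rw [List.mem_append]
      have h1 : 0 < M.count e := List.count_pos_iff.2 he
      by_cases hein : e ∈ G.compIn x
      · exact Or.inl hein
      refine Or.inr ?_
      -- The remaining wires lie on cycles of the component, and each of these cycles contributes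
      -- a single wire, namely the one entering `x`.
      have hcomp : G.Comp e.1.1 e.1.2 ∧ G.Comp e.1.2 x := by
        have h2 := hcount e
        by_cases heE : e ∈ E
        · exact ⟨hX.comp ((hE e).1 heE).1, ((hE e).1 heE).2⟩
        · rw [List.count_eq_zero.2 (by simp [hein, heE] : e ∉ G.compIn x ++ E)] at h2
          have h3 : e.1.1 ∈ Tp.map Subtype.val := by
            by_contra h3
            simp only [h3, if_false] at h2
            omega
          obtain ⟨z, hz, hze⟩ := List.mem_map.1 h3
          obtain ⟨h4, h5⟩ := hTpx z hz
          rw [hze] at h4 h5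
          have h6 := comp_of_source_ne_rep hG (hrep h4 h5)
          exact ⟨h6, h6.symm.trans h4⟩
      obtain ⟨c, hc, hl⟩ := exists_isSimpleCycle e hcomp.1
      have hxc : x ∈ c := by
        rw [← hx, ← rep_eq_of_comp hcomp.2]
        exact rep_mem_of_mem hG hc (Cycle.Follows.mem_right hl)
      obtain ⟨e', he', hl'⟩ := exists_target hc hxc
      have he'M := hxM e' ((G.mem_incoming _ _).2 he')
      have h2 : M.countP (fun e : G.Edge => e.LiesOn c) ≤ 1 := by
        rw [countP_liesOn_eq hg hc]
        exact hgood.nodup_wires.countP_le_one fun a ha b hb hpa hpb =>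
          hgood.cycle c hc a ha b hb (by simpa using hpa) (by simpa using hpb)
      have := List.eq_of_countP_le_one h2 he he'M (by simpa using hl) (by simpa using hl')
      subst this
      exact hE'mem.2 ⟨hcomp.1.trans hcomp.2, he'⟩
    · intro he
      refine hxM e ((G.mem_incoming _ _).2 ?_)
      rcases List.mem_append.1 he with he | he
      · exact hin he
      · exact (hE'mem.1 he).2
  -- The edges of the nodes in `Tp` stay in the component, so these nodes can be drawn without the
  -- wires entering the component.
  obtain ⟨Tp', f, hTp', hf⟩ := exists_draws (d := d) hX hTpn (L := E) (N := E') (by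
    intro z hz e he
    obtain ⟨h1, h2⟩ := hTpx z hz
    rw [← (G.mem_incoming _ _).1 he] at h1 h2
    have h3 := comp_of_target_ne_rep hG (hrep h1 h2)
    by_cases heE : e ∈ E
    · exact Or.inl heE
    refine Or.inr ⟨?_, fun heX => heE ((hE e).2 ⟨heX, h1⟩)⟩
    rcases hg.mem_of_mem_inp hz he with h4 | ⟨z', hz', hz''⟩
    · rcases List.mem_append.1 h4 with h4 | h4
      · exact absurd h3 (mem_finiteList.1 h4).2
      · exact absurd h4 heE
    · exact List.mem_map.2 ⟨z', hz', ((G.mem_outgoing _ _).1 hz'').symm⟩) (by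
    have h1 := hg.flatMap_perm
    rw [List.perm_iff_count] at h1 hMperm ⊢
    intro e
    have h1 := h1 e
    have h2 := hMperm e
    simp only [List.count_append, boxes] at h1 h2 ⊢
    omega)
  obtain ⟨p, hp⟩ := WirePerm.exists_of_perm (obj := d.obj) hMperm.symm
  refine ⟨Tp', x' :: Tq, toWires f, p ≫ h, hTp'.append_right _, hf.run, ?_⟩
  exact (BoxSystem.Run.of_wirePerm hp).append hh

/-- A node forming a strongly connected component on its own. -/
def IsTrivial (z : G.Internal) : Prop := ∀ w, G.Comp w z.1 → w = z.1

/-- A piece of the diagram in which the component of `x` has been cut open decomposes into nodes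
drawn before the component (those from which it can be reached), the component itself, and nodes
drawn after it. -/
lemma exists_glue_decomposition (hX : G.IsCut X)
    (hxc : ∃ c, G.IsSimpleCycle c ∧ x ∈ c) {E : List G.Edge} (hEn : E.Nodup)
    (hE : ∀ e, e ∈ E ↔ e ∈ X ∧ G.Comp e.1.2 x) {H K : List G.Edge} {T : List G.Internal}
    (hTn : T.Nodup) (hH : H.Nodup) (hHc : ∀ e ∈ H, ¬ G.Comp e.1.1 e.1.2)
    (hHT : ∀ e ∈ H, e.1.1 ∉ T.map Subtype.val) (hET : ∀ e ∈ E, e.1.2 ∈ T.map Subtype.val)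
    {f : wires d.obj (H ++ E) ⟶ wires d.obj (K ++ E)}
    (hf : d.boxes.Run (H ++ E) T (K ++ E) f) :
    (∀ e ∈ K, ¬ G.Comp e.1.1 e.1.2) ∧
    ∃ (T₁ T₀ T₂ : List G.Internal) (R : List G.Edge) (f₁ : _) (φ : _) (f₂ : _),
      T.Perm (T₁ ++ T₀ ++ T₂) ∧ T₀.Nodup ∧ (∀ z, z ∈ T₀ ↔ G.Comp z.1 x) ∧
      (∀ z ∈ T₁ ++ T₂, IsTrivial z) ∧
      d.Draws H T₁ (R ++ G.compIn x) f₁ ∧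
      d.Draws (G.compIn x ++ E) T₀ (G.compOut x ++ E) φ ∧
      d.Draws (R ++ G.compOut x) T₂ K f₂ ∧
      f = wiresRight (toWires f₁) E ≫ (wiresCast d.obj (List.append_assoc ..) ≫
        wiresLeft (toWires φ) R ≫ wiresCast d.obj (List.append_assoc ..).symm) ≫
        wiresRight (toWires f₂) E := by
  classical
  have hgood : Good (H ++ E) T :=
    good_append hX hH hEn (fun e he => ((hE e).1 he).1) hTn hHc hHT
  have hI : ∀ w, G.Comp w x → w ∉ G.inputs ∧ w ∉ G.outputs := by
    intro w hw
    by_cases hwx : w = x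
    · obtain ⟨c, hc, hxc⟩ := hxc
      exact hwx ▸ notMem_of_mem_cycle hc hxc
    · obtain ⟨c, hc, hwc⟩ := exists_cycle_of_comp hw hwx
      exact notMem_of_mem_cycle hc hwc
  have hEx : ∀ {c}, G.IsSimpleCycle c → (∃ v ∈ c, G.Comp v x) → ∃ e ∈ E, e.LiesOn c := by
    rintro c hc ⟨v, hv, hvx⟩
    obtain ⟨e, ⟨he, hl⟩, -⟩ := hX.1 c hc
    exact ⟨e, (hE e).2 ⟨he, (comp_of_isSimpleCycle hc (Cycle.Follows.mem_right hl) hv).trans hvx⟩,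
      hl⟩
  have hK : ∀ e ∈ K, ¬ G.Comp e.1.1 e.1.2 := by
    intro e he hcomp
    obtain ⟨c, hc, hl⟩ := exists_isSimpleCycle e hcomp
    have h1 := countP_liesOn_eq hf hc
    have h2 : H.countP (fun e : G.Edge => e.LiesOn c) = 0 :=
      List.countP_eq_zero.2 fun a ha hla => hHc a ha ((of_decide_eq_true hla : a.LiesOn c).comp hc)
    have h3 : 0 < K.countP (fun e : G.Edge => e.LiesOn c) :=
      List.countP_pos_iff.2 ⟨e, he, by simpa using hl⟩
    rw [List.countP_append, List.countP_append] at h1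
    omega
  have hcount := count_add_eq hf hTn
  simp only [List.count_append] at hcount
  -- All nodes of the component are drawn: the target of a cut edge is, and none of the edges
  -- leading from there around the cycle can remain as an idle wire.
  have hcT : ∀ v, G.Comp v x → v ∈ T.map Subtype.val := by
    intro v hv
    obtain ⟨c, hc, hvc⟩ : ∃ c, G.IsSimpleCycle c ∧ v ∈ c := by
      by_cases hvx : v = x
      · exact hvx ▸ hxc
      · exact exists_cycle_of_comp hv hvx
    obtain ⟨e, heE, hl⟩ := hEx hc ⟨v, hvc, hv⟩
    refine Cycle.forall_of_follows (p := fun w => w ∈ T.map Subtype.val) ?_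
      (Cycle.Follows.mem_right hl) (hET e heE) hvc
    intro a b hab ha
    have hadj := hab.rel hc.2.2
    have hlab : Edge.LiesOn (G := G) ⟨(a, b), hadj⟩ c := hab
    have h1 := hcount ⟨(a, b), hadj⟩
    have h2 : H.count ⟨(a, b), hadj⟩ = 0 :=
      List.count_eq_zero.2 fun h => hHc _ h (hlab.comp hc)
    have h3 : K.count ⟨(a, b), hadj⟩ = 0 :=
      List.count_eq_zero.2 fun h => hK _ h (hlab.comp hc)
    by_contra hb
    simp only [ha, hb, if_true, if_false] at h1
    omega
  -- The cycles of other components are not cut open inside this piece, so their nodes cannot be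
  -- drawn.
  have hnoncomp : ∀ z ∈ T, ¬ G.Comp z.1 x → IsTrivial z := by
    intro z hz hzx w hw
    by_contra hne
    obtain ⟨c, hc, hzc⟩ := exists_cycle_of_comp hw.symm (Ne.symm hne)
    refine notMem_of_run hf hc (fun e he hl => ?_) hz hzc
    rcases List.mem_append.1 he with he | he
    · exact hHc e he (hl.comp hc)
    · exact hzx ((comp_of_isSimpleCycle hc hzc (Cycle.Follows.mem_right hl)).trans
        ((hE e).1 he).2)
  -- The nodes from which the component can be reached are drawn before it, the others after it.
  set A₁ := T.filter (fun z => ¬ G.Comp z.1 x ∧ G.Reach z.1 x) with hA₁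
  set A₂ := T.filter (fun z => ¬ G.Comp z.1 x ∧ ¬ G.Reach z.1 x) with hA₂
  have hA₁n : A₁.Nodup := hTn.filter _
  have hA₂n : A₂.Nodup := hTn.filter _
  have mem₁ : ∀ {v}, v ∈ A₁.map Subtype.val ↔ v ∈ T.map Subtype.val ∧ ¬ G.Comp v x ∧
      G.Reach v x := by
    intro v
    simp only [hA₁, List.mem_map, List.mem_filter, decide_eq_true_eq]
    constructor
    · rintro ⟨z, ⟨h1, h2⟩, rfl⟩; exact ⟨⟨z, h1, rfl⟩, h2⟩
    · rintro ⟨⟨z, h1, rfl⟩, h2⟩; exact ⟨z, ⟨h1, h2⟩, rfl⟩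
  have mem₂ : ∀ {v}, v ∈ A₂.map Subtype.val ↔ v ∈ T.map Subtype.val ∧ ¬ G.Comp v x ∧
      ¬ G.Reach v x := by
    intro v
    simp only [hA₂, List.mem_map, List.mem_filter, decide_eq_true_eq]
    constructor
    · rintro ⟨z, ⟨h1, h2⟩, rfl⟩; exact ⟨⟨z, h1, rfl⟩, h2⟩
    · rintro ⟨⟨z, h1, rfl⟩, h2⟩; exact ⟨z, ⟨h1, h2⟩, rfl⟩
  have hsrc : ∀ z ∈ T, ∀ e ∈ G.incoming z.1, ¬ G.Comp e.1.1 e.1.2 →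
      e ∈ H ∨ e.1.1 ∈ T.map Subtype.val := by
    intro z hz e he hcomp
    rcases hf.mem_of_mem_inp hz he with h | ⟨z', hz', h⟩
    · rcases List.mem_append.1 h with h | h
      · exact Or.inl h
      · exact absurd (hX.comp ((hE e).1 h).1) hcomp
    · exact Or.inr (List.mem_map.2 ⟨z', hz', ((G.mem_outgoing _ _).1 h).symm⟩)
  have hnc : ∀ {e : G.Edge}, ¬ G.Comp e.1.2 x → e.1.2 ∈ T.map Subtype.val →
      ¬ G.Comp e.1.1 e.1.2 := by
    intro e he heT hcomp
    obtain ⟨z, hz, hze⟩ := List.mem_map.1 heT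
    have := hnoncomp z hz (hze ▸ he) e.1.1 (hze ▸ hcomp)
    exact not_adj_self (G := G) e.1.1 (by
      have := this.trans hze; have h2 := e.2; rwa [← this] at h2)
  -- `N₁` are the wires after the former, namely those entering the component and the idle wires
  -- `R`.
  obtain ⟨N₁, hN₁⟩ : ∃ N₁, (N₁ ++ A₁.flatMap fun z => G.incoming z.1).Perm
      (H ++ A₁.flatMap fun z => G.outgoing z.1) := by
    have hsub : (A₁.flatMap fun z => G.incoming z.1) ⊆
        (H ++ A₁.flatMap fun z => G.outgoing z.1) := by
      intro e he
      rw [mem_flatMap_incoming, mem₁] at he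
      obtain ⟨z, hz, hze⟩ := List.mem_map.1 he.1
      rw [List.mem_append, mem_flatMap_outgoing, mem₁]
      rcases hsrc z hz e ((G.mem_incoming _ _).2 hze.symm) (hnc he.2.1 he.1) with h | h
      · exact Or.inl h
      · refine Or.inr ⟨h, fun hcomp => ?_, (Edge.reach e).trans he.2.2⟩
        exact he.2.1 ⟨he.2.2, hcomp.2.trans (Edge.reach e)⟩
    obtain ⟨r, hr⟩ := (nodup_flatMap_incoming hA₁n).exists_perm_append hsub
    exact ⟨r, (List.perm_append_comm.trans hr.symm)⟩
  have hN₁count : ∀ e : G.Edge, N₁.count e + (if e.1.2 ∈ A₁.map Subtype.val then 1 else 0) =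
      H.count e + (if e.1.1 ∈ A₁.map Subtype.val then 1 else 0) := by
    intro e
    have h1 := hN₁.count_eq e
    have h2 := List.Nodup.count (a := e) (nodup_flatMap_incoming hA₁n)
    have h3 := List.Nodup.count (a := e) (nodup_flatMap_outgoing hA₁n)
    rw [List.count_append, List.count_append, h2, h3] at h1
    simpa only [mem_flatMap_incoming, mem_flatMap_outgoing] using h1
  obtain ⟨R, hR⟩ : ∃ R, N₁.Perm (R ++ G.compIn x) := by
    have hsub : G.compIn x ⊆ N₁ := by
      intro e he
      obtain ⟨h1, h2⟩ := mem_finiteList.1 he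
      obtain ⟨z, hz, hze⟩ := List.mem_map.1 (hcT _ h1)
      have h3 := hN₁count e
      have h4 : e.1.2 ∉ A₁.map Subtype.val := fun h => (mem₁.1 h).2.1 h1
      refine List.count_pos_iff.1 ?_
      rcases hsrc z hz e ((G.mem_incoming _ _).2 hze.symm) h2 with h | h
      · have := List.count_pos_iff.2 h
        simp only [h4, if_false] at h3
        omega
      · have h5 : e.1.1 ∈ A₁.map Subtype.val :=
          mem₁.2 ⟨h, fun hc => h2 (hc.trans h1.symm), (Edge.reach e).trans h1.1⟩
        simp only [h4, h5, if_true, if_false] at h3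
        omega
    obtain ⟨r, hr⟩ := (nodup_finiteList _).exists_perm_append hsub
    exact ⟨r, hr.trans List.perm_append_comm⟩
  have hRcount : ∀ e, N₁.count e = R.count e + (G.compIn x).count e := fun e => by
    rw [hR.count_eq, List.count_append]
  obtain ⟨T₁, f₁, hT₁, hf₁⟩ := exists_draws (d := d) hX hA₁n (L := H) (N := R ++ G.compIn x) (by
      intro z hz e he
      have hzT := List.mem_filter.1 hz
      simp only [decide_eq_true_eq] at hzT
      have hze := (G.mem_incoming _ _).1 he
      have heT : e.1.2 ∈ T.map Subtype.val := List.mem_map.2 ⟨z, hzT.1, hze.symm⟩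
      have h1 := hnc (by rw [hze]; exact hzT.2.1) heT
      rcases hsrc z hzT.1 e he h1 with h | h
      · exact Or.inl h
      · refine Or.inr ⟨mem₁.2 ⟨h, fun hc => ?_, (Edge.reach e).trans (hze ▸ hzT.2.2)⟩,
          fun heX => h1 (hX.comp heX)⟩
        exact hzT.2.1 ⟨hzT.2.2, hc.2.trans (hze ▸ (Edge.reach e))⟩) (by
      exact (hR.symm.append_right _).trans hN₁)
  obtain ⟨T₀, φ, hT₀n, hT₀, hφ⟩ := exists_draws_comp (d := d) hX hI hE
  have hTperm : T.Perm (A₁ ++ T₀ ++ A₂) := by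
    rw [List.perm_iff_count]
    intro z
    have h1 := List.Nodup.count (a := z) hTn
    have h2 := List.Nodup.count (a := z) hT₀n
    have h3 := List.Nodup.count (a := z) hA₁n
    have h4 := List.Nodup.count (a := z) hA₂n
    rw [List.count_append, List.count_append, h1, h2, h3, h4]
    simp only [hA₁, hA₂, List.mem_filter, hT₀, decide_eq_true_eq]
    by_cases hz : z ∈ T
    · by_cases hz1 : G.Comp z.1 x
      · simp [hz, hz1]
      · by_cases hz2 : G.Reach z.1 x <;> simp [hz, hz1, hz2]
    · have hz1 : ¬ G.Comp z.1 x := by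
        intro h
        obtain ⟨z', hz', e⟩ := List.mem_map.1 (hcT _ h)
        exact hz (Subtype.ext e ▸ hz')
      simp [hz, hz1]
  have hTsplit : ∀ v : G.V, (if v ∈ T.map Subtype.val then 1 else 0 : ℕ) =
      (if v ∈ A₁.map Subtype.val then 1 else 0) + (if G.Comp v x then 1 else 0) +
        (if v ∈ A₂.map Subtype.val then 1 else 0) := by
    intro v
    simp only [mem₁, mem₂]
    have h := hcT v
    split_ifs <;> first | rfl | (exfalso; tauto)
  have hbal : ∀ e : G.Edge, (G.compOut x).count e + (if G.Comp e.1.2 x then 1 else 0) =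
      (G.compIn x).count e + (if G.Comp e.1.1 x then 1 else 0) := by
    intro e
    have h1 := (comp_balance hI hT₀n hT₀).count_eq e
    have h2 := List.Nodup.count (a := e) (nodup_flatMap_incoming hT₀n)
    have h3 := List.Nodup.count (a := e) (nodup_flatMap_outgoing hT₀n)
    rw [List.count_append, List.count_append, h2, h3] at h1
    simpa only [mem_flatMap_incoming, mem_flatMap_outgoing, mem_map_val_iff hI hT₀] using h1
  obtain ⟨T₂, f₂, hT₂, hf₂⟩ := exists_draws (d := d) hX hA₂n (L := R ++ G.compOut x) (N := K) (by
      intro z hz e he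
      have hzT := List.mem_filter.1 hz
      simp only [decide_eq_true_eq] at hzT
      have hze := (G.mem_incoming _ _).1 he
      have heT : e.1.2 ∈ T.map Subtype.val := List.mem_map.2 ⟨z, hzT.1, hze.symm⟩
      have hex : ¬ G.Comp e.1.2 x := by rw [hze]; exact hzT.2.1
      have h1 := hnc hex heT
      have h2 : e.1.2 ∉ A₁.map Subtype.val := fun h => by
        have := (mem₁.1 h).2.2
        rw [hze] at this
        exact hzT.2.2 this
      have h3 : e ∉ G.compIn x := fun h => hex (mem_finiteList.1 h).1
      have h4 := hN₁count e
      have h5 := hRcount e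
      rw [List.count_eq_zero.2 h3] at h5
      simp only [h2, if_false] at h4
      rcases hsrc z hzT.1 e he h1 with h | h
      · have := List.count_pos_iff.2 h
        exact Or.inl (List.mem_append_left _ (List.count_pos_iff.1 (by omega)))
      · by_cases h6 : e.1.1 ∈ A₁.map Subtype.val
        · simp only [h6, if_true] at h4
          exact Or.inl (List.mem_append_left _ (List.count_pos_iff.1 (by omega)))
        · by_cases h7 : G.Comp e.1.1 x
          · exact Or.inl (List.mem_append_right _ (mem_finiteList.2 ⟨h7, h1⟩))
          · refine Or.inr ⟨mem₂.2 ⟨h, h7, fun hr => h6 (mem₁.2 ⟨h, h7, hr⟩)⟩,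
              fun heX => h1 (hX.comp heX)⟩) (by
      rw [List.perm_iff_count]
      intro e
      have h1 := List.Nodup.count (a := e) (nodup_flatMap_incoming hA₂n)
      have h2 := List.Nodup.count (a := e) (nodup_flatMap_outgoing hA₂n)
      simp only [mem_flatMap_incoming, mem_flatMap_outgoing] at h1 h2
      rw [List.count_append, List.count_append, List.count_append, h1, h2]
      have h3 := hcount e
      rw [hTsplit, hTsplit] at h3
      have h4 := hN₁count e
      have h5 := hRcount e
      have h6 := hbal e
      omega)
  have hTperm' : T.Perm (T₁ ++ T₀ ++ T₂) :=
    hTperm.trans (((hT₁.symm.append_right _).append_right _).trans (hT₂.symm.append_left _))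
  refine ⟨hK, T₁, T₀, T₂, R, f₁, φ, f₂, hTperm', hT₀n, hT₀, ?_, hf₁, hφ, hf₂, ?_⟩
  · intro z hz
    rcases List.mem_append.1 hz with hz | hz
    · have := List.mem_filter.1 (hT₁.subset hz)
      simp only [decide_eq_true_eq] at this
      exact hnoncomp z this.1 this.2.1
    · have := List.mem_filter.1 (hT₂.subset hz)
      simp only [decide_eq_true_eq] at this
      exact hnoncomp z this.1 this.2.1
  · refine run_unique hf ?_ hTperm' hgood
    rw [List.append_assoc]
    refine (hf₁.run.wiresRight E).append (BoxSystem.Run.append ?_ (hf₂.run.wiresRight E))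
    have := (hφ.run.wiresLeft R).perm (.wiresCast (List.append_assoc R (G.compOut x) E).symm)
    exact (BoxSystem.Run.of_wirePerm (.wiresCast (List.append_assoc ..))).append this

end CausalDiagram

/-! ### The laws of a time-travel super-operator for lists of wires -/

section Glue

open Functor.LaxMonoidal Functor.OplaxMonoidal

variable {C : Type u₁} [Category.{v₁} C] [MonoidalCategory C]
variable {D : Type u₂} [Category.{v₂} D] [MonoidalCategory D] {F : C ⥤ D}
variable {ι : Type} {obj : ι → C}

/-- The super-operator applied to a morphism from the wires `H ++ E` to the wires `K ++ E`, gluing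
together the wires `E`. -/
def wiresGlue (Ξ : SuperOperator F) (H K E : List ι)
    (f : wires obj (H ++ E) ⟶ wires obj (K ++ E)) : F.obj (wires obj H) ⟶ F.obj (wires obj K) :=
  Ξ _ _ (wires obj E) ((wiresSplit obj H E).inv ≫ f ≫ (wiresSplit obj K E).hom)

variable [F.Monoidal] {Ξ : SuperOperator F} (hΞ : Ξ.IsTimeTravel)
include hΞ

namespace SuperOperator.IsTimeTravel

/-- A time-travel super-operator is invariant under isomorphisms of all three objects. -/
lemma conj {H H' K K' X X' : C} (a : H ≅ H') (b : K ≅ K') (e : X ≅ X') (Ψ : H ⊗ X ⟶ K ⊗ X) :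
    Ξ H' K' X' ((a.inv ⊗ₘ e.inv) ≫ Ψ ≫ (b.hom ⊗ₘ e.hom)) =
      F.map a.inv ≫ Ξ H K X Ψ ≫ F.map b.hom := by
  have h1 := hΞ.naturality a.inv (H ◁ e.inv ≫ Ψ ≫ K ◁ e.hom) b.hom
  have h2 := hΞ.sliding (Ψ ≫ K ◁ e.hom) e.inv
  rw [← h2] at h1
  simp only [Category.assoc, ← whiskerLeft_comp, Iso.hom_inv_id, whiskerLeft_id, Category.comp_id]
    at h1
  rw [← h1, MonoidalCategory.tensorHom_def a.inv, MonoidalCategory.tensorHom_def' b.hom]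
  simp only [Category.assoc]

/-- The morphism obtained by one application of the super-operator, expressed on tensor products
with a trailing unit. -/
lemma toMapWires'_eq (H K E : List ι) (f : wireTensor obj (H ++ E) ⟶ wireTensor obj (K ++ E)) :
    toMapWires' (Ξ _ _ _ ((wireSplit obj H E).inv ≫ f ≫ (wireSplit obj K E).hom)) =
      toMapWires (wiresGlue Ξ H K E (toWires f)) := by
  rw [toMapWires']
  congr 1
  rw [wiresGlue, ← hΞ.conj (wireTensorIso obj H) (wireTensorIso obj K) (wireTensorIso obj E)]
  congr 1
  have h1 := wireSplit_wireTensorIso obj K E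
  have h2 : ((wireTensorIso obj H).inv ⊗ₘ (wireTensorIso obj E).inv) ≫ (wireSplit obj H E).inv =
      (wiresSplit obj H E).inv ≫ (wireTensorIso obj (H ++ E)).inv := by
    have := wireSplit_wireTensorIso obj H E
    rw [Iso.eq_inv_comp, ← cancel_epi (wireTensorIso obj (H ++ E)).hom, ← reassoc_of% this]
    simp [tensorHom_comp_tensorHom_assoc]
  simp only [Category.assoc, toWires]
  rw [reassoc_of% h2, h1]

/-- Naturality, for lists of wires. -/
lemma wiresGlue_comp {H H' K K' : List ι} (E : List ι) (f₁ : wires obj H' ⟶ wires obj H)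
    (f : wires obj (H ++ E) ⟶ wires obj (K ++ E)) (f₂ : wires obj K ⟶ wires obj K') :
    wiresGlue Ξ H' K' E (wiresRight f₁ E ≫ f ≫ wiresRight f₂ E) =
      F.map f₁ ≫ wiresGlue Ξ H K E f ≫ F.map f₂ := by
  rw [wiresGlue, wiresGlue, ← hΞ.naturality]
  simp [wiresRight]

/-- Strength, for lists of wires and an identity on the idle wires. -/
lemma wiresGlue_wiresLeft (R : List ι) {H K E : List ι}
    (f : wires obj (H ++ E) ⟶ wires obj (K ++ E)) :
    toMapWires (wiresGlue Ξ (R ++ H) (R ++ K) E (wiresCast obj (List.append_assoc ..) ≫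
      wiresLeft f R ≫ wiresCast obj (List.append_assoc ..).symm)) =
      wiresLeft (toMapWires (wiresGlue Ξ H K E f)) R := by
  rw [← toMapWires_left]
  congr 1
  have h1 := wiresSplit_assoc (obj := obj) R H E
  have h2 := wiresSplit_assoc (obj := obj) R K E
  have h1' : (wiresSplit obj (R ++ H) E).inv ≫ wiresCast obj (List.append_assoc ..) ≫
      (wiresSplit obj R (H ++ E)).hom = (wiresSplit obj R H).hom ▷ wires obj E ≫ (α_ _ _ _).hom ≫
        wires obj R ◁ (wiresSplit obj H E).inv := by
    rw [Iso.inv_comp_eq]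
    have := congrArg (· ≫ wires obj R ◁ (wiresSplit obj H E).inv) h1
    simpa using this.symm
  have h2' : (wiresSplit obj R (K ++ E)).inv ≫ wiresCast obj (List.append_assoc ..).symm ≫
      (wiresSplit obj (R ++ K) E).hom = wires obj R ◁ (wiresSplit obj K E).hom ≫ (α_ _ _ _).inv ≫
        (wiresSplit obj R K).inv ▷ wires obj E := by
    rw [Iso.inv_comp_eq]
    have := congrArg (fun t => wiresCast obj (List.append_assoc ..).symm ≫ t ≫ (α_ _ _ _).inv ≫
      (wiresSplit obj R K).inv ▷ wires obj E) h2
    simpa [← comp_whiskerRight] using this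
  have h3 := hΞ.naturality (wiresSplit obj R H).hom
    ((α_ _ _ _).hom ≫ (𝟙 (wires obj R) ⊗ₘ
      ((wiresSplit obj H E).inv ≫ f ≫ (wiresSplit obj K E).hom)) ≫ (α_ _ _ _).inv)
    (wiresSplit obj R K).inv
  rw [hΞ.strength] at h3
  have h4 : F.map (wiresSplit obj R H).hom ≫ (δ F _ _ ≫ (F.map (𝟙 (wires obj R)) ⊗ₘ
      wiresGlue Ξ H K E f) ≫ μ F _ _) ≫ F.map (wiresSplit obj R K).inv =
      (mapWiresSplit F obj R H).hom ≫ F.obj (wires obj R) ◁ wiresGlue Ξ H K E f ≫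
        (mapWiresSplit F obj R K).inv := by
    simp [mapWiresSplit]
  rw [← h4]
  refine Eq.trans ?_ h3
  rw [wiresGlue, wiresLeft_eq]
  congr 1
  simp only [Category.assoc]
  rw [reassoc_of% h1', h2']
  simp

/-- Sliding, for lists of wires. -/
lemma wiresGlue_slide {H K E E' : List ι} (g : wires obj E ⟶ wires obj E')
    (f : wires obj (H ++ E') ⟶ wires obj (K ++ E)) :
    wiresGlue Ξ H K E (wiresLeft g H ≫ f) = wiresGlue Ξ H K E' (f ≫ wiresLeft g K) := by
  have h := hΞ.sliding ((wiresSplit obj H E').inv ≫ f ≫ (wiresSplit obj K E).hom) g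
  simpa [wiresGlue, wiresLeft_eq] using h.symm

/-- Vanishing, for lists of wires. -/
lemma wiresGlue_nil {H K : List ι} (f : wires obj (H ++ []) ⟶ wires obj (K ++ [])) :
    wiresGlue Ξ H K [] f = F.map (wiresCast obj (List.append_nil H).symm ≫ f ≫
      wiresCast obj (List.append_nil K)) := by
  have key : ∀ {U V H K : C} (s : U ≅ H ⊗ 𝟙_ C) (t : V ≅ K ⊗ 𝟙_ C) (c : U ⟶ H) (c' : H ⟶ U)
      (b : V ⟶ K) (f : U ⟶ V), c' ≫ c = 𝟙 _ → s.hom = c ≫ (ρ_ H).inv → t.hom = b ≫ (ρ_ K).inv →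
      (ρ_ H).inv ≫ (s.inv ≫ f ≫ t.hom) ≫ (ρ_ K).hom = c' ≫ f ≫ b := by
    intro U V H K s t c c' b f hc hs ht
    have h : (ρ_ H).inv ≫ s.inv = c' := by
      rw [← cancel_mono s.hom, Category.assoc, Iso.inv_hom_id, hs, reassoc_of% hc,
        Category.comp_id]
    simp only [Category.assoc, ht, reassoc_of% h, Iso.inv_hom_id, Category.comp_id]
  exact (hΞ.vanishing _).trans (congrArg F.map
    (key _ _ _ _ _ f (by simp) (wiresSplit_nil H) (wiresSplit_nil K)))

end SuperOperator.IsTimeTravel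

end Glue

/-! ### Components as boxes -/

namespace FramedCausalGraph

variable {G : FramedCausalGraph}

lemma notMem_of_comp {x : G.V} (hx : x ∉ G.inputs ∧ x ∉ G.outputs) {w : G.V} (h : G.Comp w x) :
    w ∉ G.inputs ∧ w ∉ G.outputs := by
  by_cases hwx : w = x
  · exact hwx ▸ hx
  · obtain ⟨c, hc, hw⟩ := exists_cycle_of_comp h hwx
    exact notMem_of_mem_cycle hc hw

variable (G) in
/-- The edges of the component of `x` cut by `repCut`. -/
noncomputable def compCut (x : G.V) : List G.Edge :=
  finiteList fun e => e ∈ G.repCut ∧ G.Comp e.1.2 x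

lemma mem_compIn {x : G.V} {e : G.Edge} :
    e ∈ G.compIn x ↔ G.Comp e.1.2 x ∧ ¬ G.Comp e.1.1 e.1.2 := mem_finiteList

lemma mem_compOut {x : G.V} {e : G.Edge} :
    e ∈ G.compOut x ↔ G.Comp e.1.1 x ∧ ¬ G.Comp e.1.1 e.1.2 := mem_finiteList

end FramedCausalGraph

namespace CausalDiagram

open FramedCausalGraph

section Boxes

variable {C : Type u₁} [Category.{v₁} C] [MonoidalCategory C] [SymmetricCategory C]
variable {D : Type u₂} [Category.{v₂} D] [MonoidalCategory D]
variable {F : C ⥤ D} [F.Monoidal] (Ξ : SuperOperator F)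
variable {G : FramedCausalGraph} (hG : G.IsCVLocal) (d : CausalDiagram G C)

include hG in
/-- The component of `z` can be drawn once it has been cut open by `repCut`. -/
lemma exists_run_compCut (z : G.Internal) :
    ∃ (φ : wires d.obj (G.compIn z.1 ++ G.compCut z.1) ⟶
        wires d.obj (G.compOut z.1 ++ G.compCut z.1)) (T : List G.Internal), T.Nodup ∧
      (∀ w, w ∈ T ↔ G.Comp w.1 z.1) ∧
      d.boxes.Run (G.compIn z.1 ++ G.compCut z.1) T (G.compOut z.1 ++ G.compCut z.1) φ := by
  obtain ⟨T, φ, hn, hT, hφ⟩ := exists_draws_comp (d := d) (isCut_repCut hG)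
    (fun w hw => notMem_of_comp z.2 hw) (E := G.compCut z.1) (fun e => mem_finiteList)
  exact ⟨_, T, hn, hT, hφ.run⟩

/-- The components of the diagram, cut open by `repCut` and reglued by the super-operator, as boxes
in `D`. A component is labelled by any of its nodes, so each component occurs as often as it has
nodes; only the labels which represent their component are used for drawings. -/
noncomputable def compBoxes : BoxSystem (fun e => F.obj (d.obj e)) G.Internal where
  inp z := G.compIn z.1
  out z := G.compOut z.1
  mor z := toMapWires (wiresGlue Ξ _ _ _ (exists_run_compCut hG d z).choose)

variable {Ξ d} (hΞ : Ξ.IsTimeTravel)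
include hΞ

/-- Cutting a component open differently yields the same box, by sliding. -/
lemma toMapWires_wiresGlue_eq {X : Set G.Edge} (hX : G.IsCut X) {z : G.Internal}
    (hz : G.rep z.1 = z.1) {E : List G.Edge} (hEn : E.Nodup)
    (hE : ∀ e, e ∈ E ↔ e ∈ X ∧ G.Comp e.1.2 z.1) {T : List G.Internal} (hTn : T.Nodup)
    (hT : ∀ w, w ∈ T ↔ G.Comp w.1 z.1)
    {φ : wires d.obj (G.compIn z.1 ++ E) ⟶ wires d.obj (G.compOut z.1 ++ E)}
    (hφ : d.boxes.Run (G.compIn z.1 ++ E) T (G.compOut z.1 ++ E) φ) :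
    toMapWires (wiresGlue Ξ _ _ _ φ) = (compBoxes Ξ hG d).mor z := by
  refine congrArg toMapWires ?_
  obtain ⟨T', hTn', hT', hφ'⟩ := (exists_run_compCut hG d z).choose_spec
  generalize (exists_run_compCut hG d z).choose = φ' at hφ'
  have hE' : ∀ e, e ∈ G.compCut z.1 ↔ e ∈ G.repCut ∧ G.Comp e.1.2 z.1 := fun e => mem_finiteList
  have hEn' : (G.compCut z.1).Nodup := nodup_finiteList _
  obtain ⟨Tp, Tq, f, ψ, hpq, hf, hψ⟩ := exists_slide hG hX hz
    (fun w hw => notMem_of_comp z.2 hw) hEn hE hEn' hE' hTn hT hφ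
  have h1 : φ = wiresLeft f _ ≫ ψ := run_unique hφ ((hf.wiresLeft _).append hψ) hpq.symm
    (good_comp hX hEn hE hTn fun w hw => (hT w).1 hw)
  have hTT' : T'.Perm T := (List.perm_ext_iff_of_nodup hTn' hTn).2 fun w => by rw [hT, hT']
  have h2 : φ' = ψ ≫ wiresLeft f _ := run_unique hφ' (hψ.append (hf.wiresLeft _))
    (hTT'.trans (hpq.symm.trans List.perm_append_comm))
    (good_comp (isCut_repCut hG) hEn' hE' hTn' fun w hw => (hT' w).1 hw)
  rw [h1, h2, hΞ.wiresGlue_slide]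

end Boxes

section Reglue

variable {C : Type u₁} [Category.{v₁} C] [MonoidalCategory C] [SymmetricCategory C]
variable {D : Type u₂} [Category.{v₂} D] [MonoidalCategory D] [SymmetricCategory D]
variable {F : C ⥤ D} [F.Braided] {Ξ : SuperOperator F}
variable {G : FramedCausalGraph} (hG : G.IsCVLocal) {d : CausalDiagram G C}

lemma compIn_perm {z : G.Internal} (hz : IsTrivial z) : (G.compIn z.1).Perm (G.incoming z.1) := by
  refine (List.perm_ext_iff_of_nodup (nodup_finiteList _) (G.incoming_nodup _)).2 fun e => ?_
  rw [mem_finiteList, G.mem_incoming]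
  refine ⟨fun h => hz _ h.1, fun h => ⟨h ▸ .refl _, fun h' => ?_⟩⟩
  exact not_adj_self (G := G) e.1.1 (by
    have h1 := hz _ (h ▸ h')
    have h2 := e.2
    rwa [h, ← h1] at h2)

lemma compOut_perm {z : G.Internal} (hz : IsTrivial z) : (G.compOut z.1).Perm (G.outgoing z.1) := by
  refine (List.perm_ext_iff_of_nodup (nodup_finiteList _) (G.outgoing_nodup _)).2 fun e => ?_
  rw [mem_finiteList, G.mem_outgoing]
  refine ⟨fun h => hz _ h.1, fun h => ⟨h ▸ .refl _, fun h' => ?_⟩⟩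
  exact not_adj_self (G := G) e.1.1 (by
    have h1 := hz _ (h ▸ h'.symm)
    have h2 := e.2
    rwa [h1, ← h] at h2)

variable (hΞ : Ξ.IsTimeTravel)
include hΞ

/-- On a component with a single node, the super-operator glues nothing, so the box of the component
is the image of the process at this node. -/
lemma run_compBoxes_of_isTrivial {z : G.Internal} (hz : IsTrivial z) :
    (compBoxes Ξ hG d).Run (G.incoming z.1) [z] (G.outgoing z.1)
      (toMapWires (F.map (toWires (d.mor z)))) := by
  obtain ⟨p, hp⟩ := WirePerm.exists_of_perm (obj := d.obj) (compIn_perm hz)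
  obtain ⟨q, hq⟩ := WirePerm.exists_of_perm (obj := d.obj) (compOut_perm hz).symm
  have hnil : ∀ e : G.Edge, e ∈ ([] : List G.Edge) ↔ e ∈ G.repCut ∧ G.Comp e.1.2 z.1 := by
    intro e
    refine ⟨fun h => absurd h List.not_mem_nil, fun h => ?_⟩
    have h1 := hz _ h.2
    have h2 := hz _ (h.1.1.trans h.2)
    exact absurd e.2 (by rw [h1, h2]; exact not_adj_self _)
  have hrun : d.boxes.Run (G.compIn z.1 ++ []) [z] (G.compOut z.1 ++ [])
      (wiresCast d.obj (List.append_nil _) ≫ (p ≫ toWires (d.mor z) ≫ q) ≫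
        wiresCast d.obj (List.append_nil _).symm) := by
    have h1 := BoxSystem.Run.mor (B := d.boxes) z
    have h2 := (BoxSystem.Run.of_wirePerm (B := d.boxes) hp).append (h1.perm hq)
    have h3 := h2.perm (.wiresCast (List.append_nil _).symm)
    exact (BoxSystem.Run.of_wirePerm (B := d.boxes)
      (.wiresCast (List.append_nil (G.compIn z.1)))).append h3
  have h1 := toMapWires_wiresGlue_eq hG hΞ (isCut_repCut hG) (hz _ (comp_rep z.1).symm)
    List.nodup_nil hnil (List.nodup_singleton z) (fun w => by
      rw [List.mem_singleton]
      exact ⟨fun h => h ▸ .refl _, fun h => Subtype.ext (hz _ h)⟩) hrun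
  rw [hΞ.wiresGlue_nil] at h1
  simp only [Category.assoc, wiresCast_trans_assoc, wiresCast_trans, wiresCast_rfl,
    Category.id_comp, Category.comp_id, Functor.map_comp, toMapWires_comp] at h1
  obtain ⟨p', hp', -, hpp'⟩ := hp.exists_inv
  obtain ⟨q', hq', hqq', -⟩ := hq.exists_inv
  have h2 := (BoxSystem.Run.of_wirePerm (B := compBoxes Ξ hG d) hp'.map).append
    ((BoxSystem.Run.mor (B := compBoxes Ξ hG d) z).perm hq'.map)
  rw [← h1] at h2
  have e1 : toMapWires (F.map p') ≫ toMapWires (F.map p) = 𝟙 _ := by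
    rw [← toMapWires_comp, ← Functor.map_comp, hpp', CategoryTheory.Functor.map_id, toMapWires_id]
  have e2 : toMapWires (F.map q) ≫ toMapWires (F.map q') = 𝟙 _ := by
    rw [← toMapWires_comp, ← Functor.map_comp, hqq', CategoryTheory.Functor.map_id, toMapWires_id]
  have e3 : toMapWires (F.map p') ≫ (toMapWires (F.map p) ≫ toMapWires (F.map (toWires (d.mor z))) ≫
      toMapWires (F.map q)) ≫ toMapWires (F.map q') = toMapWires (F.map (toWires (d.mor z))) := by
    simp only [Category.assoc, e2, reassoc_of% e1, Category.comp_id]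
  exact e3 ▸ h2

/-- A piece without nodes on cycles is drawn, after its embedding, from boxes of components. -/
lemma run_compBoxes_of_run {M N : List G.Edge} {T : List G.Internal}
    {f : wires d.obj M ⟶ wires d.obj N} (hf : d.boxes.Run M T N f) (hT : ∀ z ∈ T, IsTrivial z) :
    (compBoxes Ξ hG d).Run M T N (toMapWires (F.map f)) := by
  induction hf with
  | start => rw [CategoryTheory.Functor.map_id, toMapWires_id]; exact .start
  | perm _ hp ih =>
    rw [Functor.map_comp, toMapWires_comp]
    exact (ih hT).perm hp.map
  | box b _ ih =>
    rw [Functor.map_comp, toMapWires_comp, toMapWires_map_wiresRight]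
    refine (ih fun z hz => hT z (List.mem_append_left _ hz)).append ?_
    exact (run_compBoxes_of_isTrivial hG hΞ (hT b (by simp))).wiresRight _

end Reglue

end CausalDiagram

/-! ### Uniqueness and existence of the morphism defined by a diagram -/

namespace FramedCausalGraph

variable {G : FramedCausalGraph}

lemma mem_inputEdges {e : G.Edge} : e ∈ G.inputEdges ↔ e.1.1 ∈ G.inputs := by
  simp [inputEdges, G.mem_outgoing]

lemma mem_outputEdges {e : G.Edge} : e ∈ G.outputEdges ↔ e.1.2 ∈ G.outputs := by
  simp [outputEdges, G.mem_incoming]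

lemma nodup_inputEdges : G.inputEdges.Nodup := by
  refine List.nodup_flatMap.2 ⟨fun x _ => G.outgoing_nodup _, G.inputs_nodup.imp ?_⟩
  intro a b hab e he he'
  exact hab (((G.mem_outgoing _ _).1 he).symm.trans ((G.mem_outgoing _ _).1 he'))

lemma nodup_outputEdges : G.outputEdges.Nodup := by
  refine List.nodup_flatMap.2 ⟨fun x _ => G.incoming_nodup _, G.outputs_nodup.imp ?_⟩
  intro a b hab e he he'
  exact hab (((G.mem_incoming _ _).1 he).symm.trans ((G.mem_incoming _ _).1 he'))

lemma notMem_map_val {S : List G.Internal} {v : G.V} (h : v ∈ G.inputs ∨ v ∈ G.outputs) :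
    v ∉ S.map Subtype.val := by
  rintro hv
  obtain ⟨z, -, rfl⟩ := List.mem_map.1 hv
  exact h.elim z.2.1 z.2.2

lemma nodup_inputEdges_append {S : List G.Internal} (hS : S.Nodup) :
    (G.inputEdges ++ S.flatMap fun z => G.outgoing z.1).Nodup := by
  refine List.nodup_append.2 ⟨nodup_inputEdges, nodup_flatMap_outgoing hS, ?_⟩
  rintro e he e' he' rfl
  exact notMem_map_val (Or.inl (mem_inputEdges.1 he)) (mem_flatMap_outgoing.1 he')

lemma nodup_outputEdges_append {S : List G.Internal} (hS : S.Nodup) :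
    (G.outputEdges ++ S.flatMap fun z => G.incoming z.1).Nodup := by
  refine List.nodup_append.2 ⟨nodup_outputEdges, nodup_flatMap_incoming hS, ?_⟩
  rintro e he e' he' rfl
  exact notMem_map_val (Or.inr (mem_outputEdges.1 he)) (mem_flatMap_incoming.1 he')

lemma source_notMem_outputs (e : G.Edge) : e.1.1 ∉ G.outputs := by
  intro h
  have := (G.mem_outgoing e.1.1 e).2 rfl
  rw [G.outgoing_output _ h] at this
  exact absurd this List.not_mem_nil

lemma target_notMem_inputs (e : G.Edge) : e.1.2 ∉ G.inputs := by
  intro h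
  have := (G.mem_incoming e.1.2 e).2 rfl
  rw [G.incoming_input _ h] at this
  exact absurd this List.not_mem_nil

/-- Both sides enumerate all the edges, according to their targets and to their sources. -/
lemma outputEdges_append_perm {S : List G.Internal} (hS : S.Nodup) (hS' : ∀ z, z ∈ S) :
    (G.outputEdges ++ S.flatMap fun z => G.incoming z.1).Perm
      (G.inputEdges ++ S.flatMap fun z => G.outgoing z.1) := by
  have hall : ∀ v, v ∉ G.inputs → v ∉ G.outputs → v ∈ S.map Subtype.val :=
    fun v h1 h2 => List.mem_map.2 ⟨⟨v, h1, h2⟩, hS' _, rfl⟩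
  refine (List.perm_ext_iff_of_nodup (nodup_outputEdges_append hS)
    (nodup_inputEdges_append hS)).2 fun e => iff_of_true ?_ ?_
  · rw [List.mem_append, mem_outputEdges, mem_flatMap_incoming]
    by_cases h : e.1.2 ∈ G.outputs
    · exact Or.inl h
    · exact Or.inr (hall _ (target_notMem_inputs e) h)
  · rw [List.mem_append, mem_inputEdges, mem_flatMap_outgoing]
    by_cases h : e.1.1 ∈ G.inputs
    · exact Or.inl h
    · exact Or.inr (hall _ h (source_notMem_outputs e))

lemma not_comp_of_mem_inputEdges {e : G.Edge} (he : e ∈ G.inputEdges) :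
    ¬ G.Comp e.1.1 e.1.2 := by
  intro h
  obtain ⟨c, hc, hl⟩ := exists_isSimpleCycle e h
  exact (notMem_of_mem_cycle hc (Cycle.Follows.mem_left hl)).1 (mem_inputEdges.1 he)

end FramedCausalGraph

namespace CausalDiagram

open FramedCausalGraph

variable {C : Type u₁} [Category.{v₁} C] [MonoidalCategory C] [SymmetricCategory C]
variable {G : FramedCausalGraph} {d : CausalDiagram G C}

/-- If no wire of a cycle is present, only nodes outside of the cycles can be drawn, and no wire of
a cycle appears. -/
lemma isTrivial_of_run {M N : List G.Edge} {T : List G.Internal}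
    {f : wires d.obj M ⟶ wires d.obj N} (hf : d.boxes.Run M T N f)
    (hM : ∀ e ∈ M, ¬ G.Comp e.1.1 e.1.2) :
    (∀ z ∈ T, IsTrivial z) ∧ ∀ e ∈ N, ¬ G.Comp e.1.1 e.1.2 := by
  classical
  constructor
  · intro z hz w hw
    by_contra hne
    obtain ⟨c, hc, hzc⟩ := exists_cycle_of_comp hw.symm (Ne.symm hne)
    exact notMem_of_run hf hc (fun e he hl => hM e he (hl.comp hc)) hz hzc
  · intro e he hcomp
    obtain ⟨c, hc, hl⟩ := exists_isSimpleCycle e hcomp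
    have h1 := countP_liesOn_eq hf hc
    have h2 : M.countP (fun e : G.Edge => e.LiesOn c) = 0 :=
      List.countP_eq_zero.2 fun a ha hla => hM a ha ((of_decide_eq_true hla : a.LiesOn c).comp hc)
    rw [h2] at h1
    exact List.countP_eq_zero.1 h1 e he (by simpa using hl)

section Balance

variable {D : Type u₂} [Category.{v₂} D] [MonoidalCategory D]
variable {F : C ⥤ D} [F.Monoidal] {Ξ : SuperOperator F}

/-- Balance of the wires for a reglued diagram: the cut edges occur on both sides of each piece and
cancel. -/
lemma Reglues.flatMap_perm {X : Set G.Edge} {S : List G.Internal} {M : List G.Edge}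
    {m : F.obj (wireTensor d.obj G.inputEdges) ⟶ F.obj (wireTensor d.obj M)}
    (h : d.Reglues Ξ X S M m) :
    (M ++ S.flatMap fun z => G.incoming z.1).Perm
      (G.inputEdges ++ S.flatMap fun z => G.outgoing z.1) := by
  classical
  induction h with
  | start => exact .refl _
  | embed _ hf ih =>
    have h1 := hf.flatMap_perm
    rw [List.perm_iff_count] at h1 ih ⊢
    intro e
    have h1 := h1 e
    have ih := ih e
    simp only [List.flatMap_append, List.count_append] at h1 ih ⊢
    omega
  | glue _ _ hf _ ih =>
    have h1 := hf.flatMap_perm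
    rw [List.perm_iff_count] at h1 ih ⊢
    intro e
    have h1 := h1 e
    have ih := ih e
    simp only [List.flatMap_append, List.count_append] at h1 ih ⊢
    omega

lemma Reglues.nodup {X : Set G.Edge} {S : List G.Internal} {M : List G.Edge}
    {m : F.obj (wireTensor d.obj G.inputEdges) ⟶ F.obj (wireTensor d.obj M)}
    (h : d.Reglues Ξ X S M m) (hS : S.Nodup) : M.Nodup :=
  (h.flatMap_perm.nodup_iff.2 (nodup_inputEdges_append hS)).of_append_left

lemma Reglues.source {X : Set G.Edge} {S : List G.Internal} {M : List G.Edge}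
    {m : F.obj (wireTensor d.obj G.inputEdges) ⟶ F.obj (wireTensor d.obj M)}
    (h : d.Reglues Ξ X S M m) {e : G.Edge} (he : e ∈ M) :
    e.1.1 ∈ G.inputs ∨ e.1.1 ∈ S.map Subtype.val := by
  have := h.flatMap_perm.subset (List.mem_append_left _ he)
  rwa [List.mem_append, mem_inputEdges, mem_flatMap_outgoing] at this

end Balance

section Uniqueness

variable {D : Type u₂} [Category.{v₂} D] [MonoidalCategory D] [SymmetricCategory D]
variable {F : C ⥤ D} [F.Braided] {Ξ : SuperOperator F} (hG : G.IsCVLocal) (hΞ : Ξ.IsTimeTravel)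
include hG hΞ

open Classical in
/-- However the diagram is cut and reglued, the result is drawn from the boxes of components, each
labelled by its representative. In between the pieces, no wire from a cycle is present. -/
lemma Reglues.exists_run {X : Set G.Edge} (hX : G.IsCut X) {S : List G.Internal} {M : List G.Edge}
    {m : F.obj (wireTensor d.obj G.inputEdges) ⟶ F.obj (wireTensor d.obj M)}
    (h : d.Reglues Ξ X S M m) (hS : S.Nodup) :
    (∀ e ∈ M, ¬ G.Comp e.1.1 e.1.2) ∧
      ∃ S' : List G.Internal, S'.Perm (S.filter fun z => G.rep z.1 = z.1) ∧
        (compBoxes Ξ hG d).Run G.inputEdges S' M (toMapWires' m) := by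
  have hfilter : ∀ {T : List G.Internal}, (∀ z ∈ T, IsTrivial z) →
      T.filter (fun z => G.rep z.1 = z.1) = T := fun hT =>
    List.filter_eq_self.2 fun z hz => decide_eq_true (hT z hz _ (comp_rep z.1).symm)
  induction h with
  | start =>
    refine ⟨fun e => not_comp_of_mem_inputEdges, [], by simp, ?_⟩
    rw [toMapWires'_id]
    exact .start
  | @embed S T M N m f h hf ih =>
    obtain ⟨hM, S', hS', hrun⟩ := ih hS.of_append_left
    obtain ⟨hT, hN⟩ := isTrivial_of_run hf.run hM
    refine ⟨hN, S' ++ T, ?_, ?_⟩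
    · rw [List.filter_append, hfilter hT]
      exact hS'.append_right T
    · rw [toMapWires'_comp, toMapWires'_map]
      exact hrun.append (run_compBoxes_of_run hG hΞ hf.run hT)
  | @glue S T l r H K E m f h hE hf hT ih =>
    obtain ⟨hM, S', hS', hrun⟩ := ih hS.of_append_left
    have hMn := h.nodup hS.of_append_left
    obtain ⟨x, hx, hxc, hEn, hE'⟩ := hE.exists_rep hG hX
    have hH : H.Nodup := hMn.of_append_left.of_append_right
    have hHM : ∀ e ∈ H, e ∈ l ++ H ++ r := fun e he => by simp [he]
    have hHT : ∀ e ∈ H, e.1.1 ∉ T.map Subtype.val := by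
      intro e he heT
      rcases h.source (hHM e he) with h1 | h1
      · exact notMem_map_val (Or.inl h1) heT
      · obtain ⟨z, hz, hze⟩ := List.mem_map.1 h1
        obtain ⟨z', hz', hze'⟩ := List.mem_map.1 heT
        exact (List.nodup_append.1 hS).2.2 z hz z' hz' (Subtype.ext (hze.trans hze'.symm))
    obtain ⟨hK, T₁, T₀, T₂, R, f₁, φ, f₂, hTp, hT₀n, hT₀, htriv, hf₁, hφ, hf₂, heq⟩ :=
      exists_glue_decomposition hX hxc hEn hE' hS.of_append_right hH
        (fun e he => hM e (hHM e he)) hHT hT hf.run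
    obtain ⟨c, hc, hxc⟩ := hxc
    set x' : G.Internal := ⟨x, notMem_of_mem_cycle hc hxc⟩ with hx'
    refine ⟨?_, S' ++ (T₁ ++ [x'] ++ T₂), ?_, ?_⟩
    · intro e he
      rcases List.mem_append.1 he with he | he
      · rcases List.mem_append.1 he with he | he
        · exact hM e (by simp [he])
        · exact hK e he
      · exact hM e (by simp [he])
    · rw [List.filter_append]
      refine hS'.append (.symm ((hTp.filter _).trans ?_))
      rw [List.filter_append, List.filter_append,
        hfilter fun z hz => htriv z (List.mem_append_left _ hz),
        hfilter fun z hz => htriv z (List.mem_append_right _ hz)]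
      refine (List.Perm.append_left _ ?_).append_right _
      refine (List.perm_ext_iff_of_nodup (hT₀n.filter _) (List.nodup_singleton _)).2 fun z => ?_
      rw [List.mem_filter, hT₀, List.mem_singleton, decide_eq_true_eq]
      constructor
      · rintro ⟨h1, h2⟩
        exact Subtype.ext (h2.symm.trans ((rep_eq_of_comp h1).trans hx))
      · rintro rfl
        exact ⟨.refl _, hx⟩
    · rw [toMapWires'_comp, toMapWires'_wireWhiskerMap, hΞ.toMapWires'_eq, heq, hΞ.wiresGlue_comp,
        toMapWires_comp, toMapWires_comp, hΞ.wiresGlue_wiresLeft,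
        toMapWires_wiresGlue_eq (z := x') hG hΞ hX hx hEn hE' hT₀n hT₀ hφ.run]
      refine hrun.append (BoxSystem.Run.wiresRight (BoxSystem.Run.wiresLeft ?_ l) r)
      rw [List.append_assoc]
      refine (run_compBoxes_of_run hG hΞ hf₁.run
        fun z hz => htriv z (List.mem_append_left _ hz)).append (BoxSystem.Run.append ?_
        (run_compBoxes_of_run hG hΞ hf₂.run fun z hz => htriv z (List.mem_append_right _ hz)))
      exact (BoxSystem.Run.mor (B := compBoxes Ξ hG d) x').wiresLeft R

/-- Two morphisms defined by the diagram are drawn from the same boxes, one for each component, and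
the edges between components are wires of at most one box on either end. -/
lemma IsMorphism.unique {X X' : Set G.Edge} (hX : G.IsCut X) (hX' : G.IsCut X')
    {m m' : F.obj (wireTensor d.obj G.inputEdges) ⟶ F.obj (wireTensor d.obj G.outputEdges)}
    (h : d.IsMorphism Ξ X m) (h' : d.IsMorphism Ξ X' m') : m = m' := by
  classical
  obtain ⟨S, hS, hSa, h⟩ := h
  obtain ⟨S', hS', hSa', h'⟩ := h'
  obtain ⟨-, T, hT, hrun⟩ := h.exists_run hG hΞ hX hS
  obtain ⟨-, T', hT', hrun'⟩ := h'.exists_run hG hΞ hX' hS'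
  have hSS : S.Perm S' :=
    (List.perm_ext_iff_of_nodup hS hS').2 fun z => iff_of_true (hSa z) (hSa' z)
  have hTT : T.Perm T' := hT.trans ((hSS.filter _).trans hT'.symm)
  have hTn : T.Nodup := hT.nodup_iff.2 (hS.filter _)
  have hrep : ∀ z ∈ T, G.rep z.1 = z.1 := fun z hz => by
    simpa using (List.mem_filter.1 (hT.subset hz)).2
  have huniq : ∀ {v : G.V}, ∀ z ∈ T, ∀ w ∈ T, G.Comp v z.1 → G.Comp v w.1 → z = w := by
    intro v z hz w hw h1 h2
    have := rep_eq_of_comp (h1.symm.trans h2)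
    rw [hrep z hz, hrep w hw] at this
    exact Subtype.ext this
  have hin : (T.flatMap (compBoxes Ξ hG d).inp).Nodup := by
    refine List.nodup_flatMap.2 ⟨fun x _ => nodup_finiteList _, ?_⟩
    refine hTn.pairwise_of_forall_ne fun z hz w hw hne e he he' => ?_
    exact hne (huniq z hz w hw (mem_compIn.1 he).1 (mem_compIn.1 he').1)
  have hout : (T.flatMap (compBoxes Ξ hG d).out).Nodup := by
    refine List.nodup_flatMap.2 ⟨fun x _ => nodup_finiteList _, ?_⟩
    refine hTn.pairwise_of_forall_ne fun z hz w hw hne e he he' => ?_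
    exact hne (huniq z hz w hw (mem_compOut.1 he).1 (mem_compOut.1 he').1)
  have hsafe : (compBoxes Ξ hG d).Safe G.inputEdges T := by
    refine BoxSystem.safe_of_nodup (List.nodup_append.2 ⟨nodup_inputEdges, hout, ?_⟩)
    rintro e he e' he' rfl
    obtain ⟨z, -, hz⟩ := List.mem_flatMap.1 he'
    exact (notMem_of_comp z.2 (mem_compOut.1 hz).1).1 (mem_inputEdges.1 he)
  have := hrun.unique hrun' hTT hsafe hin hout (.refl _)
  rw [Category.comp_id] at this
  exact toMapWires'_injective this

end Uniqueness

section Existence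

variable {D : Type u₂} [Category.{v₂} D] [MonoidalCategory D]
variable {F : C ⥤ D} [F.Monoidal] {Ξ : SuperOperator F}

lemma Reglues.perm {X : Set G.Edge} {S : List G.Internal} {M N : List G.Edge}
    {m : F.obj (wireTensor d.obj G.inputEdges) ⟶ F.obj (wireTensor d.obj M)}
    (h : d.Reglues Ξ X S M m) (hp : M.Perm N) : ∃ m', d.Reglues Ξ X S N m' := by
  obtain ⟨f, hf⟩ := (Draws.start (d := d) (L := M)).perm hp
  have := h.embed hf
  rw [List.append_nil] at this
  exact ⟨_, this⟩

/-- As long as some node has not been drawn, another component can be drawn: one which cannot be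
reached from the other components left. -/
lemma Reglues.exists_extend (hG : G.IsCVLocal) {X : Set G.Edge} (hX : G.IsCut X)
    {S : List G.Internal} {M : List G.Edge}
    {m : F.obj (wireTensor d.obj G.inputEdges) ⟶ F.obj (wireTensor d.obj M)}
    (h : d.Reglues Ξ X S M m) (hS : S.Nodup)
    (hcl : ∀ z ∈ S, ∀ w : G.Internal, G.Comp w.1 z.1 → w ∈ S)
    {z0 : G.Internal} (hz0 : z0 ∉ S) :
    ∃ (T : List G.Internal) (N : List G.Edge) (m' : _), T ≠ [] ∧ (S ++ T).Nodup ∧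
      (∀ z ∈ S ++ T, ∀ w : G.Internal, G.Comp w.1 z.1 → w ∈ S ++ T) ∧
      d.Reglues Ξ X (S ++ T) N m' := by
  have hwf : WellFounded (fun u v : G.Internal => G.Reach u.1 v.1 ∧ ¬ G.Reach v.1 u.1) := by
    have : IsTrans G.Internal (fun u v => G.Reach u.1 v.1 ∧ ¬ G.Reach v.1 u.1) :=
      ⟨fun a b c h1 h2 => ⟨h1.1.trans h2.1, fun h3 => h1.2 (h2.1.trans h3)⟩⟩
    have : Std.Irrefl (fun u v : G.Internal => G.Reach u.1 v.1 ∧ ¬ G.Reach v.1 u.1) :=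
      ⟨fun a h => h.2 h.1⟩
    exact Finite.wellFounded_of_trans_of_irrefl _
  obtain ⟨z1, hz1, hmin⟩ := hwf.has_min {z | z ∉ S} ⟨z0, hz0⟩
  -- The component is named by its representative.
  obtain ⟨z, hzS, hz, hzmin⟩ : ∃ z : G.Internal, z ∉ S ∧ G.rep z.1 = z.1 ∧
      ∀ w : G.Internal, G.Reach w.1 z.1 → ¬ G.Comp w.1 z.1 → w ∈ S := by
    refine ⟨⟨G.rep z1.1, notMem_of_comp z1.2 (comp_rep _).symm⟩, fun h1 => ?_, rep_rep _, ?_⟩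
    · exact hz1 (hcl _ h1 z1 (comp_rep _))
    · intro w h1 h2
      by_contra hw
      refine hmin w hw ⟨Reach.trans h1 (comp_rep z1.1).2, fun h3 => ?_⟩
      exact h2 ⟨h1, Reach.trans (comp_rep z1.1).2 h3⟩
  have hsub : ∀ e : G.Edge, G.Comp e.1.2 z.1 → ¬ G.Comp e.1.1 e.1.2 → e ∈ M := by
    intro e h1 h2
    have h3 : e ∈ G.inputEdges ++ S.flatMap fun z => G.outgoing z.1 := by
      rw [List.mem_append, mem_inputEdges, mem_flatMap_outgoing]
      by_cases h3 : e.1.1 ∈ G.inputs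
      · exact Or.inl h3
      · refine Or.inr (List.mem_map.2 ⟨⟨e.1.1, h3, source_notMem_outputs e⟩,
          hzmin _ (Reach.trans (Edge.reach e) h1.1) fun h4 => h2 (Comp.trans h4 h1.symm), rfl⟩)
    refine (List.mem_append.1 (h.flatMap_perm.symm.subset h3)).resolve_right fun h4 => ?_
    obtain ⟨w, hw, hwe⟩ := List.mem_map.1 (mem_flatMap_incoming.1 h4)
    exact hzS (hcl w hw z (hwe ▸ h1.symm))
  have hclosed : ∀ {T : List G.Internal}, (∀ w, w ∈ T ↔ G.Comp w.1 z.1) → T.Nodup →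
      T ≠ [] ∧ (S ++ T).Nodup ∧
        ∀ z ∈ S ++ T, ∀ w : G.Internal, G.Comp w.1 z.1 → w ∈ S ++ T := by
    intro T hT hTn
    refine ⟨List.ne_nil_of_mem ((hT z).2 (.refl _)), List.nodup_append.2 ⟨hS, hTn, ?_⟩, ?_⟩
    · rintro w hw _ hw' rfl
      exact hzS (hcl w hw z ((hT w).1 hw').symm)
    · intro u hu w hw
      rcases List.mem_append.1 hu with hu | hu
      · exact List.mem_append_left _ (hcl u hu w hw)
      · exact List.mem_append_right _ ((hT w).2 (hw.trans ((hT u).1 hu)))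
  by_cases htriv : ∃ c, G.IsSimpleCycle c ∧ z.1 ∈ c
  · obtain ⟨T, φ, hTn, hT, hφ⟩ := exists_draws_comp (d := d) hX
      (fun w hw => notMem_of_comp z.2 hw)
      (E := finiteList fun e => e ∈ X ∧ G.Comp e.1.2 z.1) (fun e => mem_finiteList)
    obtain ⟨h1, h2, h3⟩ := hclosed hT hTn
    obtain ⟨R, hR⟩ := List.Nodup.exists_perm_append (nodup_finiteList _ : (G.compIn z.1).Nodup)
      (fun e he => hsub e (mem_compIn.1 he).1 (mem_compIn.1 he).2)
    obtain ⟨m', hm'⟩ := h.perm (N := R ++ G.compIn z.1 ++ [])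
      (by rw [List.append_nil]; exact hR.trans List.perm_append_comm)
    refine ⟨T, _, _, h1, h2, h3, hm'.glue
      (isGluingGroup_of_rep hG hX hz htriv (nodup_finiteList _) fun e => mem_finiteList) hφ ?_⟩
    intro e he
    have he := (mem_finiteList.1 he).2
    exact List.mem_map.2 ⟨⟨e.1.2, notMem_of_comp z.2 he⟩, (hT _).2 he, rfl⟩
  · have hz' : IsTrivial z := by
      intro w hw
      by_contra hne
      exact htriv (exists_cycle_of_comp hw.symm (Ne.symm hne))
    obtain ⟨h1, h2, h3⟩ := hclosed (T := [z]) (fun w => by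
      rw [List.mem_singleton]
      exact ⟨fun h => h ▸ .refl _, fun h => Subtype.ext (hz' _ h)⟩) (List.nodup_singleton _)
    obtain ⟨R, hR⟩ := List.Nodup.exists_perm_append (G.incoming_nodup z.1) (m := M)
      (fun e he => by
        have he := (compIn_perm hz').symm.subset he
        exact hsub e (mem_compIn.1 he).1 (mem_compIn.1 he).2)
    obtain ⟨f', hf'⟩ := (Draws.start (d := d) (L := M)).exists_node z hR
    exact ⟨[z], _, _, h1, h2, h3, h.embed hf'⟩

/-- For each cut, some morphism is defined by the diagram: the components are drawn one after the
other. -/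
lemma exists_isMorphism (hG : G.IsCVLocal) {X : Set G.Edge} (hX : G.IsCut X) :
    ∃ m, d.IsMorphism Ξ X m := by
  classical
  have := Fintype.ofFinite G.Internal
  have key : ∀ n (S : List G.Internal) (M : List G.Edge) (m : _), d.Reglues Ξ X S M m → S.Nodup →
      (∀ z ∈ S, ∀ w : G.Internal, G.Comp w.1 z.1 → w ∈ S) → Fintype.card G.Internal - S.length = n →
      ∃ m, d.IsMorphism Ξ X m := by
    intro n
    induction n using Nat.strong_induction_on with
    | _ n ih =>
      intro S M m h hS hcl hn
      by_cases hall : ∀ z, z ∈ S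
      · obtain ⟨m', hm'⟩ := h.perm ((List.perm_append_right_iff _).1
          (h.flatMap_perm.trans (outputEdges_append_perm hS hall).symm))
        exact ⟨m', S, hS, hall, hm'⟩
      · push Not at hall
        obtain ⟨z0, hz0⟩ := hall
        obtain ⟨T, N, m', hT, hST, hcl', h'⟩ := h.exists_extend hG hX hS hcl hz0
        have h1 := hST.length_le_card
        have h2 := List.length_pos_iff.2 hT
        rw [List.length_append] at h1
        exact ih _ (by rw [List.length_append]; omega) _ _ _ h' hST hcl' rfl
  exact key _ [] _ _ .start List.nodup_nil (by simp) rfl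

end Existence

end CausalDiagram

/-- A time-travel super-operator yields well-defined morphisms. -/
theorem SuperOperator.IsTimeTravel.isWellDefined
    {C : Type u₁} [Category.{v₁} C] [MonoidalCategory C] [SymmetricCategory C]
    {D : Type u₂} [Category.{v₂} D] [MonoidalCategory D] [SymmetricCategory D]
    {F : C ⥤ D} [F.Braided] {Ξ : SuperOperator F} (hΞ : Ξ.IsTimeTravel) : Ξ.IsWellDefined := by
  intro G hG d
  have hX := FramedCausalGraph.isCut_repCut hG
  obtain ⟨m, hm⟩ := CausalDiagram.exists_isMorphism (d := d) (Ξ := Ξ) hG hX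
  refine ⟨⟨_, hX⟩, m, fun X' hX' m' => ⟨fun h => h.unique hG hΞ hX' hX hm, ?_⟩⟩
  rintro rfl
  obtain ⟨m'', h⟩ := CausalDiagram.exists_isMorphism (d := d) (Ξ := Ξ) hG hX'
  exact (h.unique hG hΞ hX' hX hm) ▸ h

/-! ### Morphisms between few idle wires -/

section Whisker

variable {C : Type u₁} [Category.{v₁} C] [MonoidalCategory C] {ι : Type} (obj : ι → C)

lemma wireWhisker_id (l r H : List ι) : wireWhisker obj l r (𝟙 (wireTensor obj H)) = 𝟙 _ := by
  simp [wireWhisker]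

lemma wireWhisker_one (i j : ι) (f : obj i ⟶ obj j) :
    wireWhisker obj [] [] (H := [i]) (K := [j]) f = f := by
  have key : ∀ {A B : C} (f : A ⟶ B), (ρ_ A).inv ≫ ((λ_ A).inv ≫ (𝟙_ C ◁ f) ≫ (λ_ B).hom) ▷ 𝟙_ C ≫
      (ρ_ B).hom = f := by
    intros; simp
  exact key f

lemma wireWhisker_two (i j i' j' : ι) (f : obj i ⊗ obj j ⟶ obj i' ⊗ obj j') :
    wireWhisker obj [] [] (H := [i, j]) (K := [i', j']) f = f := by
  have key : ∀ {A B A' B' : C} (f : A ⊗ B ⟶ A' ⊗ B'), (A ◁ (ρ_ B).inv ≫ (α_ _ _ _).inv) ≫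
      ((λ_ (A ⊗ B)).inv ≫ (𝟙_ C ◁ f) ≫ (λ_ (A' ⊗ B')).hom) ▷ 𝟙_ C ≫
      (α_ _ _ _).hom ≫ A' ◁ (ρ_ B').hom = f := by
    intros; simp
  exact key f

lemma wireWhisker_right (i j k : ι) (f : obj i ⟶ obj j) :
    wireWhisker obj [] [k] (H := [i]) (K := [j]) f = f ▷ obj k := by
  have key : ∀ {A B R : C} (f : A ⟶ B), 𝟙 _ ≫ ((λ_ A).inv ≫ (𝟙_ C ◁ f) ≫ (λ_ B).hom) ▷ R ≫
      𝟙 _ = f ▷ R := by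
    intros; simp
  exact key f

lemma wireWhisker_right_two (i j k l : ι) (f : obj i ⟶ obj j) :
    wireWhisker obj [] [k, l] (H := [i]) (K := [j]) f = f ▷ (obj k ⊗ obj l) := by
  have key : ∀ {A B R : C} (f : A ⟶ B), 𝟙 _ ≫ ((λ_ A).inv ≫ (𝟙_ C ◁ f) ≫ (λ_ B).hom) ▷ R ≫
      𝟙 _ = f ▷ R := by
    intros; simp
  exact key f

lemma wireWhisker_left (i j k : ι) (f : obj i ⟶ obj j) :
    wireWhisker obj [k] [] (H := [i]) (K := [j]) f = obj k ◁ f := by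
  have key : ∀ {A B L : C} (f : A ⟶ B), (L ◁ (ρ_ A).inv ≫ (α_ _ _ _).inv) ≫
      (𝟙 _ ≫ (L ◁ f) ≫ 𝟙 _) ▷ 𝟙_ C ≫ (α_ _ _ _).hom ≫ L ◁ (ρ_ B).hom = L ◁ f := by
    intros; simp
  exact key f

lemma wireWhisker_left_two (i j i' j' k : ι) (f : obj i ⊗ obj j ⟶ obj i' ⊗ obj j') :
    wireWhisker obj [k] [] (H := [i, j]) (K := [i', j']) f = obj k ◁ f := by
  have key : ∀ {A B A' B' L : C} (f : A ⊗ B ⟶ A' ⊗ B'),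
      (L ◁ (A ◁ (ρ_ B).inv ≫ (α_ _ _ _).inv) ≫ (α_ _ _ _).inv) ≫
      (𝟙 _ ≫ (L ◁ f) ≫ 𝟙 _) ▷ 𝟙_ C ≫ (α_ _ _ _).hom ≫
        L ◁ ((α_ _ _ _).hom ≫ A' ◁ (ρ_ B').hom) = L ◁ f := by
    intros; simp
  exact key f

variable {D : Type u₂} [Category.{v₂} D] [MonoidalCategory D] (F : C ⥤ D) [F.Monoidal]

open Functor.LaxMonoidal Functor.OplaxMonoidal

variable {F} in
lemma map_rightUnitor_conj {A B : C} (m : F.obj A ⟶ F.obj B) :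
    F.map (ρ_ A).inv ≫ δ F A (𝟙_ C) ≫ m ▷ F.obj (𝟙_ C) ≫ μ F B (𝟙_ C) ≫ F.map (ρ_ B).hom = m := by
  rw [Functor.Monoidal.map_rightUnitor, Functor.Monoidal.map_rightUnitor_inv]
  simp only [Category.assoc, Functor.Monoidal.μ_δ_assoc, ← whisker_exchange_assoc]
  rw [← whiskerLeft_comp_assoc, Functor.Monoidal.ε_η, whiskerLeft_id, Category.id_comp,
    rightUnitor_naturality, Iso.inv_hom_id_assoc]

variable {F} in
lemma map_leftUnitor_conj {A B : C} (m : F.obj A ⟶ F.obj B) :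
    F.map (λ_ A).inv ≫ δ F (𝟙_ C) A ≫ F.obj (𝟙_ C) ◁ m ≫ μ F (𝟙_ C) B ≫ F.map (λ_ B).hom = m := by
  rw [Functor.Monoidal.map_leftUnitor, Functor.Monoidal.map_leftUnitor_inv]
  simp only [Category.assoc, Functor.Monoidal.μ_δ_assoc, whisker_exchange_assoc]
  rw [← comp_whiskerRight_assoc, Functor.Monoidal.ε_η, id_whiskerRight, Category.id_comp,
    leftUnitor_naturality, Iso.inv_hom_id_assoc]

lemma wireWhiskerMap_one (i j : ι) (m : F.obj (obj i) ⟶ F.obj (obj j)) :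
    wireWhiskerMap F obj [] [] (H := [i]) (K := [j]) m = m :=
  (map_rightUnitor_conj _).trans (map_leftUnitor_conj m)

lemma wireWhiskerMap_two (i j i' j' : ι)
    (m : F.obj (obj i ⊗ obj j) ⟶ F.obj (obj i' ⊗ obj j')) :
    wireWhiskerMap F obj [] [] (H := [i, j]) (K := [i', j']) m = m := by
  have key : ∀ {A B A' B' : C} (m : F.obj (A ⊗ B) ⟶ F.obj (A' ⊗ B')),
      F.map (A ◁ (ρ_ B).inv ≫ (α_ _ _ _).inv) ≫ δ F _ _ ≫ m ▷ F.obj (𝟙_ C) ≫ μ F _ _ ≫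
        F.map ((α_ _ _ _).hom ≫ A' ◁ (ρ_ B').hom) = m := by
    intro A B A' B' m
    rw [← rightUnitor_tensor_hom, ← rightUnitor_tensor_inv, map_rightUnitor_conj]
  exact (key _).trans (map_leftUnitor_conj m)

lemma wireWhiskerMap_left (i j k : ι) (m : F.obj (obj i) ⟶ F.obj (obj j)) :
    wireWhiskerMap F obj [k] [] (H := [i]) (K := [j]) m =
      δ F (obj k) (obj i) ≫ F.obj (obj k) ◁ m ≫ μ F (obj k) (obj j) := by
  have key : ∀ {A B L : C} (m : F.obj A ⟶ F.obj B),
      F.map (L ◁ (ρ_ A).inv ≫ (α_ _ _ _).inv) ≫ δ F _ _ ≫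
      (F.map (𝟙 _) ≫ δ F L A ≫ (F.obj L ◁ m) ≫ μ F L B ≫ F.map (𝟙 _)) ▷
        F.obj (𝟙_ C) ≫ μ F _ _ ≫ F.map ((α_ _ _ _).hom ≫ L ◁ (ρ_ B).hom) =
      δ F L A ≫ F.obj L ◁ m ≫ μ F L B := by
    intro A B L m
    rw [← rightUnitor_tensor_hom, ← rightUnitor_tensor_inv, map_rightUnitor_conj]
    simp only [CategoryTheory.Functor.map_id, Category.id_comp, Category.comp_id]
  exact key m

end Whisker

/-! ### Graphs with a single cycle -/

namespace FramedCausalGraph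

variable {G : FramedCausalGraph} {x y : G.V} (hxy : G.graph.Adj x y) (hyx : G.graph.Adj y x)
  (rank : G.V → ℕ) (hle : ∀ e : G.Edge, rank e.1.1 ≤ rank e.1.2)
  (hlt : ∀ e : G.Edge, rank e.1.2 ≤ rank e.1.1 → e = ⟨(x, y), hxy⟩ ∨ e = ⟨(y, x), hyx⟩)

section Loop

include hle hlt

/-- If the only edges along which the rank does not increase are those from `x` to `y` and back,
then every simple cycle passes through these edges and no others. -/
lemma liesOn_of_rank {c : Cycle G.V} (hc : G.IsSimpleCycle c) :
    Edge.LiesOn (G := G) ⟨(x, y), hxy⟩ c ∧ Edge.LiesOn (G := G) ⟨(y, x), hyx⟩ c ∧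
      ∀ v ∈ c, v = x ∨ v = y := by
  have hreach : ∀ {u v}, G.Reach u v → rank u ≤ rank v := by
    intro u v h
    induction h with
    | refl => exact le_rfl
    | @tail a b _ h ih => exact ih.trans (hle ⟨(a, b), h⟩)
  have hedge : ∀ e : G.Edge, e.LiesOn c → e = ⟨(x, y), hxy⟩ ∨ e = ⟨(y, x), hyx⟩ :=
    fun e hl => hlt e (hreach (hl.comp hc).2)
  have hne : x ≠ y := by rintro rfl; exact not_adj_self _ hxy
  have hx : ∀ {v}, v ∈ c → v = x ∨ v = y := by
    intro v hv
    obtain ⟨e, rfl, hl⟩ := exists_source hc hv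
    rcases hedge e hl with rfl | rfl
    · exact Or.inl rfl
    · exact Or.inr rfl
  have hxc : x ∈ c ∧ y ∈ c := by
    obtain ⟨v, hv⟩ : ∃ v, v ∈ c := by
      induction c using Cycle.induction_on with
      | nil => exact absurd rfl hc.1
      | cons a l _ => exact ⟨a, by simp⟩
    obtain ⟨e, -, hl⟩ := exists_source hc hv
    have h1 := Cycle.Follows.mem_left hl
    have h2 := Cycle.Follows.mem_right hl
    rcases hedge e hl with rfl | rfl
    · exact ⟨h1, h2⟩
    · exact ⟨h2, h1⟩
  refine ⟨?_, ?_, fun v => hx⟩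
  · obtain ⟨e, he, hl⟩ := exists_source hc hxc.1
    rcases hedge e hl with rfl | rfl
    · exact hl
    · exact absurd he.symm hne
  · obtain ⟨e, he, hl⟩ := exists_source hc hxc.2
    rcases hedge e hl with rfl | rfl
    · exact absurd he hne
    · exact hl

lemma isCVLocal_of_rank (hy : G.degree y ≤ 2) : G.IsCVLocal := by
  intro c hc u hu v hv hdu hdv
  have h : ∀ w ∈ c, 2 < G.degree w → w = x := fun w hw hd =>
    ((liesOn_of_rank hxy hyx rank hle hlt hc).2.2 w hw).resolve_right
      (by rintro rfl; exact absurd hy (not_le.2 hd))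
  rw [h u hu hdu, h v hv hdv]

lemma isCut_of_rank {e : G.Edge} (he : e = ⟨(x, y), hxy⟩ ∨ e = ⟨(y, x), hyx⟩) :
    G.IsCut {e} := by
  have hl : ∀ c, G.IsSimpleCycle c → e.LiesOn c := by
    intro c hc
    obtain ⟨h1, h2, -⟩ := liesOn_of_rank hxy hyx rank hle hlt hc
    rcases he with rfl | rfl
    · exact h1
    · exact h2
  refine ⟨fun c hc => ⟨e, ⟨rfl, hl c hc⟩, fun e' he' => he'.1⟩, ?_⟩
  intro e' he'
  obtain rfl : e' = e := he'
  refine exists_isSimpleCycle e' ?_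
  rcases he with rfl | rfl
  · exact ⟨.single hxy, .single hyx⟩
  · exact ⟨.single hyx, .single hxy⟩

lemma isGluingGroup_of_rank (hx : 2 < G.degree x) {e : G.Edge}
    (he : e = ⟨(x, y), hxy⟩ ∨ e = ⟨(y, x), hyx⟩) : G.IsGluingGroup {e} [e] := by
  obtain ⟨c, hc, hl⟩ := (isCut_of_rank hxy hyx rank hle hlt he).2 e rfl
  have hxc : x ∈ c := by
    rcases he with rfl | rfl
    · exact Cycle.Follows.mem_left hl
    · exact Cycle.Follows.mem_right hl
  refine ⟨List.nodup_singleton e, Or.inl ⟨x, hx, ⟨c, hc, hxc⟩, fun e' => ?_⟩⟩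
  rw [List.mem_singleton]
  exact ⟨by rintro rfl; exact ⟨rfl, c, hc, hxc, hl⟩, fun h => h.1⟩

end Loop

end FramedCausalGraph

lemma CausalDiagram.Draws.of_eq {C : Type u₁} [Category.{v₁} C] [MonoidalCategory C]
    [SymmetricCategory C] {G : FramedCausalGraph} {d : CausalDiagram G C} {L M : List G.Edge}
    {S : List G.Internal} {f g : wireTensor d.obj L ⟶ wireTensor d.obj M} (h : d.Draws L S M f)
    (e : f = g) : d.Draws L S M g := e ▸ h

lemma CausalDiagram.Reglues.of_eq {C : Type u₁} [Category.{v₁} C] [MonoidalCategory C]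
    [SymmetricCategory C] {D : Type u₂} [Category.{v₂} D] [MonoidalCategory D] {F : C ⥤ D}
    [F.Monoidal] {Ξ : SuperOperator F} {G : FramedCausalGraph} {d : CausalDiagram G C}
    {X : Set G.Edge} {S : List G.Internal} {M : List G.Edge}
    {f g : F.obj (wireTensor d.obj G.inputEdges) ⟶ F.obj (wireTensor d.obj M)}
    (h : d.Reglues Ξ X S M f) (e : f = g) : d.Reglues Ξ X S M g := e ▸ h

lemma SuperOperator.IsWellDefined.eq {C : Type u₁} [Category.{v₁} C] [MonoidalCategory C]
    [SymmetricCategory C] {D : Type u₂} [Category.{v₂} D] [MonoidalCategory D] {F : C ⥤ D}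
    [F.Monoidal] {Ξ : SuperOperator F} (h : Ξ.IsWellDefined) {G : FramedCausalGraph}
    (hG : G.IsCVLocal) {d : CausalDiagram G C} {X X' : Set G.Edge} (hX : G.IsCut X)
    (hX' : G.IsCut X')
    {m m' : F.obj (wireTensor d.obj G.inputEdges) ⟶ F.obj (wireTensor d.obj G.outputEdges)}
    (hm : d.IsMorphism Ξ X m) (hm' : d.IsMorphism Ξ X' m') : m = m' := by
  obtain ⟨-, m₀, h⟩ := h G hG d
  rw [(h X hX m).1 hm, (h X' hX' m').1 hm']

/-! ### Vanishing -/

namespace Segment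

/-- The nodes of the graph `i → v → o`. -/
inductive Node
  | i | v | o

/-- The edges of the graph `i → v → o`. -/
inductive Adj : Node → Node → Prop
  | iv : Adj .i .v
  | vo : Adj .v .o

/-- The pairs of adjacent nodes. -/
abbrev Edge : Type := {e : Node × Node // Adj e.1 e.2}

/-- The incoming edges. -/
def incoming : Node → List Edge
  | .i => []
  | .v => [⟨(.i, .v), .iv⟩]
  | .o => [⟨(.v, .o), .vo⟩]

/-- The outgoing edges. -/
def outgoing : Node → List Edge
  | .i => [⟨(.i, .v), .iv⟩]
  | .v => [⟨(.v, .o), .vo⟩]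
  | .o => []

/-- The graph `i → v → o`. -/
def graph : FramedCausalGraph where
  V := Node
  finite := Set.finite_univ_iff.1 ((Set.toFinite {.i, .v, .o}).subset
    fun u _ => by cases u <;> simp)
  graph := ⟨Adj⟩
  nontransitive := by rintro _ _ _ h1 h2 h3; cases h1 <;> cases h2; nomatch h3
  inputs := [.i]
  inputs_nodup := List.nodup_singleton _
  outputs := [.o]
  outputs_nodup := List.nodup_singleton _
  incoming := incoming
  incoming_nodup := by rintro (_ | _ | _) <;> simp [incoming]
  mem_incoming := by rintro (_ | _ | _) ⟨⟨_, _⟩, h⟩ <;> cases h <;> simp [incoming]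
  outgoing := outgoing
  outgoing_nodup := by rintro (_ | _ | _) <;> simp [outgoing]
  mem_outgoing := by rintro (_ | _ | _) ⟨⟨_, _⟩, h⟩ <;> cases h <;> simp [outgoing]
  incoming_input := by simp [incoming]
  outgoing_input := by rintro _ h; cases List.mem_singleton.1 h; exact ⟨_, rfl⟩
  outgoing_output := by simp [outgoing]
  incoming_output := by rintro _ h; cases List.mem_singleton.1 h; exact ⟨_, rfl⟩
  incoming_compatible := by
    rintro (_ | _ | _) e e' h <;> simpa [incoming] using h.length_le
  outgoing_compatible := by
    rintro (_ | _ | _) e e' h <;> simpa [outgoing] using h.length_le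

lemma isInternal {u : Node} (hi : u ≠ .i) (ho : u ≠ .o) :
    u ∉ graph.inputs ∧ u ∉ graph.outputs :=
  ⟨fun h => hi (List.mem_singleton.1 h), fun h => ho (List.mem_singleton.1 h)⟩

/-- The position of a node, which increases along the edges. -/
def rank : Node → ℕ
  | .i => 0
  | .v => 1
  | .o => 2

lemma isCR : graph.IsCR := by
  have h : ∀ u w : Node, Relation.TransGen graph.graph.Adj u w → rank u < rank w := by
    intro u w h
    induction h with
    | single h => cases h <;> simp [rank]
    | tail _ h ih => exact ih.trans (by cases h <;> simp [rank])
  exact fun x hx => lt_irrefl _ (h x x hx)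

section Diagram

variable {C : Type u₁} [Category.{v₁} C] [MonoidalCategory C]

/-- The object on the wire leaving a node. -/
def wire (H K : C) : Node → C
  | .i => H
  | _ => K

/-- The diagram with a single process `f`. -/
def diagram {H K : C} (f : H ⟶ K) : CausalDiagram graph C where
  obj e := wire H K e.1.1
  mor
    | ⟨.i, h⟩ => absurd (List.mem_singleton_self _) h.1
    | ⟨.v, _⟩ => f
    | ⟨.o, h⟩ => absurd (List.mem_singleton_self _) h.2

/-- The internal node. -/
def v : graph.Internal := ⟨.v, isInternal nofun nofun⟩

lemma isCRMorphism [SymmetricCategory C] {H K : C} (f : H ⟶ K) :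
    (diagram f).IsCRMorphism f := by
  refine ⟨[v], List.nodup_singleton _, ?_, ?_⟩
  · rintro ⟨_ | _ | _, h⟩
    · exact absurd (List.mem_singleton_self _) h.1
    · exact List.mem_singleton_self _
    · exact absurd (List.mem_singleton_self _) h.2
  · exact ((CausalDiagram.Draws.start (d := diagram f)).node (l := []) (r := []) v).of_eq
      ((Category.id_comp _).trans (wireWhisker_one _ _ _ _))

end Diagram

end Segment

/-! ### Naturality and sliding -/

namespace Loop

/-- The nodes of the graph `i → a → x → b → o` with `x` and `y` on a cycle. The second node `y` on
the cycle is needed since no node is adjacent to itself. -/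
inductive Node
  | i | a | x | y | b | o

/-- The edges of the graph. -/
inductive Adj : Node → Node → Prop
  | ia : Adj .i .a
  | ax : Adj .a .x
  | xy : Adj .x .y
  | yx : Adj .y .x
  | xb : Adj .x .b
  | bo : Adj .b .o

/-- The pairs of adjacent nodes. -/
abbrev Edge : Type := {e : Node × Node // Adj e.1 e.2}

/-- The incoming edges. -/
def incoming : Node → List Edge
  | .i => []
  | .a => [⟨(.i, .a), .ia⟩]
  | .x => [⟨(.a, .x), .ax⟩, ⟨(.y, .x), .yx⟩]
  | .y => [⟨(.x, .y), .xy⟩]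
  | .b => [⟨(.x, .b), .xb⟩]
  | .o => [⟨(.b, .o), .bo⟩]

/-- The outgoing edges. -/
def outgoing : Node → List Edge
  | .i => [⟨(.i, .a), .ia⟩]
  | .a => [⟨(.a, .x), .ax⟩]
  | .x => [⟨(.x, .b), .xb⟩, ⟨(.x, .y), .xy⟩]
  | .y => [⟨(.y, .x), .yx⟩]
  | .b => [⟨(.b, .o), .bo⟩]
  | .o => []

/-- The graph `i → a → x → b → o` with `x` and `y` on a cycle. -/
def graph : FramedCausalGraph where
  V := Node
  finite := Set.finite_univ_iff.1 ((Set.toFinite {.i, .a, .x, .y, .b, .o}).subset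
    fun u _ => by cases u <;> simp)
  graph := ⟨Adj⟩
  nontransitive := by rintro _ _ _ h1 h2 h3; cases h1 <;> cases h2 <;> nomatch h3
  inputs := [.i]
  inputs_nodup := List.nodup_singleton _
  outputs := [.o]
  outputs_nodup := List.nodup_singleton _
  incoming := incoming
  incoming_nodup := by rintro (_ | _ | _ | _ | _ | _) <;> simp [incoming]
  mem_incoming := by
    rintro (_ | _ | _ | _ | _ | _) ⟨⟨_, _⟩, h⟩ <;> cases h <;> simp [incoming]
  outgoing := outgoing
  outgoing_nodup := by rintro (_ | _ | _ | _ | _ | _) <;> simp [outgoing]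
  mem_outgoing := by
    rintro (_ | _ | _ | _ | _ | _) ⟨⟨_, _⟩, h⟩ <;> cases h <;> simp [outgoing]
  incoming_input := by simp [incoming]
  outgoing_input := by rintro _ h; cases List.mem_singleton.1 h; exact ⟨_, rfl⟩
  outgoing_output := by simp [outgoing]
  incoming_output := by rintro _ h; cases List.mem_singleton.1 h; exact ⟨_, rfl⟩
  incoming_compatible := by
    rintro (_ | _ | _ | _ | _ | _) e e' h
    case x => cases h.eq_of_length rfl; simp
    all_goals simpa [incoming] using h.length_le
  outgoing_compatible := by
    rintro (_ | _ | _ | _ | _ | _) e e' h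
    case x => cases h.eq_of_length rfl; simp
    all_goals simpa [outgoing] using h.length_le

lemma isInternal {u : Node} (hi : u ≠ .i) (ho : u ≠ .o) :
    u ∉ graph.inputs ∧ u ∉ graph.outputs :=
  ⟨fun h => hi (List.mem_singleton.1 h), fun h => ho (List.mem_singleton.1 h)⟩

/-- The position of a node, which increases along the edges off the cycle. -/
def rank : Node → ℕ
  | .i => 0
  | .a => 1
  | .x => 2
  | .y => 2
  | .b => 3
  | .o => 4

/-- The edge from `x` to `y`. -/
def xy : graph.Edge := ⟨(.x, .y), .xy⟩

/-- The edge from `y` to `x`. -/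
def yx : graph.Edge := ⟨(.y, .x), .yx⟩

lemma rank_le (e : graph.Edge) : rank e.1.1 ≤ rank e.1.2 := by
  obtain ⟨⟨_, _⟩, h⟩ := e
  cases h <;> simp [rank]

lemma eq_of_rank_le (e : graph.Edge) (h : rank e.1.2 ≤ rank e.1.1) : e = xy ∨ e = yx := by
  obtain ⟨⟨_, _⟩, he⟩ := e
  cases he <;> first | exact Or.inl rfl | exact Or.inr rfl | exact absurd h (by decide)

lemma isCVLocal : graph.IsCVLocal :=
  FramedCausalGraph.isCVLocal_of_rank xy.2 yx.2 rank rank_le eq_of_rank_le le_rfl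

lemma isCut {e : graph.Edge} (he : e = xy ∨ e = yx) : graph.IsCut {e} :=
  FramedCausalGraph.isCut_of_rank xy.2 yx.2 rank rank_le eq_of_rank_le he

lemma isGluingGroup {e : graph.Edge} (he : e = xy ∨ e = yx) : graph.IsGluingGroup {e} [e] :=
  FramedCausalGraph.isGluingGroup_of_rank xy.2 yx.2 rank rank_le eq_of_rank_le (by decide) he

/-- The internal node `a`. -/
def a : graph.Internal := ⟨.a, isInternal nofun nofun⟩

/-- The internal node `x`. -/
def x : graph.Internal := ⟨.x, isInternal nofun nofun⟩

/-- The internal node `y`. -/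
def y : graph.Internal := ⟨.y, isInternal nofun nofun⟩

/-- The internal node `b`. -/
def b : graph.Internal := ⟨.b, isInternal nofun nofun⟩

lemma mem_of_perm {S : List graph.Internal} (hS : [a, x, y, b].Perm S) :
    S.Nodup ∧ ∀ z, z ∈ S := by
  refine ⟨hS.nodup_iff.1 (List.Nodup.of_map Subtype.val
    (show [Node.a, .x, .y, .b].Nodup by simp)), fun z => hS.mem_iff.1 ?_⟩
  obtain ⟨_ | _ | _ | _ | _ | _, h⟩ := z
  · exact absurd (List.mem_singleton_self _) h.1
  · simp [a]
  · simp [x]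
  · simp [y]
  · simp [b]
  · exact absurd (List.mem_singleton_self _) h.2

section Diagram

variable {C : Type u₁} [Category.{v₁} C] [MonoidalCategory C]

/-- The object on a wire, given by its source and its target. -/
def wire (H' H K K' X Y : C) : Node → Node → C
  | .i, _ => H'
  | .a, _ => H
  | .x, .y => Y
  | .x, _ => K
  | .y, _ => X
  | _, _ => K'

variable {H' H K K' X Y : C} (f : H' ⟶ H) (Φ : H ⊗ X ⟶ K ⊗ Y) (t : Y ⟶ X) (g : K ⟶ K')

/-- The diagram with the processes `f`, `Φ`, `t` and `g` at the nodes `a`, `x`, `y` and `b`. -/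
def diagram : CausalDiagram graph C where
  obj e := wire H' H K K' X Y e.1.1 e.1.2
  mor
    | ⟨.i, h⟩ => absurd (List.mem_singleton_self _) h.1
    | ⟨.a, _⟩ => f
    | ⟨.x, _⟩ => Φ
    | ⟨.y, _⟩ => t
    | ⟨.b, _⟩ => g
    | ⟨.o, h⟩ => absurd (List.mem_singleton_self _) h.2

variable [SymmetricCategory C] {D : Type u₂} [Category.{v₂} D] [MonoidalCategory D]
  (F : C ⥤ D) [F.Monoidal] (Ξ : SuperOperator F)

open CausalDiagram

/-- The edge from `i` to `a`. -/
def ia : graph.Edge := ⟨(.i, .a), .ia⟩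

/-- The edge from `a` to `x`. -/
def ax : graph.Edge := ⟨(.a, .x), .ax⟩

/-- The edge from `x` to `b`. -/
def xb : graph.Edge := ⟨(.x, .b), .xb⟩

/-- The edge from `b` to `o`. -/
def bo : graph.Edge := ⟨(.b, .o), .bo⟩

lemma draws_a : (diagram f Φ t g).Draws [ia] [a] [ax] f :=
  ((Draws.start (d := diagram f Φ t g) (L := [ia])).node (l := []) (r := []) a).of_eq
    ((Category.id_comp _).trans (wireWhisker_one _ _ _ _))

lemma draws_b : (diagram f Φ t g).Draws [xb] [b] [bo] g :=
  ((Draws.start (d := diagram f Φ t g) (L := [xb])).node (l := []) (r := []) b).of_eq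
    ((Category.id_comp _).trans (wireWhisker_one _ _ _ _))

lemma draws_x : (diagram f Φ t g).Draws [ax, yx] [x] [xb, xy] Φ :=
  ((Draws.start (d := diagram f Φ t g) (L := [ax, yx])).node (l := []) (r := []) x).of_eq
    ((Category.id_comp _).trans (wireWhisker_two _ _ _ _ _ _))

lemma draws_xy : (diagram f Φ t g).Draws [ax, yx] [x, y] [xb, yx] (Φ ≫ K ◁ t) :=
  ((draws_x f Φ t g).node (l := [xb]) (r := []) y).of_eq
    (congrArg (Φ ≫ ·) (wireWhisker_left _ _ _ _ _))

lemma draws_yx : (diagram f Φ t g).Draws [ax, xy] [y, x] [xb, xy] (H ◁ t ≫ Φ) := by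
  have h : (diagram f Φ t g).Draws [ax, xy] [y] [ax, yx] (H ◁ t) :=
    ((Draws.start (d := diagram f Φ t g) (L := [ax, xy])).node (l := [ax]) (r := []) y).of_eq
      ((Category.id_comp _).trans (wireWhisker_left _ _ _ _ _))
  exact (h.node (l := []) (r := []) x).of_eq (congrArg (H ◁ t ≫ ·) (wireWhisker_two _ _ _ _ _ _))

lemma draws_axyb : (diagram f Φ t g).Draws [ia, yx] [a, x, y, b] [bo, yx]
    (f ▷ X ≫ (Φ ≫ K ◁ t) ≫ g ▷ X) := by
  have h : (diagram f Φ t g).Draws [ia, yx] [a] [ax, yx] (f ▷ X) :=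
    ((Draws.start (d := diagram f Φ t g) (L := [ia, yx])).node (l := []) (r := [yx]) a).of_eq
      ((Category.id_comp _).trans (wireWhisker_right _ _ _ _ _))
  have h1 : (diagram f Φ t g).Draws [ia, yx] [a, x] [xb, xy] (f ▷ X ≫ Φ) :=
    (h.node (l := []) (r := []) x).of_eq (congrArg (f ▷ X ≫ ·) (wireWhisker_two _ _ _ _ _ _))
  have h2 : (diagram f Φ t g).Draws [ia, yx] [a, x, y] [xb, yx] ((f ▷ X ≫ Φ) ≫ K ◁ t) :=
    (h1.node (l := [xb]) (r := []) y).of_eq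
      (congrArg ((f ▷ X ≫ Φ) ≫ ·) (wireWhisker_left _ _ _ _ _))
  have h3 : (diagram f Φ t g).Draws [ia, yx] [a, x, y, b] [bo, yx]
      (((f ▷ X ≫ Φ) ≫ K ◁ t) ≫ g ▷ X) :=
    (h2.node (l := []) (r := [yx]) b).of_eq
      (congrArg (((f ▷ X ≫ Φ) ≫ K ◁ t) ≫ ·) (wireWhisker_right _ _ _ _ _))
  exact h3.of_eq ((congrArg (· ≫ g ▷ X) (Category.assoc _ _ _)).trans (Category.assoc _ _ _))

variable {F}

/-- The cycle is cut open at the edge from `y` to `x`, and the processes at `a` and `b` are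
embedded. -/
lemma isMorphism_yx : (diagram f Φ t g).IsMorphism Ξ {yx}
    (F.map f ≫ Ξ H K X (Φ ≫ K ◁ t) ≫ F.map g) := by
  obtain ⟨h1, h2⟩ := mem_of_perm (List.Perm.refl _)
  refine ⟨[a, x, y, b], h1, h2, ?_⟩
  have h : (diagram f Φ t g).Reglues Ξ {yx} [a] [ax] (F.map f) :=
    (Reglues.start.embed (draws_a f Φ t g)).of_eq (Category.id_comp _)
  have h3 : (diagram f Φ t g).Reglues Ξ {yx} [a, x, y] [xb]
      (F.map f ≫ Ξ H K X (Φ ≫ K ◁ t)) :=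
    (Reglues.glue (l := []) (r := []) (H := [ax]) (K := [xb]) (E := [yx]) h
      (isGluingGroup (Or.inr rfl)) (draws_xy f Φ t g)
      (by
        rintro _ h
        cases List.mem_singleton.1 h
        exact List.mem_map_of_mem (f := Subtype.val) (a := x) (by simp))).of_eq
      (congrArg (F.map f ≫ ·) ((wireWhiskerMap_one _ F _ _ _).trans
        (congrArg (Ξ H K X) ((Category.id_comp _).trans (Category.comp_id _)))))
  exact (h3.embed (draws_b f Φ t g)).of_eq (Category.assoc _ _ _)

/-- The cycle is cut open at the edge from `x` to `y`, and the processes at `a` and `b` are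
embedded. -/
lemma isMorphism_xy : (diagram f Φ t g).IsMorphism Ξ {xy}
    (F.map f ≫ Ξ H K Y (H ◁ t ≫ Φ) ≫ F.map g) := by
  obtain ⟨h1, h2⟩ := mem_of_perm (((List.Perm.swap y x []).append_right [b]).cons a)
  refine ⟨[a, y, x, b], h1, h2, ?_⟩
  have h : (diagram f Φ t g).Reglues Ξ {xy} [a] [ax] (F.map f) :=
    (Reglues.start.embed (draws_a f Φ t g)).of_eq (Category.id_comp _)
  have h3 : (diagram f Φ t g).Reglues Ξ {xy} [a, y, x] [xb]
      (F.map f ≫ Ξ H K Y (H ◁ t ≫ Φ)) :=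
    (Reglues.glue (l := []) (r := []) (H := [ax]) (K := [xb]) (E := [xy]) h
      (isGluingGroup (Or.inl rfl)) (draws_yx f Φ t g)
      (by
        rintro _ h
        cases List.mem_singleton.1 h
        exact List.mem_map_of_mem (f := Subtype.val) (a := y) (by simp))).of_eq
      (congrArg (F.map f ≫ ·) ((wireWhiskerMap_one _ F _ _ _).trans
        (congrArg (Ξ H K Y) ((Category.id_comp _).trans (Category.comp_id _)))))
  exact (h3.embed (draws_b f Φ t g)).of_eq (Category.assoc _ _ _)

/-- The cycle is cut open at the edge from `y` to `x`, and all the nodes are part of the piece which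
is reglued. -/
lemma isMorphism_glue : (diagram f Φ t g).IsMorphism Ξ {yx}
    (Ξ H' K' X (f ▷ X ≫ (Φ ≫ K ◁ t) ≫ g ▷ X)) := by
  obtain ⟨h1, h2⟩ := mem_of_perm (List.Perm.refl _)
  refine ⟨[a, x, y, b], h1, h2, ?_⟩
  exact (Reglues.glue (l := []) (r := []) (H := [ia]) (K := [bo]) (E := [yx]) Reglues.start
      (isGluingGroup (Or.inr rfl)) (draws_axyb f Φ t g)
      (by
        rintro _ h
        cases List.mem_singleton.1 h
        exact List.mem_map_of_mem (f := Subtype.val) (a := x) (by simp))).of_eq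
      ((Category.id_comp _).trans ((wireWhiskerMap_one _ F _ _ _).trans
        (congrArg (Ξ H' K' X) ((Category.id_comp _).trans (Category.comp_id _)))))

end Diagram

end Loop

/-! ### Strength -/

namespace Strands

/-- The nodes of the graph with strands `i → a → o` and `i' → x → o'`, and `x` and `y` on a
cycle. -/
inductive Node
  | i | a | o | i' | x | y | o'

/-- The edges of the graph. -/
inductive Adj : Node → Node → Prop
  | ia : Adj .i .a
  | ao : Adj .a .o
  | ix : Adj .i' .x
  | xy : Adj .x .y
  | yx : Adj .y .x
  | xo : Adj .x .o'

/-- The pairs of adjacent nodes. -/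
abbrev Edge : Type := {e : Node × Node // Adj e.1 e.2}

/-- The incoming edges. -/
def incoming : Node → List Edge
  | .i => []
  | .a => [⟨(.i, .a), .ia⟩]
  | .o => [⟨(.a, .o), .ao⟩]
  | .i' => []
  | .x => [⟨(.i', .x), .ix⟩, ⟨(.y, .x), .yx⟩]
  | .y => [⟨(.x, .y), .xy⟩]
  | .o' => [⟨(.x, .o'), .xo⟩]

/-- The outgoing edges. -/
def outgoing : Node → List Edge
  | .i => [⟨(.i, .a), .ia⟩]
  | .a => [⟨(.a, .o), .ao⟩]
  | .o => []
  | .i' => [⟨(.i', .x), .ix⟩]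
  | .x => [⟨(.x, .o'), .xo⟩, ⟨(.x, .y), .xy⟩]
  | .y => [⟨(.y, .x), .yx⟩]
  | .o' => []

/-- The graph with strands `i → a → o` and `i' → x → o'`, and `x` and `y` on a cycle. -/
def graph : FramedCausalGraph where
  V := Node
  finite := Set.finite_univ_iff.1 ((Set.toFinite {.i, .a, .o, .i', .x, .y, .o'}).subset
    fun u _ => by cases u <;> simp)
  graph := ⟨Adj⟩
  nontransitive := by rintro _ _ _ h1 h2 h3; cases h1 <;> cases h2 <;> nomatch h3
  inputs := [.i, .i']
  inputs_nodup := by simp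
  outputs := [.o, .o']
  outputs_nodup := by simp
  incoming := incoming
  incoming_nodup := by rintro (_ | _ | _ | _ | _ | _ | _) <;> simp [incoming]
  mem_incoming := by
    rintro (_ | _ | _ | _ | _ | _ | _) ⟨⟨_, _⟩, h⟩ <;> cases h <;> simp [incoming]
  outgoing := outgoing
  outgoing_nodup := by rintro (_ | _ | _ | _ | _ | _ | _) <;> simp [outgoing]
  mem_outgoing := by
    rintro (_ | _ | _ | _ | _ | _ | _) ⟨⟨_, _⟩, h⟩ <;> cases h <;> simp [outgoing]
  incoming_input := by simp [incoming]
  outgoing_input := List.forall_mem_cons.2 ⟨⟨_, rfl⟩, List.forall_mem_singleton.2 ⟨_, rfl⟩⟩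
  outgoing_output := by simp [outgoing]
  incoming_output := List.forall_mem_cons.2 ⟨⟨_, rfl⟩, List.forall_mem_singleton.2 ⟨_, rfl⟩⟩
  incoming_compatible := by
    rintro (_ | _ | _ | _ | _ | _ | _) e e' h
    case x => cases h.eq_of_length rfl; simp
    all_goals simpa [incoming] using h.length_le
  outgoing_compatible := by
    rintro (_ | _ | _ | _ | _ | _ | _) e e' h
    case x => cases h.eq_of_length rfl; simp
    all_goals simpa [outgoing] using h.length_le

/-- The position of a node on its strand, which increases along the edges off the cycle. -/
def rank : Node → ℕ
  | .i => 0
  | .a => 1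
  | .o => 2
  | .i' => 0
  | .x => 1
  | .y => 1
  | .o' => 2

lemma isInternal {u : Node} (hi : u ∉ [Node.i, .i']) (ho : u ∉ [Node.o, .o']) :
    u ∉ graph.inputs ∧ u ∉ graph.outputs := ⟨hi, ho⟩

/-- The edge from `i` to `a`. -/
def ia : graph.Edge := ⟨(.i, .a), .ia⟩

/-- The edge from `a` to `o`. -/
def ao : graph.Edge := ⟨(.a, .o), .ao⟩

/-- The edge from `i'` to `x`. -/
def ix : graph.Edge := ⟨(.i', .x), .ix⟩

/-- The edge from `x` to `o'`. -/
def xo : graph.Edge := ⟨(.x, .o'), .xo⟩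

/-- The edge from `x` to `y`. -/
def xy : graph.Edge := ⟨(.x, .y), .xy⟩

/-- The edge from `y` to `x`. -/
def yx : graph.Edge := ⟨(.y, .x), .yx⟩

lemma rank_le (e : graph.Edge) : rank e.1.1 ≤ rank e.1.2 := by
  obtain ⟨⟨_, _⟩, h⟩ := e
  cases h <;> simp [rank]

lemma eq_of_rank_le (e : graph.Edge) (h : rank e.1.2 ≤ rank e.1.1) : e = xy ∨ e = yx := by
  obtain ⟨⟨_, _⟩, he⟩ := e
  cases he <;> first | exact Or.inl rfl | exact Or.inr rfl | exact absurd h (by decide)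

lemma isCVLocal : graph.IsCVLocal :=
  FramedCausalGraph.isCVLocal_of_rank xy.2 yx.2 rank rank_le eq_of_rank_le le_rfl

lemma isCut_yx : graph.IsCut {yx} :=
  FramedCausalGraph.isCut_of_rank xy.2 yx.2 rank rank_le eq_of_rank_le (Or.inr rfl)

lemma isGluingGroup_yx : graph.IsGluingGroup {yx} [yx] :=
  FramedCausalGraph.isGluingGroup_of_rank xy.2 yx.2 rank rank_le eq_of_rank_le (by decide)
    (Or.inr rfl)

/-- The internal node `a`. -/
def a : graph.Internal := ⟨.a, isInternal (by simp) (by simp)⟩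

/-- The internal node `x`. -/
def x : graph.Internal := ⟨.x, isInternal (by simp) (by simp)⟩

/-- The internal node `y`. -/
def y : graph.Internal := ⟨.y, isInternal (by simp) (by simp)⟩

lemma nodup_internal : [a, x, y].Nodup :=
  List.Nodup.of_map Subtype.val (show [Node.a, .x, .y].Nodup by simp)

lemma mem_internal (z : graph.Internal) : z ∈ [a, x, y] := by
  obtain ⟨_ | _ | _ | _ | _ | _ | _, h⟩ := z
  · exact absurd List.mem_cons_self h.1
  · simp [a]
  · exact absurd List.mem_cons_self h.2
  · exact absurd (List.mem_cons_of_mem _ List.mem_cons_self) h.1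
  · simp [x]
  · simp [y]
  · exact absurd (List.mem_cons_of_mem _ List.mem_cons_self) h.2

section Diagram

variable {C : Type u₁} [Category.{v₁} C] [MonoidalCategory C]

/-- The object on a wire, given by its source and its target. -/
def wire (A B H K X : C) : Node → Node → C
  | .i, _ => A
  | .a, _ => B
  | .i', _ => H
  | .x, .y => X
  | .y, _ => X
  | _, _ => K

variable {A B H K X : C} (g : A ⟶ B) (Φ : H ⊗ X ⟶ K ⊗ X)

/-- The diagram with the processes `g` and `Φ` at the nodes `a` and `x`, and an identity at `y`. -/
def diagram : CausalDiagram graph C where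
  obj e := wire A B H K X e.1.1 e.1.2
  mor
    | ⟨.i, h⟩ => absurd List.mem_cons_self h.1
    | ⟨.a, _⟩ => g
    | ⟨.o, h⟩ => absurd List.mem_cons_self h.2
    | ⟨.i', h⟩ => absurd (List.mem_cons_of_mem _ List.mem_cons_self) h.1
    | ⟨.x, _⟩ => Φ
    | ⟨.y, _⟩ => 𝟙 X
    | ⟨.o', h⟩ => absurd (List.mem_cons_of_mem _ List.mem_cons_self) h.2

variable [SymmetricCategory C] {D : Type u₂} [Category.{v₂} D] [MonoidalCategory D]
  {F : C ⥤ D} [F.Monoidal] (Ξ : SuperOperator F)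

open CausalDiagram Functor.LaxMonoidal Functor.OplaxMonoidal

lemma draws_a : (diagram g Φ).Draws [ia, ix] [a] [ao, ix] (g ▷ H) :=
  ((Draws.start (d := diagram g Φ) (L := [ia, ix])).node (l := []) (r := [ix]) a).of_eq
    ((Category.id_comp _).trans (wireWhisker_right _ _ _ _ _))

lemma draws_xy : (diagram g Φ).Draws [ix, yx] [x, y] [xo, yx] Φ := by
  have h : (diagram g Φ).Draws [ix, yx] [x] [xo, xy] Φ :=
    ((Draws.start (d := diagram g Φ) (L := [ix, yx])).node (l := []) (r := []) x).of_eq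
      ((Category.id_comp _).trans (wireWhisker_two _ _ _ _ _ _))
  exact (h.node (l := [xo]) (r := []) y).of_eq ((congrArg (Φ ≫ ·)
    (wireWhisker_id (diagram g Φ).obj [xo] [] [xy])).trans (Category.comp_id _))

lemma draws_axy : (diagram g Φ).Draws [ia, ix, yx] [a, x, y] [ao, xo, yx]
    (g ▷ (H ⊗ X) ≫ B ◁ Φ) := by
  have h : (diagram g Φ).Draws [ia, ix, yx] [a] [ao, ix, yx] (g ▷ (H ⊗ X)) :=
    ((Draws.start (d := diagram g Φ) (L := [ia, ix, yx])).node (l := []) (r := [ix, yx]) a).of_eq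
      ((Category.id_comp _).trans (wireWhisker_right_two _ _ _ _ _ _))
  have h1 : (diagram g Φ).Draws [ia, ix, yx] [a, x] [ao, xo, xy] (g ▷ (H ⊗ X) ≫ B ◁ Φ) :=
    (h.node (l := [ao]) (r := []) x).of_eq
      (congrArg (g ▷ (H ⊗ X) ≫ ·) (wireWhisker_left_two _ _ _ _ _ _ _))
  exact (h1.node (l := [ao, xo]) (r := []) y).of_eq ((congrArg ((g ▷ (H ⊗ X) ≫ B ◁ Φ) ≫ ·)
    (wireWhisker_id (diagram g Φ).obj [ao, xo] [] [xy])).trans (Category.comp_id _))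

/-- The process at `a` is embedded. -/
lemma isMorphism_embed : (diagram g Φ).IsMorphism Ξ {yx}
    (F.map (g ▷ H) ≫ δ F B H ≫ F.obj B ◁ Ξ H K X Φ ≫ μ F B K) := by
  refine ⟨[a, x, y], nodup_internal, mem_internal, ?_⟩
  have h : (diagram g Φ).Reglues Ξ {yx} [a] [ao, ix] (F.map (g ▷ H)) :=
    (Reglues.start.embed (draws_a g Φ)).of_eq (Category.id_comp _)
  exact (Reglues.glue (l := [ao]) (r := []) (H := [ix]) (K := [xo]) (E := [yx]) h
      isGluingGroup_yx (draws_xy g Φ) (by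
        rintro _ h
        cases List.mem_singleton.1 h
        exact List.mem_map_of_mem (f := Subtype.val) (a := x) (by simp))).of_eq
      (congrArg (F.map (g ▷ H) ≫ ·) ((wireWhiskerMap_left _ F _ _ _ _).trans
        (congrArg (fun t => δ F B H ≫ F.obj B ◁ Ξ H K X t ≫ μ F B K)
          ((Category.id_comp _).trans (Category.comp_id _)))))

/-- The process at `a` is part of the piece which is reglued. -/
lemma isMorphism_glue : (diagram g Φ).IsMorphism Ξ {yx}
    (Ξ (A ⊗ H) (B ⊗ K) X ((α_ A H X).hom ≫ (g ⊗ₘ Φ) ≫ (α_ B K X).inv)) := by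
  refine ⟨[a, x, y], nodup_internal, mem_internal, ?_⟩
  refine (Reglues.glue (l := []) (r := []) (H := [ia, ix]) (K := [ao, xo]) (E := [yx])
      Reglues.start isGluingGroup_yx (draws_axy g Φ) (by
        rintro _ h
        cases List.mem_singleton.1 h
        exact List.mem_map_of_mem (f := Subtype.val) (a := x) (by simp))).of_eq
      ((Category.id_comp _).trans ((wireWhiskerMap_two _ F _ _ _ _ _).trans
        (congrArg (Ξ (A ⊗ H) (B ⊗ K) X) ?_)))
  have key : ∀ {A B H K X : C} (g : A ⟶ B) (Φ : H ⊗ X ⟶ K ⊗ X),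
      ((α_ A H X).hom ≫ A ◁ 𝟙 _) ≫ (g ▷ (H ⊗ X) ≫ B ◁ Φ) ≫ B ◁ 𝟙 _ ≫ (α_ B K X).inv =
        (α_ A H X).hom ≫ (g ⊗ₘ Φ) ≫ (α_ B K X).inv := by
    intros; simp [MonoidalCategory.tensorHom_def]
  exact key g Φ

end Diagram

end Strands

/-! ### The laws of a super-operator yielding well-defined morphisms -/

section Converse

open Functor.LaxMonoidal Functor.OplaxMonoidal

variable {C : Type u₁} [Category.{v₁} C] [MonoidalCategory C] [SymmetricCategory C]
variable {D : Type u₂} [Category.{v₂} D] [MonoidalCategory D]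
variable {F : C ⥤ D} [F.Monoidal] {Ξ : SuperOperator F}

/-- Each law equates two morphisms defined by the same diagram, or, for vanishing, expresses the
compatibility with the embedding. -/
lemma SuperOperator.IsWellDefined.isTimeTravel (h : Ξ.IsWellDefined) (h' : Ξ.RespectsEmbedding) :
    Ξ.IsTimeTravel where
  naturality {H H' K K' X} f Φ g := by
    have := h.eq Loop.isCVLocal (Loop.isCut (Or.inr rfl)) (Loop.isCut (Or.inr rfl))
      (Loop.isMorphism_glue f Φ (𝟙 X) g Ξ) (Loop.isMorphism_yx f Φ (𝟙 X) g Ξ)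
    rwa [whiskerLeft_id, Category.comp_id] at this
  strength {A B H K X} g Φ := by
    have := h.eq Strands.isCVLocal Strands.isCut_yx Strands.isCut_yx
      (Strands.isMorphism_glue g Φ Ξ) (Strands.isMorphism_embed g Φ Ξ)
    have e : F.map (g ▷ H) ≫ δ F B H ≫ F.obj B ◁ Ξ H K X Φ ≫ μ F B K =
        δ F A H ≫ (F.map g ⊗ₘ Ξ H K X Φ) ≫ μ F B K := by
      rw [← δ_natural_left_assoc, MonoidalCategory.tensorHom_def, Category.assoc]
    exact Eq.trans this e
  sliding {H K X Y} Φ f := by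
    have := h.eq Loop.isCVLocal (Loop.isCut (Or.inr rfl)) (Loop.isCut (Or.inl rfl))
      (Loop.isMorphism_yx (𝟙 H) Φ f (𝟙 K) Ξ) (Loop.isMorphism_xy (𝟙 H) Φ f (𝟙 K) Ξ)
    refine (Eq.trans ?_ this).trans ?_
    · exact (by simp : Ξ H K X (Φ ≫ K ◁ f) = F.map (𝟙 H) ≫ Ξ H K X (Φ ≫ K ◁ f) ≫ F.map (𝟙 K))
    · exact (by simp : F.map (𝟙 H) ≫ Ξ H K Y (H ◁ f ≫ Φ) ≫ F.map (𝟙 K) = Ξ H K Y (H ◁ f ≫ Φ))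
  vanishing {H K} Φ := by
    refine Eq.trans ?_ (h' Segment.graph Segment.isCR _ _
      (Segment.isCRMorphism ((ρ_ H).inv ≫ Φ ≫ (ρ_ K).hom)))
    exact congrArg (Ξ H K (𝟙_ C)) (by simp : Φ =
      (ρ_ H).hom ≫ ((ρ_ H).inv ≫ Φ ≫ (ρ_ K).hom) ≫ (ρ_ K).inv)

end Converse

theorem mainTheorem2
    {C : Type u₁} [Category.{v₁} C] [MonoidalCategory C] [SymmetricCategory C]
    {D : Type u₂} [Category.{v₂} D] [MonoidalCategory D] [SymmetricCategory D]
    (F : C ⥤ D) [F.Braided] [F.Faithful] (Ξ : SuperOperator F) :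
    (Ξ.IsTimeTravel → Ξ.IsWellDefined) ∧
      (Ξ.IsWellDefined → Ξ.RespectsEmbedding → Ξ.IsTimeTravel) :=
  ⟨fun h => h.isWellDefined, fun h h' => h.isTimeTravel h'⟩
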